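/- **Theorem.** Let $M$ be an oriented smooth (Hausdorff, boundaryless) $n$-manifold, $W$ a finite-dimensional real vector space, and $\hat TM = TM\oplus(M\times W)$ the super tangent bundle with even part $TM$, odd part $M\times W$ and super Lie bracket $[U+\alpha,V+\beta]=[U,V]+U(\beta)-V(\alpha)$; odd fields act on functions by zero. Let $\langle\cdot,\cdot\rangle$ be a super metric on $M$, i.e. a semi-Riemannian metric on $TM$ together with a smooth family of symplectic forms on $W$, with $TM\perp W$, and let $\nabla$ be its Levi-Civita super connection (the torsion free super connection compatible with the metric). A super differential form of order $r$ is a smooth field $\tilde\eta$ of $r$-linear forms on $\hat TM$ such that exchanging two neighbouring homogeneous arguments $v,w$ multiplies the value by $-(-1)^{|v||w|}$; it has pair order $(k,l)$ if it vanishes on homogeneous arguments unless exactly $k$ are even and $l$ are odd, and then $|\tilde\eta|=k \bmod 2$ is its first parity. Conventions, for homogeneous $\mathbf U,\mathbf U_i$ (everything being extended linearly to sums of forms of several pair orders): * insertion: $(i_{\mathbf U}\tilde\eta)(\mathbf U_1,\dots,\mathbf U_{r-1})=(-1)^{|\tilde\eta||\mathbf U|}\,\tilde\eta(\mathbf U,\mathbf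 U_1,\dots,\mathbf U_{r-1})$, and $i_{\mathbf U}$ vanishes on forms of order $0$; * covariant derivative: $(\nabla_{\mathbf U}\tilde\eta)(\mathbf U_1,\dots,\mathbf U_r)=\mathbf U\big(\tilde\eta(\mathbf U_1,\dots,\mathbf U_r)\big)-\sum_{i}(-1)^{|\mathbf U|(|\tilde\eta|+|\mathbf U_1|+\dots+|\mathbf U_{i-1}|)}\,\tilde\eta(\mathbf U_1,\dots,\nabla_{\mathbf U}\mathbf U_i,\dots,\mathbf U_r)$, where $|\tilde\eta|$ is the first parity of the component of $\tilde\eta$ that is evaluated; * divergence: for $\tilde\eta$ of pair order $(k,l)$ with $k\ge 1$, $\delta\tilde\eta=(-1)^{n(k+1)+s+1}\,H\,d\,H\,\tilde\eta$, and $\delta\tilde\eta=0$ for $k=0$. Here $s$ is the number of negative vectors in an orthonormal basis of the tangent space, $H(\omega\otimes\xi)=H(\omega)\otimes\xi$ is the Hodge operator acting on the alternating part (with $\omega\wedge H(\varphi)=\langle\omega,\varphi\rangle\Omega$ for the volume form $\Omega$), and $d$ is the super exterior derivation $$(d\tilde\omega)(\mathbf U_1,\dots,\mathbf U_{r+1})=\sum_i(-1)^{i+1+|\mathbf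 U_i|\sum_{a<i}|\mathbf U_a|}\,\mathbf U_i\big(\tilde\omega(\dots,\hat{\mathbf U}_i,\dots)\big)+\sum_{i<j}(-1)^{i+j+|\mathbf U_i|\sum_{a<i}|\mathbf U_a|+|\mathbf U_j|\sum_{a<j,\,a\ne i}|\mathbf U_a|}\,\tilde\omega([\mathbf U_i,\mathbf U_j],\dots,\hat{\mathbf U}_i,\dots,\hat{\mathbf U}_j,\dots).$$ Let $\{E_1,\dots,E_n,\alpha_1,\dots,\alpha_m\}$ be a homogeneous local base of $\hat TM$ on an open set $U\subseteq M$ (the $E_i$ even, the $\alpha_j$ odd) and $\{E^1,\dots,E^n,\alpha^1,\dots,\alpha^m\}$ its reciprocal base, $\langle E^j,E_i\rangle=\delta^j_i$ and $\langle\alpha^j,\alpha_i\rangle=\delta^j_i$. Then, for every super differential form $\tilde\eta$, on $U$ $$\delta\tilde\eta=-\sum_i i_{E^i}\big(\nabla_{E_i}\tilde\eta\big)+\sum_j\nabla_{\alpha^j}\big(i_{\alpha_j}\tilde\eta\big).$$ (Since $\{E_1,\dots,E_n,-\alpha_1,\dots,-\alpha_m\}$ is the reciprocal base of $\{E^i,\alpha^j\}$,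 the last sum equals $-\sum_j\nabla_{\alpha_j}\big(i_{\alpha^j}\tilde\eta\big)$.) -/

import Mathlib

open scoped Manifold ContDiff

noncomputable section

namespace SuperGeometry

/-! ### Tensors on a super vector space `V₀ ⊕ V₁` -/

section Algebra

variable {V₀ V₁ : Type*} [AddCommGroup V₀] [Module ℝ V₀] [AddCommGroup V₁] [Module ℝ V₁]

/-- A vector of `V₀ ⊕ V₁` has parity `0` if it lies in `V₀` and parity `1` if it lies in `V₁`. -/
def HasParity (ε : Fin 2) (v : V₀ × V₁) : Prop :=
  if ε = 0 then v.2 = 0 else v.1 = 0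

/-- The projection of `V₀ ⊕ V₁` onto its even part, as an endomorphism. -/
def evenPart : V₀ × V₁ →ₗ[ℝ] V₀ × V₁ := LinearMap.prodMap LinearMap.id 0

/-- The projection of `V₀ ⊕ V₁` onto its odd part, as an endomorphism. -/
def oddPart : V₀ × V₁ →ₗ[ℝ] V₀ × V₁ := LinearMap.prodMap 0 LinearMap.id

variable (V₀ V₁) in
/-- Covariant tensors of order `r` on `V₀ ⊕ V₁`. -/
abbrev SuperTensor (r : ℕ) : Type _ := MultilinearMap ℝ (fun _ : Fin r => V₀ × V₁) ℝ

/-- `T` is super alternating: exchanging two neighbouring homogeneous arguments `v, w` multiplies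
the value by `-(-1)^(|v||w|)`. -/
def IsSuperAlternating {r : ℕ} (T : SuperTensor V₀ V₁ r) : Prop :=
  ∀ (v : Fin r → V₀ × V₁) (ε : Fin r → Fin 2), (∀ i, HasParity (ε i) (v i)) →
    ∀ i j : Fin r, (i : ℕ) + 1 = j →
      T v = -(-1 : ℝ) ^ ((ε i : ℕ) * (ε j : ℕ)) * T (v ∘ Equiv.swap i j)

/-- The sign `(-1)^(|T| a)`, where `|T|` is the first parity of `T` (the number of even arguments
modulo `2`). For `a = 1` every even argument contributes a factor `-1`, so that a
tensor of pair order `(k, l)` is multiplied by `(-1)^k`. -/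
def firstParitySign {r : ℕ} (a : Fin 2) (T : SuperTensor V₀ V₁ r) : SuperTensor V₀ V₁ r :=
  if a = 0 then T
  else T.compLinearMap (fun _ => LinearMap.prodMap (-LinearMap.id) LinearMap.id)

/-- Insertion `i_v`: for homogeneous `v`, `(i_v T)(v₁, …) = (-1)^(|T||v|) T(v, v₁, …)`, extended
linearly in `v`; it vanishes on tensors of order zero. -/
def insertion : {r : ℕ} → V₀ × V₁ → SuperTensor V₀ V₁ r → SuperTensor V₀ V₁ (r - 1)
  | 0, _, _ => 0
  | _ + 1, v, T => T.curryLeft (evenPart v) + (firstParitySign 1 T).curryLeft (oddPart v)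

/-- Fill the first `k` slots of a multilinear map with the vectors `u`. -/
def fillFirst {V : Type*} [AddCommGroup V] [Module ℝ V] {k j : ℕ}
    (T : MultilinearMap ℝ (fun _ : Fin (k + j) => V) ℝ) (u : Fin k → V) :
    MultilinearMap ℝ (fun _ : Fin j => V) ℝ :=
  (T.domDomCongr finSumFinEquiv.symm).currySum u

/-- `σ` is a shuffle: increasing on the first `j` and on the last `l` indices. -/
def IsShuffle (j l : ℕ) (σ : Equiv.Perm (Fin (j + l))) : Prop :=
  StrictMono (σ ∘ Fin.castAdd l) ∧ StrictMono (σ ∘ Fin.natAdd j)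

open scoped Classical in
/-- The extension, to all arguments, of the values of `f` on `j` even vectors followed by `l` odd
vectors. If `f` is alternating in the former and symmetric in the latter, this is the
unique super alternating tensor of pair order `(j, l)` with these values: a summand has the sign
`-1` for each odd argument that stands before an even one. -/
def superExtend (j l : ℕ) (f : SuperTensor V₀ V₁ (j + l)) : SuperTensor V₀ V₁ (j + l) :=
  ∑ σ : Equiv.Perm (Fin (j + l)) with IsShuffle j l σ,
    ((Equiv.Perm.sign σ : ℤ) : ℝ) •
      (f.compLinearMap (fun i => if (i : ℕ) < j then evenPart else oddPart)).domDomCongr σ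

/-- An orthonormal basis of a (possibly indefinite) inner product. -/
def IsOrthonormalBasis {n : ℕ} (B : LinearMap.BilinForm ℝ V₀) (e : Module.Basis (Fin n) ℝ V₀) :
    Prop :=
  (∀ i j, i ≠ j → B (e i) (e j) = 0) ∧ ∀ i, B (e i) (e i) = 1 ∨ B (e i) (e i) = -1

open scoped Classical in
/-- The canonical volume tensor `e¹ ∧ ⋯ ∧ eⁿ` of an oriented inner product space, where `e` is a
positively oriented orthonormal basis (the sign is reversed for a negatively oriented one). -/
def volumeTensor {n : ℕ} (B : LinearMap.BilinForm ℝ V₀) (o : Orientation ℝ V₀ (Fin n)) :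
    V₀ [⋀^Fin n]→ₗ[ℝ] ℝ :=
  if h : ∃ e : Module.Basis (Fin n) ℝ V₀, IsOrthonormalBasis B e then
    if h.choose.orientation = o then h.choose.det else -h.choose.det
  else 0

/-- The Hodge operator on super alternating tensors of pair order `(k, l)`, where `n = k + j` is
the dimension of `V₀`: it is `H(ω ⊗ ξ) = H(ω) ⊗ ξ` with `H(ω) = i_ω Ω`, where
`i_{β₁ ∧ ⋯ ∧ βₖ} = i_{βₖ} ∘ ⋯ ∘ i_{β₁}` and `i_β` is the insertion of the vector `β♭` with
`⟨β♭, v⟩ = β v`. In terms of any basis `b` of `V₀` (with dual basis `b^a`), on `j` even vectors `v`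
followed by `l` odd vectors `w` its value is
`(1 / k!) ∑ₐ Ω((b^{a₁})♭, …, (b^{aₖ})♭, v) T(b_{a₁}, …, b_{aₖ}, w)`.
Only the component of `T` of pair order `(k, l)` contributes. -/
def hodge [FiniteDimensional ℝ V₀] {n : ℕ} (B : LinearMap.BilinForm ℝ V₀) (hB : B.Nondegenerate)
    (o : Orientation ℝ V₀ (Fin n)) {r r' : ℕ} (k l j : ℕ) (hr : r = k + l) (hr' : r' = j + l)
    (hn : n = k + j) (T : SuperTensor V₀ V₁ r) : SuperTensor V₀ V₁ r' :=
  (superExtend j l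
    (((Nat.factorial k : ℝ)⁻¹) • ∑ a : Fin k → Fin (Module.finrank ℝ V₀),
      ((LinearMap.mul' ℝ ℝ).compMultilinearMap
        (((fillFirst ((volumeTensor B o).toMultilinearMap.domDomCongr (finCongr hn))
            (fun i => (B.toDual hB).symm ((Module.finBasis ℝ V₀).coord (a i)))).compLinearMap
              (fun _ => LinearMap.fst ℝ V₀ V₁)).domCoprod
          (fillFirst (T.domDomCongr (finCongr hr))
            (fun i => (Module.finBasis ℝ V₀ (a i), (0 : V₁)))))).domDomCongr
        finSumFinEquiv)).domDomCongr (finCongr hr'.symm)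

end Algebra

/-! ### The super tangent bundle `TM ⊕ (M × W)` and its sections -/

section Manifold

variable (n : ℕ) (M : Type*) [TopologicalSpace M] [ChartedSpace (EuclideanSpace ℝ (Fin n)) M]
  [IsManifold (𝓡 n) ∞ M]
  (W : Type*) [NormedAddCommGroup W] [NormedSpace ℝ W]

/-- The fibre `T_pM ⊕ W` of the super tangent bundle. -/
abbrev SuperTangent (p : M) : Type _ := TangentSpace (𝓡 n) p × W

/-- (Not necessarily smooth) super vector fields. -/
abbrev SuperField : Type _ := ∀ p : M, SuperTangent n M W p

/-- (Not necessarily smooth) fields of covariant tensors of order `r` on the super tangent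
bundle. -/
abbrev SuperTensorField (r : ℕ) : Type _ := ∀ p : M, SuperTensor (TangentSpace (𝓡 n) p) W r

variable {n M W}

/-- Smoothness of a super vector field on a set. -/
def SmoothFieldOn (X : SuperField n M W) (U : Set M) : Prop :=
  ContMDiffOn (𝓡 n) ((𝓡 n).prod 𝓘(ℝ, EuclideanSpace ℝ (Fin n))) ∞
    (fun p => (⟨p, (X p).1⟩ : TangentBundle (𝓡 n) M)) U ∧
  ContMDiffOn (𝓡 n) 𝓘(ℝ, W) ∞ (fun p => (X p).2) U

/-- Smoothness of a real function on a set. -/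
def SmoothFunOn (f : M → ℝ) (U : Set M) : Prop := ContMDiffOn (𝓡 n) 𝓘(ℝ, ℝ) ∞ f U

/-- The action of a super tangent vector on a function; odd vectors act by zero. -/
def act (f : M → ℝ) (p : M) (v : SuperTangent n M W p) : ℝ := mfderiv (𝓡 n) 𝓘(ℝ, ℝ) f p v.1

/-- The derivative `v(f)` of a `W`-valued function (such as an odd field); odd vectors act by
zero. -/
def actVec (f : M → W) (p : M) (v : SuperTangent n M W p) : W := mfderiv (𝓡 n) 𝓘(ℝ, W) f p v.1

/-- The super Lie bracket `[U + α, V + β] = [U, V] + U(β) - V(α)`. -/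
def superBracket (X Y : SuperField n M W) : SuperField n M W := fun p =>
  (VectorField.mlieBracket (𝓡 n) (fun q => (X q).1) (fun q => (Y q).1) p,
    actVec (fun q => (Y q).2) p (X p) - actVec (fun q => (X q).2) p (Y p))

/-- A super differential form of order `r`: a smooth field of super alternating tensors. -/
structure IsSuperForm {r : ℕ} (η : SuperTensorField n M W r) : Prop where
  alternating : ∀ p, IsSuperAlternating (η p)
  smooth : ∀ U : Set M, IsOpen U → ∀ X : Fin r → SuperField n M W, (∀ i, SmoothFieldOn (X i) U) →
    SmoothFunOn (n := n) (fun p => η p (fun i => X i p)) U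

/-! ### Super exterior derivation -/

/-- The first sum in the formula for `dη(X₀, …, X_r)`, for `X i` of parity `ε i`. -/
def extDerivSumAct {r : ℕ} (η : SuperTensorField n M W r) (ε : Fin (r + 1) → Fin 2)
    (X : Fin (r + 1) → SuperField n M W) (p : M) : ℝ :=
  ∑ i : Fin (r + 1), (-1 : ℝ) ^ ((i : ℕ) + (ε i : ℕ) * ∑ a ∈ Finset.Iio i, (ε a : ℕ)) *
    act (fun q => η q (i.removeNth fun a => X a q)) p (X i p)

/-- The second sum in the formula for `dη(X₀, …, X_r)`, for `X i` of parity `ε i`: a sum over all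
pairs `i' < j'`, enumerated as `i' = i.castSucc`, `j' = j.succ` with `i ≤ j`. The indices are
counted from `0`, so that the sign `(-1)^(i' + j')` is `(-1)^(i + j + 1)`. -/
def extDerivSumBracket : {r : ℕ} → SuperTensorField n M W r → (Fin (r + 1) → Fin 2) →
    (Fin (r + 1) → SuperField n M W) → M → ℝ
  | 0, _, _, _, _ => 0
  | r + 1, η, ε, X, p =>
    ∑ i : Fin (r + 1), ∑ j ∈ Finset.Ici i,
      (-1 : ℝ) ^ ((i : ℕ) + (j : ℕ) + 1
          + (ε i.castSucc : ℕ) * (∑ a ∈ Finset.Iio i.castSucc, (ε a : ℕ))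
          + (ε j.succ : ℕ) * (∑ a ∈ (Finset.Iio j.succ).erase i.castSucc, (ε a : ℕ))) *
        η p (Fin.cons (superBracket (X i.castSucc) (X j.succ) p)
          (j.removeNth (i.castSucc.removeNth fun a => X a p)))

/-- `D` is the value at `p` of the super exterior derivative of `η`: the defining formula holds for
all smooth homogeneous super vector fields near `p`. -/
def IsExtDerivAt {r : ℕ} (η : SuperTensorField n M W r) (p : M)
    (D : SuperTensor (TangentSpace (𝓡 n) p) W (r + 1)) : Prop :=
  ∀ U : Set M, IsOpen U → p ∈ U → ∀ (ε : Fin (r + 1) → Fin 2) (X : Fin (r + 1) → SuperField n M W),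
    (∀ i, SmoothFieldOn (X i) U) → (∀ i, ∀ q ∈ U, HasParity (ε i) (X i q)) →
      D (fun i => X i p) = extDerivSumAct η ε X p + extDerivSumBracket η ε X p

open scoped Classical in
/-- The super exterior derivative `dη` (zero at points where the defining formula does not
determine a tensor, which does not happen for super differential forms). -/
def superExtDeriv {r : ℕ} (η : SuperTensorField n M W r) : SuperTensorField n M W (r + 1) :=
  fun p => if h : ∃ D, IsExtDerivAt η p D then h.choose else 0

/-! ### Super metrics, orientations, divergence -/

variable (n M W) in
/-- A super metric on `M`: a semi-Riemannian metric on `TM` together with a smooth family of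
symplectic forms on `W`; even and odd vectors are orthogonal. -/
structure SuperMetric where
  even : ∀ p : M, LinearMap.BilinForm ℝ (TangentSpace (𝓡 n) p)
  odd : M → LinearMap.BilinForm ℝ W
  even_symm : ∀ p, (even p).IsSymm
  even_nondegenerate : ∀ p, (even p).Nondegenerate
  odd_alt : ∀ p, (odd p).IsAlt
  odd_nondegenerate : ∀ p, (odd p).Nondegenerate
  smooth : ∀ U : Set M, IsOpen U → ∀ X Y : SuperField n M W, SmoothFieldOn X U →
    SmoothFieldOn Y U →
      SmoothFunOn (n := n) (fun p => even p (X p).1 (Y p).1 + odd p (X p).2 (Y p).2) U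

/-- The super inner product `⟨v, w⟩` at `p`. -/
def SuperMetric.inner (g : SuperMetric n M W) (p : M) (v w : SuperTangent n M W p) : ℝ :=
  g.even p v.1 w.1 + g.odd p v.2 w.2

variable (n M) in
/-- An orientation of `M`: a choice of orientations of the tangent spaces such that, around each
point, some smooth frame is everywhere positively or everywhere negatively oriented. -/
structure ManifoldOrientation where
  at_ : ∀ p : M, Orientation ℝ (TangentSpace (𝓡 n) p) (Fin n)
  smooth : ∀ p : M, ∃ U : Set M, IsOpen U ∧ p ∈ U ∧
    ∃ X : Fin n → ∀ q : M, TangentSpace (𝓡 n) q,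
      (∀ i, ContMDiffOn (𝓡 n) ((𝓡 n).prod 𝓘(ℝ, EuclideanSpace ℝ (Fin n))) ∞
        (fun q => (⟨q, X i q⟩ : TangentBundle (𝓡 n) M)) U) ∧
      ((∀ q ∈ U, ∃ b : Module.Basis (Fin n) ℝ (TangentSpace (𝓡 n) q),
          (∀ i, b i = X i q) ∧ b.orientation = at_ q) ∨
        (∀ q ∈ U, ∃ b : Module.Basis (Fin n) ℝ (TangentSpace (𝓡 n) q),
          (∀ i, b i = X i q) ∧ b.orientation = -at_ q))

instance (p : M) : FiniteDimensional ℝ (TangentSpace (𝓡 n) p) :=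
  inferInstanceAs (FiniteDimensional ℝ (EuclideanSpace ℝ (Fin n)))

/-- The Hodge operator on super differential forms of pair order `(k, l)`. -/
def hodgeField (g : SuperMetric n M W) (o : ManifoldOrientation n M) {r r' : ℕ} (k l j : ℕ)
    (hr : r = k + l) (hr' : r' = j + l) (hn : n = k + j) (η : SuperTensorField n M W r) :
    SuperTensorField n M W r' :=
  fun p => hodge (g.even p) (g.even_nondegenerate p) (o.at_ p) k l j hr hr' hn (η p)

/-- The number `s` of negative vectors in an orthonormal basis of `T_pM`. -/
def SuperMetric.negIndex (g : SuperMetric n M W) (p : M) : ℕ :=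
  sigNeg (LinearMap.BilinMap.toQuadraticMap (g.even p))

/-- The divergence of the component of pair order `(k, l)` of a super differential form `η` of order
`r = k + l`: it is `(-1)^(n(k+1)+s+1) H d H η` for `1 ≤ k` and zero for `k = 0`. (For `k > n` there
are no nonzero forms of pair order `(k, l)`.) -/
def pairDivergence (g : SuperMetric n M W) (o : ManifoldOrientation n M) {r : ℕ} (k l : ℕ)
    (hr : r = k + l) (η : SuperTensorField n M W r) : SuperTensorField n M W (r - 1) :=
  fun p =>
    if h : 1 ≤ k ∧ k ≤ n then
      (-1 : ℝ) ^ (n * (k + 1) + g.negIndex p + 1) •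
        hodgeField g o (n - k + 1) l (k - 1) (r := n - k + l + 1) (by omega) (by omega) (by omega)
          (superExtDeriv (hodgeField g o k l (n - k) hr rfl (by omega) η)) p
    else 0

/-- The divergence `δη` of a super differential form of order `r`: the sum of the divergences of its
components of pair orders `(k, r - k)`. -/
def divergence (g : SuperMetric n M W) (o : ManifoldOrientation n M) {r : ℕ}
    (η : SuperTensorField n M W r) : SuperTensorField n M W (r - 1) :=
  fun p => ∑ k : Fin (r + 1), pairDivergence g o (k : ℕ) (r - k) (by omega) η p

/-! ### Super connections -/

variable (n M W) in
/-- A super connection on `M`: `cov Y p v` is `∇_v Y` at `p`. It is tensorial in the direction `v`,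
satisfies the Leibniz rule in `Y`, preserves parities and maps smooth fields to smooth fields. (Its
values on fields that are not smooth near `p` are irrelevant.) -/
structure SuperConnection where
  cov : SuperField n M W → ∀ p : M, SuperTangent n M W p →ₗ[ℝ] SuperTangent n M W p
  add : ∀ U : Set M, IsOpen U → ∀ Y Z : SuperField n M W, SmoothFieldOn Y U → SmoothFieldOn Z U →
    ∀ p ∈ U, cov (fun q => Y q + Z q) p = cov Y p + cov Z p
  leibniz : ∀ U : Set M, IsOpen U → ∀ (f : M → ℝ) (Y : SuperField n M W),
    SmoothFunOn (n := n) f U → SmoothFieldOn Y U → ∀ p ∈ U, ∀ v : SuperTangent n M W p,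
      cov (fun q => f q • Y q) p v = act f p v • Y p + f p • cov Y p v
  parity : ∀ U : Set M, IsOpen U → ∀ (Y : SuperField n M W) (a b : Fin 2), SmoothFieldOn Y U →
    (∀ q ∈ U, HasParity b (Y q)) → ∀ p ∈ U, ∀ v : SuperTangent n M W p, HasParity a v →
      HasParity (a + b) (cov Y p v)
  smooth : ∀ U : Set M, IsOpen U → ∀ X Y : SuperField n M W, SmoothFieldOn X U →
    SmoothFieldOn Y U → SmoothFieldOn (fun p => cov Y p (X p)) U

/-- The super torsion vanishes: `∇_X Y - (-1)^(|X||Y|) ∇_Y X = [X, Y]`. -/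
def SuperConnection.IsTorsionFree (C : SuperConnection n M W) : Prop :=
  ∀ U : Set M, IsOpen U → ∀ (X Y : SuperField n M W) (a b : Fin 2),
    SmoothFieldOn X U → SmoothFieldOn Y U →
    (∀ q ∈ U, HasParity a (X q)) → (∀ q ∈ U, HasParity b (Y q)) → ∀ p ∈ U,
      C.cov Y p (X p) - (-1 : ℝ) ^ ((a : ℕ) * (b : ℕ)) • C.cov X p (Y p) = superBracket X Y p

/-- Compatibility with a super metric: `X⟨Y, Z⟩ = ⟨∇_X Y, Z⟩ + (-1)^(|X||Y|) ⟨Y, ∇_X Z⟩`. -/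
def SuperConnection.IsCompatible (C : SuperConnection n M W) (g : SuperMetric n M W) : Prop :=
  ∀ U : Set M, IsOpen U → ∀ (Y Z : SuperField n M W) (a b : Fin 2),
    SmoothFieldOn Y U → SmoothFieldOn Z U → (∀ q ∈ U, HasParity b (Y q)) →
    ∀ p ∈ U, ∀ v : SuperTangent n M W p, HasParity a v →
      act (fun q => g.inner q (Y q) (Z q)) p v =
        g.inner p (C.cov Y p v) (Z p) + (-1 : ℝ) ^ ((a : ℕ) * (b : ℕ)) * g.inner p (Y p) (C.cov Z p v)

/-- `C` is the Levi-Civita super connection of `g`: torsion free and compatible with `g`. -/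
def SuperConnection.IsLeviCivita (C : SuperConnection n M W) (g : SuperMetric n M W) : Prop :=
  C.IsTorsionFree ∧ C.IsCompatible g

/-- `D` is the covariant derivative of `η` at `p`, `D v` being `∇_v η`: for `v` of parity `a` and
smooth fields `X i` of parity `ε i` near `p`,
`v(η(X₁, …, X_r)) = (∇_v η)(X₁, …, X_r)
  + ∑ᵢ (-1)^(a |η| + a (ε₁ + ⋯ + ε_{i-1})) η(X₁, …, ∇_v X_i, …, X_r)`,
where `|η|` is the first parity. -/
def IsCovDerivAt (C : SuperConnection n M W) {r : ℕ} (η : SuperTensorField n M W r) (p : M)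
    (D : SuperTangent n M W p →ₗ[ℝ] SuperTensor (TangentSpace (𝓡 n) p) W r) : Prop :=
  ∀ U : Set M, IsOpen U → p ∈ U → ∀ (v : SuperTangent n M W p) (a : Fin 2), HasParity a v →
    ∀ (ε : Fin r → Fin 2) (X : Fin r → SuperField n M W),
      (∀ i, SmoothFieldOn (X i) U) → (∀ i, ∀ q ∈ U, HasParity (ε i) (X i q)) →
        act (fun q => η q (fun i => X i q)) p v =
          D v (fun i => X i p) +
            ∑ i : Fin r, (-1 : ℝ) ^ ((a : ℕ) * ∑ b ∈ Finset.Iio i, (ε b : ℕ)) *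
              firstParitySign a (η p) (Function.update (fun b => X b p) i (C.cov (X i) p v))

open scoped Classical in
/-- The covariant derivative `∇_v η` at `p` of a tensor field `η` (zero if the defining formula does
not determine a tensor, which does not happen if `η` is smooth near `p`). -/
def SuperConnection.covTensor (C : SuperConnection n M W) {r : ℕ} (η : SuperTensorField n M W r)
    (p : M) (v : SuperTangent n M W p) : SuperTensor (TangentSpace (𝓡 n) p) W r :=
  if h : ∃ D, IsCovDerivAt C η p D then h.choose v else 0

/-! ### Homogeneous local bases -/

/-- `E₁, …, E_n, α₁, …, α_m` is a homogeneous local base of the super tangent bundle on `U`: the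
`E i` are smooth even fields on `U` which are bases of the tangent spaces, and the `α j` are smooth
odd fields on `U` whose values are bases of `W`. -/
structure IsHomogeneousBaseOn {m : ℕ} (E : Fin n → SuperField n M W) (α : Fin m → SuperField n M W)
    (U : Set M) : Prop where
  smooth_even : ∀ i, SmoothFieldOn (E i) U
  smooth_odd : ∀ j, SmoothFieldOn (α j) U
  even : ∀ i, ∀ p ∈ U, HasParity 0 (E i p)
  odd : ∀ j, ∀ p ∈ U, HasParity 1 (α j p)
  even_independent : ∀ p ∈ U, LinearIndependent ℝ (fun i => (E i p).1)
  even_span : ∀ p ∈ U, Submodule.span ℝ (Set.range fun i => (E i p).1) = ⊤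
  odd_independent : ∀ p ∈ U, LinearIndependent ℝ (fun j => (α j p).2)
  odd_span : ∀ p ∈ U, Submodule.span ℝ (Set.range fun j => (α j p).2) = ⊤

/-- `E', α'` is the reciprocal base of `E, α` on `U`: its members are homogeneous of the same
parities, and `⟨E'^j, E_i⟩ = δ_i^j`, `⟨α'^j, α_i⟩ = δ_i^j`. -/
structure IsReciprocalBaseOn (g : SuperMetric n M W) {m : ℕ} (E E' : Fin n → SuperField n M W)
    (α α' : Fin m → SuperField n M W) (U : Set M) : Prop where
  even : ∀ i, ∀ p ∈ U, HasParity 0 (E' i p)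
  odd : ∀ j, ∀ p ∈ U, HasParity 1 (α' j p)
  inner_even : ∀ i j, ∀ p ∈ U, g.inner p (E' j p) (E i p) = if i = j then 1 else 0
  inner_odd : ∀ i j, ∀ p ∈ U, g.inner p (α' j p) (α i p) = if i = j then 1 else 0

end Manifold

end SuperGeometry

end

/-! The divergence is built from the super bracket, the metric of `TM` and the volume form, while
the right-hand side uses the whole Levi-Civita super connection `∇`. The proof passes through a
third derivative, the flat derivative `∇⁰` (`SuperConnection.flat`). It exists in even directions
only, equals `∇` on the even part of a field, and differentiates the odd part as a `W`-valued
function. Two properties make it useful. First, the super bracket is `[X, Y] = ∇⁰_X Y - ∇⁰_Y X`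
(`SuperConnection.IsTorsionFree.superBracket_eq`). Second, the metric of `TM` is `∇⁰`-parallel
(`SuperConnection.IsCompatible.hasDerivAlong_even`). The symplectic forms need not be parallel, but
neither `d` nor `H` involves them.

By the first property, `d` is the alternation of the tensor derivative `L = ∇⁰η`
(`HasTensorDeriv.superExtDeriv_eq`). By the second, the volume tensor and hence `H` are
`∇⁰`-parallel (`HasTensorDeriv.hodgeField`). At a point, `H d H η` is therefore an algebraic
expression in `L`. The alternation contributes a sum over one frame index, the two Hodge operators
cancel up to sign, and what remains is a trace (`hodge_exterior_hodge`). After the signs are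
collected, `δη = -∑ i_{E^c} L_{E_c}` (`HasTensorDeriv.divergence_eq`).

It remains to compare `∇⁰` with `∇`. Their difference is governed by two tensors, given on constant
odd fields by `A_x w = ∇_x w` and `B(u, w) = ∇_u w`. Vanishing torsion gives `∇_u X = A_X u` for
even `X`, and compatibility gives `⟨B(u, w), x⟩ = ⟨w, A_x u⟩ = ⟨A_x w, u⟩`. Passing from `L` to `∇`
in the even sum produces terms with `A` in one slot. The odd sum differentiates nothing, because odd
vectors annihilate functions, and so consists of terms in `A` and `B` only. The two kinds of terms
cancel slot by slot (`IsSuperAlternating.sum_odd_contraction`). At an odd slot the `B` terms match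
the `A` terms of the even sum. At an even slot the `A` terms vanish, since `⟨α^k, A α^j⟩` is
antisymmetric in `j, k` and is contracted with a form that is symmetric in its odd arguments.

Two devices are used throughout. Derivatives at `p` are computed with a frame that is flat at `p`
(`ParallelFrame`), and super alternating tensors are compared on homogeneous arguments whose even
members stand first (`IsSuperAlternating.ext_sorted`). -/

set_option linter.unusedSectionVars false

noncomputable section

namespace SuperGeometry

/-! ### Signs and permutations of arguments of super alternating tensors -/

section SuperAlternating

variable {V₀ V₁ : Type*} [AddCommGroup V₀] [Module ℝ V₀] [AddCommGroup V₁] [Module ℝ V₁]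

theorem hasParity_zero_iff {v : V₀ × V₁} : HasParity 0 v ↔ v.2 = 0 := by simp [HasParity]

theorem hasParity_one_iff {v : V₀ × V₁} : HasParity 1 v ↔ v.1 = 0 := by simp [HasParity]

theorem hasParity_evenPart (v : V₀ × V₁) : HasParity 0 (evenPart v) := by
  simp [HasParity, evenPart]

theorem hasParity_oddPart (v : V₀ × V₁) : HasParity 1 (oddPart v) := by
  simp [HasParity, oddPart]

theorem evenPart_apply (v : V₀ × V₁) : evenPart v = (v.1, 0) := rfl

theorem oddPart_apply (v : V₀ × V₁) : oddPart v = (0, v.2) := rfl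

theorem evenPart_add_oddPart (v : V₀ × V₁) : evenPart v + oddPart v = v := by
  simp [evenPart, oddPart]

theorem evenPart_of_even {v : V₀ × V₁} (h : HasParity 0 v) : evenPart v = v := by
  rw [hasParity_zero_iff] at h; ext <;> simp [evenPart, h]

theorem evenPart_of_odd {v : V₀ × V₁} (h : HasParity 1 v) : evenPart v = 0 := by
  rw [hasParity_one_iff] at h; ext <;> simp [evenPart, h]

theorem oddPart_of_even {v : V₀ × V₁} (h : HasParity 0 v) : oddPart v = 0 := by
  rw [hasParity_zero_iff] at h; ext <;> simp [oddPart, h]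

theorem oddPart_of_odd {v : V₀ × V₁} (h : HasParity 1 v) : oddPart v = v := by
  rw [hasParity_one_iff] at h; ext <;> simp [oddPart, h]

theorem parity_cases (a : Fin 2) : a = 0 ∨ a = 1 := by omega

/-- Tensors agreeing on homogeneous arguments are equal. -/
theorem superTensor_ext_homogeneous {r : ℕ} {T S : SuperTensor V₀ V₁ r}
    (h : ∀ (v : Fin r → V₀ × V₁) (ε : Fin r → Fin 2), (∀ i, HasParity (ε i) (v i)) → T v = S v) :
    T = S := by
  classical
  ext v
  have hv : v = (fun i => evenPart (v i)) + fun i => oddPart (v i) := by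
    funext i; exact (evenPart_add_oddPart (v i)).symm
  rw [hv, MultilinearMap.map_add_univ, MultilinearMap.map_add_univ]
  refine Finset.sum_congr rfl fun s _ => h _ (fun i => if i ∈ s then 0 else 1) fun i => ?_
  by_cases hi : i ∈ s
  · simpa [Finset.piecewise, hi] using hasParity_evenPart (v i)
  · simpa [Finset.piecewise, hi] using hasParity_oddPart (v i)

/-- The sign by which a super alternating tensor changes under a permutation of homogeneous
arguments depends on the parities only. -/
theorem exists_perm_sign {r : ℕ} (σ : Equiv.Perm (Fin r)) (ε : Fin r → Fin 2) :
    ∃ s : ℝ, s ≠ 0 ∧ ∀ T : SuperTensor V₀ V₁ r, IsSuperAlternating T →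
      ∀ v : Fin r → V₀ × V₁, (∀ i, HasParity (ε i) (v i)) → T (v ∘ σ) = s * T v := by
  rcases r with _ | r
  · exact ⟨1, one_ne_zero, fun T _ v _ => by rw [one_mul]; congr 1; exact Subsingleton.elim _ _⟩
  have hσ : σ ∈ Submonoid.closure
      (Set.range fun i : Fin r => Equiv.swap i.castSucc i.succ) := by
    rw [Equiv.Perm.mclosure_swap_castSucc_succ]; trivial
  induction hσ using Submonoid.closure_induction_right with
  | one => exact ⟨1, one_ne_zero, fun T _ v _ => by simp⟩
  | mul_right σ _ τ hτ ih =>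
    obtain ⟨s, hs, h⟩ := ih
    obtain ⟨i, rfl⟩ := hτ
    -- The transposition acts on `v ∘ σ`, so the parities that enter are those of the arguments
    -- which `σ` has brought to the two places.
    refine ⟨-(-1) ^ ((ε (σ i.castSucc) : ℕ) * (ε (σ i.succ) : ℕ)) * s, by simp [hs], ?_⟩
    intro T hT v hv
    have h1 := hT (v ∘ σ) (ε ∘ σ) (fun a => hv _) i.castSucc i.succ (by simp)
    have h2 := h T hT v hv
    rw [h2] at h1
    simp only [Function.comp_apply] at h1
    rw [mul_assoc, h1, ← mul_assoc]
    rw [show v ∘ ⇑(σ * Equiv.swap i.castSucc i.succ)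
      = (v ∘ σ) ∘ ⇑(Equiv.swap i.castSucc i.succ) from rfl]
    have hq : ∀ m : ℕ, (-(-1 : ℝ) ^ m) * -(-1) ^ m = 1 := fun m => by
      rw [neg_mul_neg, ← pow_add, ← two_mul, pow_mul]; simp
    rw [hq, one_mul]

/-- Super alternating tensors agreeing on homogeneous arguments whose even members stand first are
equal. -/
theorem IsSuperAlternating.ext_sorted {r : ℕ} {T S : SuperTensor V₀ V₁ r}
    (hT : IsSuperAlternating T) (hS : IsSuperAlternating S)
    (h : ∀ (v : Fin r → V₀ × V₁) (ε : Fin r → Fin 2), (∀ i, HasParity (ε i) (v i)) →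
      Monotone ε → T v = S v) : T = S := by
  refine superTensor_ext_homogeneous fun v ε hv => ?_
  obtain ⟨s, hs, hs'⟩ := exists_perm_sign (V₀ := V₀) (V₁ := V₁) (Tuple.sort ε) ε
  have := h (v ∘ Tuple.sort ε) (ε ∘ Tuple.sort ε) (fun i => hv _) (Tuple.monotone_sort ε)
  rw [hs' T hT v hv, hs' S hS v hv] at this
  exact mul_left_cancel₀ hs this

/-- Turns a sorted parity pattern into a pair order, so that comparison on sorted arguments becomes
comparison of components. -/
theorem exists_threshold {r : ℕ} {ε : Fin r → Fin 2} (hε : Monotone ε) :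
    ∃ κ l : ℕ, r = κ + l ∧ ∀ x : Fin r, ε x = if (x : ℕ) < κ then 0 else 1 := by
  classical
  induction r with
  | zero => exact ⟨0, 0, rfl, fun x => x.elim0⟩
  | succ r ih =>
    obtain ⟨κ, l, hr, h⟩ := ih (ε := fun x => ε x.castSucc)
      (fun a b hab => hε (Fin.castSucc_le_castSucc_iff.2 hab))
    rcases parity_cases (ε (Fin.last r)) with h0 | h0
    · refine ⟨r + 1, 0, rfl, fun x => ?_⟩
      have : ε x ≤ ε (Fin.last r) := hε (Fin.le_last x)
      rw [h0] at this
      rw [if_pos x.2]; omega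
    · refine ⟨κ, l + 1, by omega, fun x => ?_⟩
      refine Fin.lastCases ?_ (fun y => ?_) x
      · rw [h0, if_neg]; simp; omega
      · rw [h y]; simp

theorem sum_Iio_castSucc_succ {r : ℕ} (f : Fin (r + 1) → ℕ) (i : Fin r) :
    ∑ a ∈ Finset.Iio i.succ, f a = (∑ a ∈ Finset.Iio i.castSucc, f a) + f i.castSucc := by
  classical
  have : Finset.Iio i.succ = insert i.castSucc (Finset.Iio i.castSucc) := by
    ext a; simp only [Finset.mem_Iio, Finset.mem_insert, Fin.lt_def, Fin.ext_iff, Fin.val_succ,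
      Fin.val_castSucc]; omega
  rw [this, Finset.sum_insert (by simp), add_comm]

theorem swap_castSucc_succ_of_lt {r : ℕ} {i : Fin r} {a : Fin (r + 1)} (h : a < i.castSucc) :
    Equiv.swap i.castSucc i.succ a = a :=
  Equiv.swap_apply_of_ne_of_ne h.ne (h.trans (Fin.castSucc_lt_succ)).ne

theorem removeNth_swap {α : Type*} {r : ℕ} (i : Fin r) (v : Fin (r + 1) → α) :
    i.castSucc.removeNth (v ∘ Equiv.swap i.castSucc i.succ) = i.succ.removeNth v := by
  funext x
  simp only [Fin.removeNth, Function.comp_apply]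
  rcases lt_trichotomy x i with h | h | h
  · rw [Fin.succAbove_of_castSucc_lt _ _ (by rw [Fin.lt_def]; simpa using h),
      Fin.succAbove_of_castSucc_lt _ _ (by rw [Fin.lt_def] at *; simp; omega),
      Equiv.swap_apply_of_ne_of_ne] <;> simp only [ne_eq, Fin.ext_iff, Fin.val_succ,
        Fin.val_castSucc] <;> omega
  · subst h
    rw [Fin.succAbove_of_le_castSucc _ _ (le_refl _), Equiv.swap_apply_right,
      Fin.succAbove_of_castSucc_lt _ _ (by simp)]
  · rw [Fin.succAbove_of_le_castSucc _ _ (by rw [Fin.lt_def] at h; rw [Fin.le_def]; simp; omega),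
      Fin.succAbove_of_le_castSucc _ _ (by rw [Fin.lt_def] at h; rw [Fin.le_def]; simp; omega),
      Equiv.swap_apply_of_ne_of_ne] <;> simp only [ne_eq, Fin.ext_iff, Fin.val_succ,
        Fin.val_castSucc] <;> omega

/-- Moving a homogeneous argument of a super alternating tensor to the front. -/
theorem IsSuperAlternating.apply_eq_cons {r : ℕ} {T : SuperTensor V₀ V₁ (r + 1)}
    (hT : IsSuperAlternating T) (i : Fin (r + 1)) (v : Fin (r + 1) → V₀ × V₁)
    (ε : Fin (r + 1) → Fin 2) (hv : ∀ a, HasParity (ε a) (v a)) :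
    T v = (-1) ^ ((i : ℕ) + (ε i : ℕ) * ∑ a ∈ Finset.Iio i, (ε a : ℕ)) *
      T (Fin.cons (v i) (i.removeNth v)) := by
  induction i using Fin.induction generalizing v ε with
  | zero =>
    have : Finset.Iio (0 : Fin (r + 1)) = ∅ := by ext; simp
    simp [this, Fin.cons_self_tail]
  | succ i ih =>
    have h1 := hT v ε hv i.castSucc i.succ (by simp)
    have h2 := ih (v ∘ Equiv.swap i.castSucc i.succ) (ε ∘ Equiv.swap i.castSucc i.succ)
      (fun a => hv _)
    rw [removeNth_swap] at h2
    simp only [Function.comp_apply, Equiv.swap_apply_left] at h2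
    rw [h1, h2, ← mul_assoc, sum_Iio_castSucc_succ (fun a => (ε a : ℕ))]
    congr 1
    have h3 : ∑ a ∈ Finset.Iio i.castSucc, (ε (Equiv.swap i.castSucc i.succ a) : ℕ)
        = ∑ a ∈ Finset.Iio i.castSucc, (ε a : ℕ) :=
      Finset.sum_congr rfl fun a ha => by
        rw [swap_castSucc_succ_of_lt (Finset.mem_Iio.1 ha)]
    rw [h3]
    simp only [Fin.val_succ, Fin.val_castSucc]
    ring

theorem hasParity_cons {r : ℕ} {x : V₀ × V₁} {a : Fin 2} (hx : HasParity a x)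
    {v : Fin r → V₀ × V₁} {ε : Fin r → Fin 2} (hv : ∀ i, HasParity (ε i) (v i)) (i : Fin (r + 1)) :
    HasParity ((Fin.cons a ε : Fin (r + 1) → Fin 2) i)
      ((Fin.cons x v : Fin (r + 1) → V₀ × V₁) i) := by
  refine Fin.cases ?_ (fun j => ?_) i
  · simpa using hx
  · simpa using hv j

theorem IsSuperAlternating.swap_front {r : ℕ} {T : SuperTensor V₀ V₁ (r + 2)}
    (hT : IsSuperAlternating T) {x y : V₀ × V₁} {a b : Fin 2} (hx : HasParity a x)
    (hy : HasParity b y) {v : Fin r → V₀ × V₁} {ε : Fin r → Fin 2}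
    (hv : ∀ i, HasParity (ε i) (v i)) :
    T (Fin.cons x (Fin.cons y v)) =
      -(-1) ^ ((a : ℕ) * (b : ℕ)) * T (Fin.cons y (Fin.cons x v)) := by
  have h := hT (Fin.cons x (Fin.cons y v)) (Fin.cons a (Fin.cons b ε))
    (fun i => hasParity_cons hx (fun i => hasParity_cons hy hv i) i) 0 1 (by simp)
  rw [h]
  congr 2
  funext i
  refine Fin.cases ?_ (fun j => ?_) i
  · rw [Function.comp_apply, Equiv.swap_apply_left]; rfl
  · refine Fin.cases ?_ (fun j => ?_) j
    · rw [Function.comp_apply, show (Fin.succ 0 : Fin (r + 2)) = 1 from rfl,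
        Equiv.swap_apply_right]; rfl
    · rw [Function.comp_apply, Equiv.swap_apply_of_ne_of_ne (by simp [Fin.ext_iff])
        (by simp [Fin.ext_iff])]
      simp

/-- Inserting an even vector preserves super alternation. -/
theorem IsSuperAlternating.curryLeft {r : ℕ} {T : SuperTensor V₀ V₁ (r + 1)}
    (hT : IsSuperAlternating T) {x : V₀ × V₁} {a : Fin 2} (hx : HasParity a x) :
    IsSuperAlternating (T.curryLeft x) := by
  intro v ε hv i j hij
  have h := hT (Fin.cons x v) (Fin.cons a ε) (fun i => hasParity_cons hx hv i) i.succ j.succ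
    (by simp [hij])
  simp only [MultilinearMap.curryLeft_apply]
  rw [h]
  simp only [Fin.cons_succ]
  congr 2
  funext b
  refine Fin.cases ?_ (fun c => ?_) b
  · rw [Function.comp_apply, Equiv.swap_apply_of_ne_of_ne (Fin.succ_ne_zero _).symm
      (Fin.succ_ne_zero _).symm]; simp
  · simp only [Function.comp_apply, Fin.cons_succ]
    rw [← (Fin.succ_injective r).map_swap]; simp

/-- A super alternating tensor vanishes if two of its arguments are equal and even. -/
theorem IsSuperAlternating.eq_zero_of_eq {r : ℕ} {T : SuperTensor V₀ V₁ r}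
    (hT : IsSuperAlternating T) {v : Fin r → V₀ × V₁} {ε : Fin r → Fin 2}
    (hv : ∀ i, HasParity (ε i) (v i)) {i j : Fin r} (hij : i ≠ j) (h : v i = v j) (hi : ε i = 0) :
    T v = 0 := by
  rcases r with _ | r
  · exact i.elim0
  have hp : ∀ k, HasParity (i.removeNth ε k) (i.removeNth v k) := fun k => hv _
  rw [hT.apply_eq_cons i v ε hv]
  obtain ⟨j', rfl⟩ := Fin.exists_succAbove_eq hij.symm
  rcases r with _ | r
  · exact j'.elim0
  have hx : HasParity 0 (v i) := hi ▸ hv i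
  have h1 := (hT.curryLeft hx).apply_eq_cons j' (i.removeNth v) (i.removeNth ε) hp
  simp only [MultilinearMap.curryLeft_apply] at h1
  rw [h1]
  have h2 : i.removeNth v j' = v i := h.symm
  rw [h2]
  -- Both copies of the even vector now stand in front. Exchanging them changes the sign but not the
  -- tuple, so the value equals its negative.
  have h3 := hT.swap_front hx hx (v := j'.removeNth (i.removeNth v))
    (ε := j'.removeNth (i.removeNth ε)) (fun k => hp _)
  have h4 : T (Fin.cons (v i) (Fin.cons (v i) (j'.removeNth (i.removeNth v)))) = 0 := by
    simp at h3; linarith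
  rw [h4]; simp

end SuperAlternating

/-! ### Extension from sorted arguments by shuffles -/

section SuperExtend

variable {V₀ V₁ : Type*} [AddCommGroup V₀] [Module ℝ V₀] [AddCommGroup V₁] [Module ℝ V₁]

/-- `f` is alternating in the first `j` (even) and symmetric in the remaining (odd) arguments. -/
structure IsBlockAlternating (j l : ℕ) (f : SuperTensor V₀ V₁ (j + l)) : Prop where
  alternating : ∀ v : Fin (j + l) → V₀ × V₁,
    (∀ x : Fin (j + l), HasParity (if (x : ℕ) < j then 0 else 1) (v x)) →
    ∀ a b : Fin (j + l), (a : ℕ) + 1 = b → (b : ℕ) < j → f (v ∘ Equiv.swap a b) = -f v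
  symmetric : ∀ v : Fin (j + l) → V₀ × V₁,
    (∀ x : Fin (j + l), HasParity (if (x : ℕ) < j then 0 else 1) (v x)) →
    ∀ a b : Fin (j + l), (a : ℕ) + 1 = b → j ≤ (a : ℕ) → f (v ∘ Equiv.swap a b) = f v

/-- The restriction of a tensor to `j` even followed by odd arguments. -/
def blockPart (j : ℕ) {r : ℕ} (f : SuperTensor V₀ V₁ r) : SuperTensor V₀ V₁ r :=
  f.compLinearMap (fun i => if (i : ℕ) < j then evenPart else oddPart)

theorem blockPart_apply (j : ℕ) {r : ℕ} (f : SuperTensor V₀ V₁ r) (v : Fin r → V₀ × V₁) :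
    blockPart j f v = f fun i => if (i : ℕ) < j then evenPart (v i) else oddPart (v i) := by
  unfold blockPart
  rw [MultilinearMap.compLinearMap_apply]
  congr 1; funext i; split_ifs <;> rfl

theorem blockPart_eq_zero {j r : ℕ} (f : SuperTensor V₀ V₁ r) {v : Fin r → V₀ × V₁} {x : Fin r}
    {a : Fin 2} (hv : HasParity a (v x)) (h : a ≠ if (x : ℕ) < j then 0 else 1) :
    blockPart j f v = 0 := by
  rw [blockPart_apply]
  refine f.map_coord_zero x ?_
  rcases parity_cases a with rfl | rfl <;> split_ifs at h ⊢ <;>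
    simp_all [evenPart_of_odd, oddPart_of_even]

theorem blockPart_apply_of_sorted {j r : ℕ} (f : SuperTensor V₀ V₁ r) {v : Fin r → V₀ × V₁}
    (hv : ∀ x : Fin r, HasParity (if (x : ℕ) < j then 0 else 1) (v x)) :
    blockPart j f v = f v := by
  rw [blockPart_apply]
  congr 1; funext x
  have := hv x
  split_ifs at this ⊢
  · exact evenPart_of_even this
  · exact oddPart_of_odd this

theorem IsBlockAlternating.blockPart_swap {j l : ℕ} {f : SuperTensor V₀ V₁ (j + l)}
    (hf : IsBlockAlternating j l f) (v : Fin (j + l) → V₀ × V₁) {a b : Fin (j + l)}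
    (hab : (a : ℕ) + 1 = b) :
    ((b : ℕ) < j → blockPart j f (v ∘ Equiv.swap a b) = -blockPart j f v) ∧
    (j ≤ (a : ℕ) → blockPart j f (v ∘ Equiv.swap a b) = blockPart j f v) := by
  have hp : ∀ x : Fin (j + l), HasParity (if (x : ℕ) < j then 0 else 1)
      (if (x : ℕ) < j then evenPart (v x) else oddPart (v x)) := fun x => by
    split_ifs
    · exact hasParity_evenPart _
    · exact hasParity_oddPart _
  have hx : ∀ x : Fin (j + l), ((b : ℕ) < j ∨ j ≤ (a : ℕ)) →
      (((Equiv.swap a b x : Fin (j + l)) : ℕ) < j ↔ (x : ℕ) < j) := fun x h => by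
    by_cases h1 : x = a
    · subst h1; rw [Equiv.swap_apply_left]; omega
    · by_cases h2 : x = b
      · subst h2; rw [Equiv.swap_apply_right]; omega
      · rw [Equiv.swap_apply_of_ne_of_ne h1 h2]
  refine ⟨fun h => ?_, fun h => ?_⟩
  · rw [blockPart_apply, blockPart_apply, ← hf.alternating _ hp a b hab h]
    congr 1; funext x
    simp only [Function.comp_apply, hx x (Or.inl h)]
  · rw [blockPart_apply, blockPart_apply, ← hf.symmetric _ hp a b hab h]
    congr 1; funext x
    simp only [Function.comp_apply, hx x (Or.inr h)]

open scoped Classical in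
theorem superExtend_apply (j l : ℕ) (f : SuperTensor V₀ V₁ (j + l)) (v : Fin (j + l) → V₀ × V₁) :
    superExtend j l f v = ∑ σ : Equiv.Perm (Fin (j + l)) with IsShuffle j l σ,
      ((Equiv.Perm.sign σ : ℤ) : ℝ) * blockPart j f (v ∘ σ) := by
  unfold superExtend
  rw [sum_apply]
  rfl

theorem isShuffle_iff {j l : ℕ} {σ : Equiv.Perm (Fin (j + l))} :
    IsShuffle j l σ ↔ ∀ x y : Fin (j + l), x < y → ((y : ℕ) < j ∨ j ≤ (x : ℕ)) → σ x < σ y := by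
  constructor
  · rintro ⟨h1, h2⟩ x y hxy (h | h)
    · exact @h1 ⟨x, by omega⟩ ⟨y, h⟩ hxy
    · have := @h2 ⟨x - j, by omega⟩ ⟨y - j, by omega⟩ (by rw [Fin.lt_def] at *; simp; omega)
      have hx : Fin.natAdd j ⟨(x : ℕ) - j, by omega⟩ = x := by ext; simp; omega
      have hy : Fin.natAdd j ⟨(y : ℕ) - j, by rw [Fin.lt_def] at hxy; omega⟩ = y := by
        rw [Fin.lt_def] at hxy; ext; simp; omega
      simpa only [Function.comp_apply, hx, hy] using this
  · intro h
    refine ⟨fun x y hxy => h _ _ (by rwa [Fin.lt_def] at *) (Or.inl (by simp)),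
      fun x y hxy => h _ _ (by simpa using hxy) (Or.inr (by simp))⟩

theorem swap_lt_swap {r : ℕ} {i j x y : Fin r} (hij : (i : ℕ) + 1 = j) (hxy : x < y)
    (h : ¬(x = i ∧ y = j)) : Equiv.swap i j x < Equiv.swap i j y := by
  simp only [Equiv.swap_apply_def]
  split_ifs <;> simp only [Fin.lt_def, Fin.ext_iff] at * <;> omega

/-- Composition with the transposition of neighbours which come from different blocks preserves
shuffles. -/
theorem IsShuffle.swap_mul {j l : ℕ} {σ : Equiv.Perm (Fin (j + l))} (hσ : IsShuffle j l σ)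
    {a b : Fin (j + l)} (hab : (a : ℕ) + 1 = b)
    (h : ¬(((σ.symm a : ℕ) < j) ↔ ((σ.symm b : ℕ) < j))) :
    IsShuffle j l (Equiv.swap a b * σ) := by
  rw [isShuffle_iff] at *
  intro x y hxy hb
  refine swap_lt_swap hab (hσ x y hxy hb) ?_
  rintro ⟨h1, h2⟩
  rw [← h1, ← h2, Equiv.symm_apply_apply, Equiv.symm_apply_apply] at h
  rw [Fin.lt_def] at hxy
  omega

/-- In a shuffle, neighbours from the same block come from neighbouring places. -/
theorem IsShuffle.symm_succ {j l : ℕ} {σ : Equiv.Perm (Fin (j + l))} (hσ : IsShuffle j l σ)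
    {a b : Fin (j + l)} (hab : (a : ℕ) + 1 = b)
    (h : ((σ.symm a : ℕ) < j) ↔ ((σ.symm b : ℕ) < j)) :
    (σ.symm a : ℕ) + 1 = σ.symm b := by
  rw [isShuffle_iff] at hσ
  set x := σ.symm a with hx
  set y := σ.symm b with hy
  have ha : a = σ x := by simp [hx]
  have hb : b = σ y := by simp [hy]
  have hxy : x < y := by
    rcases lt_trichotomy x y with h1 | h1 | h1
    · exact h1
    · rw [h1] at ha; rw [ha, hb] at hab; omega
    · have := hσ y x h1 (by rw [Fin.lt_def] at h1; omega)
      rw [← ha, ← hb, Fin.lt_def] at this; omega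
  by_contra hne
  rw [Fin.lt_def] at hxy
  have h1 := hσ x ⟨x + 1, by omega⟩ (by rw [Fin.lt_def]; simp) (by simp; omega)
  have h2 := hσ ⟨x + 1, by omega⟩ y (by rw [Fin.lt_def]; simp; omega) (by simp; omega)
  rw [← ha, Fin.lt_def] at h1
  rw [← hb, Fin.lt_def] at h2
  omega

/-- The shuffles are divided according to whether the two exchanged arguments are taken from the
same block. If they are, they occupy neighbouring places of that block, and the symmetry of `f`
there gives the sign term by term. If they are not, composition with the transposition is an
involution on the shuffles, and the sign comes from the change of `sign σ`. -/
theorem IsBlockAlternating.isSuperAlternating_superExtend {j l : ℕ} {f : SuperTensor V₀ V₁ (j + l)}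
    (hf : IsBlockAlternating j l f) : IsSuperAlternating (superExtend j l f) := by
  classical
  intro v ε hv a b hab
  rw [superExtend_apply, superExtend_apply, Finset.mul_sum]
  let B : Equiv.Perm (Fin (j + l)) → Prop := fun σ => ((σ.symm a : ℕ) < j) ↔ ((σ.symm b : ℕ) < j)
  rw [← Finset.sum_filter_add_sum_filter_not _ B, ← Finset.sum_filter_add_sum_filter_not
    (Finset.univ.filter fun σ => IsShuffle j l σ) B (fun σ => _ * _)]
  have hne : a ≠ b := fun h => by rw [h] at hab; omega
  congr 1
  · refine Finset.sum_congr rfl fun σ hσ => ?_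
    simp only [Finset.mem_filter, Finset.mem_univ, true_and] at hσ
    obtain ⟨hσ, hB⟩ := hσ
    have hs := hσ.symm_succ hab hB
    have hcomp : (v ∘ Equiv.swap a b) ∘ σ = (v ∘ σ) ∘ Equiv.swap (σ.symm a) (σ.symm b) := by
      funext x
      simp only [Function.comp_apply]
      congr 1
      rw [σ.injective.map_swap]; simp
    have key := hf.blockPart_swap (v ∘ σ) hs
    rw [hcomp]
    by_cases hj : (σ.symm a : ℕ) < j
    · rw [key.1 (hB.1 hj)]
      by_cases ha : ε a = 0
      · rw [ha]; simp
      · have h0 : blockPart j f (v ∘ σ) = 0 :=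
          blockPart_eq_zero f (x := σ.symm a) (a := ε a) (by simpa using hv a) (by simpa [hj])
        simp [h0]
    · rw [key.2 (not_lt.1 hj)]
      by_cases ha : ε a = 1
      · by_cases hb : ε b = 1
        · rw [ha, hb]; simp
        · have h0 : blockPart j f (v ∘ σ) = 0 :=
            blockPart_eq_zero f (x := σ.symm b) (a := ε b) (by simpa using hv b)
              (by rw [if_neg (fun h' => hj (hB.2 h'))]; exact hb)
          simp [h0]
      · have h0 : blockPart j f (v ∘ σ) = 0 :=
          blockPart_eq_zero f (x := σ.symm a) (a := ε a) (by simpa using hv a) (by simpa [hj])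
        simp [h0]
  · have hinv : ∀ σ, ¬B σ → ¬B (Equiv.swap a b * σ) := fun σ h => by
      simp only [B] at h ⊢
      rw [show (Equiv.swap a b * σ).symm a = σ.symm b by
          simp [Equiv.symm_apply_eq],
        show (Equiv.swap a b * σ).symm b = σ.symm a by
          simp [Equiv.symm_apply_eq]]
      tauto
    refine Finset.sum_bij' (fun σ _ => Equiv.swap a b * σ) (fun σ _ => Equiv.swap a b * σ) ?_ ?_
      (fun σ _ => by simp [← mul_assoc]) (fun σ _ => by simp [← mul_assoc]) ?_
    · intro σ hσ
      simp only [Finset.mem_filter, Finset.mem_univ, true_and] at hσ ⊢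
      exact ⟨hσ.1.swap_mul hab hσ.2, hinv σ hσ.2⟩
    · intro σ hσ
      simp only [Finset.mem_filter, Finset.mem_univ, true_and] at hσ ⊢
      exact ⟨hσ.1.swap_mul hab hσ.2, hinv σ hσ.2⟩
    · intro σ hσ
      simp only [Finset.mem_filter, Finset.mem_univ, true_and, B] at hσ
      have hcomp : (v ∘ Equiv.swap a b) ∘ ⇑(Equiv.swap a b * σ) = v ∘ σ := by
        funext x; simp
      rw [hcomp, Equiv.Perm.sign_mul, Equiv.Perm.sign_swap hne]
      -- If both arguments are odd, one of them fills a place of the even block and the summand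
      -- vanishes. Otherwise the exponent is zero and the sign of the transposition is the required
      -- factor.
      by_cases hab' : ε a = 1 ∧ ε b = 1
      · have h0 : blockPart j f (v ∘ σ) = 0 := by
          by_cases hj : (σ.symm a : ℕ) < j
          · exact blockPart_eq_zero f (x := σ.symm a) (a := ε a) (by simpa using hv a)
              (by rw [if_pos hj, hab'.1]; simp)
          · refine blockPart_eq_zero f (x := σ.symm b) (a := ε b) (by simpa using hv b) ?_
            rw [if_pos (by tauto), hab'.2]; simp
        simp [h0]
      · have : ((ε a : ℕ) * (ε b : ℕ)) = 0 := by
          rcases parity_cases (ε a) with h | h <;> rcases parity_cases (ε b) with h' | h' <;>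
            simp_all
        rw [this]; simp

/-- A shuffle that preserves the blocks is the identity. -/
theorem IsShuffle.eq_one {j l : ℕ} {σ : Equiv.Perm (Fin (j + l))} (hσ : IsShuffle j l σ)
    (h : ∀ x, (σ x : ℕ) < j ↔ (x : ℕ) < j) : σ = 1 := by
  rw [isShuffle_iff] at hσ
  have hm : StrictMono σ := fun x y hxy => by
    by_cases h1 : (y : ℕ) < j ∨ j ≤ (x : ℕ)
    · exact hσ x y hxy h1
    · have h2 := h x
      have h3 := h y
      rw [Fin.lt_def]; omega
  -- A finite linear order has no automorphism other than the identity.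
  have : (hm.orderIsoOfSurjective _ σ.surjective) = OrderIso.refl _ := Subsingleton.elim _ _
  ext x
  have := congrArg (fun e => (e x : ℕ)) this
  simpa using this

/-- The value of `superExtend j l f` on even arguments followed by odd ones. -/
theorem superExtend_apply_sorted {j l κ : ℕ} (f : SuperTensor V₀ V₁ (j + l))
    {v : Fin (j + l) → V₀ × V₁} (hκ : κ ≤ j + l)
    (hv : ∀ x : Fin (j + l), HasParity (if (x : ℕ) < κ then 0 else 1) (v x)) :
    superExtend j l f v = if κ = j then f v else 0 := by
  classical
  rw [superExtend_apply]
  have hz : ∀ σ : Equiv.Perm (Fin (j + l)), ¬(∀ x, (σ x : ℕ) < κ ↔ (x : ℕ) < j) →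
      blockPart j f (v ∘ σ) = 0 := fun σ h => by
    push Not at h
    obtain ⟨x, hx⟩ := h
    refine blockPart_eq_zero f (x := x) (hv (σ x)) ?_
    split_ifs <;> simp <;> omega
  split_ifs with h
  · subst h
    rw [Finset.sum_eq_single 1]
    · simp [blockPart_apply_of_sorted f hv]
    · intro σ hσ h1
      rw [hz σ, mul_zero]
      intro h
      exact h1 ((Finset.mem_filter.1 hσ).2.eq_one h)
    · intro h1
      exact absurd (Finset.mem_filter.2 ⟨Finset.mem_univ _, isShuffle_iff.2 fun x y h _ => h⟩) h1
  · refine Finset.sum_eq_zero fun σ _ => ?_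
    rw [hz σ, mul_zero]
    intro h'
    apply h
    -- A summand can survive only if `σ` carries the first `j` places onto the `κ` even arguments;
    -- counting then gives `κ = j`.
    have h1 : (Finset.univ.filter fun x : Fin (j + l) => (x : ℕ) < κ).card
        = (Finset.univ.filter fun x : Fin (j + l) => (x : ℕ) < j).card := by
      refine (Finset.card_bij (fun x _ => σ x) ?_ (fun x _ y _ hxy => σ.injective hxy) ?_).symm
      · intro x hx; simpa [h' x] using hx
      · intro y hy
        exact ⟨σ.symm y, by simpa [← h'] using hy, by simp⟩
    have h2 : ∀ m ≤ j + l, (Finset.univ.filter fun x : Fin (j + l) => (x : ℕ) < m).card = m :=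
      fun m hm => by rw [Fin.card_filter_val_lt]; omega
    rwa [h2 κ hκ, h2 j (by omega)] at h1

end SuperExtend

/-! ### Orthonormal bases and the volume tensor -/

section Volume

variable {V₀ : Type*} [AddCommGroup V₀] [Module ℝ V₀]

/-- Every nondegenerate symmetric form has an orthonormal basis, in which the number of negative
vectors is the negative index. -/
theorem exists_isOrthonormalBasis [FiniteDimensional ℝ V₀] {n : ℕ}
    (hn : Module.finrank ℝ V₀ = n) {B : LinearMap.BilinForm ℝ V₀} (hs : B.IsSymm)
    (hB : B.Nondegenerate) :
    ∃ e : Module.Basis (Fin n) ℝ V₀, IsOrthonormalBasis B e := by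
  subst hn
  obtain ⟨v, hv⟩ := LinearMap.BilinForm.exists_orthogonal_basis
    (LinearMap.BilinForm.isSymm_iff.1 hs)
  have hne : ∀ i, B (v i) (v i) ≠ 0 := hv.not_isOrtho_basis_self_of_separatingLeft hB.1
  -- An orthogonal basis is normalized by `|B(v, v)|^(-1/2)`; nondegeneracy excludes null vectors
  -- from it.
  let w : Fin (Module.finrank ℝ V₀) → ℝ := fun i => (Real.sqrt |B (v i) (v i)|)⁻¹
  have hw : ∀ i, w i ≠ 0 := fun i => inv_ne_zero (Real.sqrt_ne_zero'.2 (abs_pos.2 (hne i)))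
  refine ⟨v.isUnitSMul (fun i => (hw i).isUnit), fun i j hij => ?_, fun i => ?_⟩
  · simp [Module.Basis.isUnitSMul_apply, show B (v i) (v j) = 0 from hv hij]
  · simp only [Module.Basis.isUnitSMul_apply, map_smul, LinearMap.smul_apply, smul_eq_mul, ← mul_assoc]
    have h1 : w i * w i * |B (v i) (v i)| = 1 := by
      simp only [w]
      rw [← mul_inv, Real.mul_self_sqrt (abs_nonneg _), inv_mul_cancel₀ (abs_ne_zero.2 (hne i))]
    rcases abs_choice (B (v i) (v i)) with h | h
    · left; rwa [h] at h1
    · right; rw [h] at h1; linarith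

/-- Sylvester's law of inertia: the form is a sum of squares weighted by `B (e i) (e i)`, so the
number of weights `-1` is the negative index, whichever orthonormal basis was taken. -/
theorem IsOrthonormalBasis.prod_eq {n : ℕ} {B : LinearMap.BilinForm ℝ V₀} (hs : B.IsSymm)
    {e : Module.Basis (Fin n) ℝ V₀} (he : IsOrthonormalBasis B e) :
    ∏ i, B (e i) (e i) = (-1) ^ sigNeg (LinearMap.BilinMap.toQuadraticMap B) := by
  classical
  have hn : Module.finrank ℝ V₀ = n := by simpa using Module.finrank_eq_card_basis e
  have : FiniteDimensional ℝ V₀ := e.finiteDimensional_of_finite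
  subst hn
  have hassoc : QuadraticMap.associated (R := ℝ) (LinearMap.BilinMap.toQuadraticMap B) = B :=
    QuadraticMap.associated_left_inverse ℝ hs.eq
  have heq := QuadraticForm.sigNeg_of_equiv_weightedSumSquares
    ⟨QuadraticForm.isometryEquivWeightedSumSquares (LinearMap.BilinMap.toQuadraticMap B) e (by
      rw [hassoc]; exact fun i j hij => he.1 i j hij)⟩
  rw [heq]
  simp only [LinearMap.BilinMap.toQuadraticMap_apply]
  have h1 : ∀ i, B (e i) (e i) = if B (e i) (e i) < 0 then -1 else 1 := fun i => by
    rcases he.2 i with h | h <;> rw [h] <;> norm_num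
  rw [Finset.prod_congr rfl fun i _ => h1 i, Finset.prod_ite]
  simp only [Finset.prod_const, one_pow, mul_one]
  congr 1
  rw [Set.ncard_eq_toFinset_card']
  congr 1
  ext i; simp

/-- Isolates the arbitrary choice in the definition: all that is used later is that the volume
tensor is plus or minus the determinant of an orthonormal basis, with the sign determined by the
orientation. -/
theorem volumeTensor_eq {n : ℕ} {B : LinearMap.BilinForm ℝ V₀}
    (h : ∃ e : Module.Basis (Fin n) ℝ V₀, IsOrthonormalBasis B e)
    (o : Orientation ℝ V₀ (Fin n)) :
    ∃ e : Module.Basis (Fin n) ℝ V₀, IsOrthonormalBasis B e ∧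
      ((e.orientation = o ∧ volumeTensor B o = e.det) ∨
        (e.orientation = -o ∧ volumeTensor B o = -e.det)) := by
  classical
  refine ⟨h.choose, h.choose_spec, ?_⟩
  unfold volumeTensor
  rw [dif_pos h]
  split_ifs with ho
  · exact Or.inl ⟨ho, rfl⟩
  · refine Or.inr ⟨?_, rfl⟩
    rcases h.choose.orientation_eq_or_eq_neg o with h' | h'
    · exact absurd h'.symm ho
    · rw [h']; exact (neg_neg h.choose.orientation).symm

/-- The product of two values of the volume tensor is a Gram determinant. -/
theorem volumeTensor_mul [FiniteDimensional ℝ V₀] {n : ℕ} (hn : Module.finrank ℝ V₀ = n)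
    {B : LinearMap.BilinForm ℝ V₀} (hs : B.IsSymm) (hB : B.Nondegenerate)
    (o : Orientation ℝ V₀ (Fin n)) (x y : Fin n → V₀) :
    volumeTensor B o x * volumeTensor B o y =
      (-1) ^ sigNeg (LinearMap.BilinMap.toQuadraticMap B) *
        (Matrix.of fun i j => B (x i) (y j)).det := by
  classical
  obtain ⟨e, he, h⟩ := volumeTensor_eq (exists_isOrthonormalBasis hn hs hB) o
  -- The sign chosen by the orientation occurs twice and drops out.
  have h1 : volumeTensor B o x * volumeTensor B o y = e.det x * e.det y := by
    rcases h with ⟨_, h⟩ | ⟨_, h⟩ <;> rw [h] <;> simp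
  -- In orthonormal coordinates the Gram matrix is `Xᵀ D Y` with `D` diagonal and `det D = (-1)^s`.
  have h2 : (Matrix.of fun i j => B (x i) (y j)) =
      (e.toMatrix x).transpose * Matrix.diagonal (fun i => B (e i) (e i)) * e.toMatrix y := by
    ext i j
    rw [Matrix.mul_apply]
    simp only [Matrix.mul_diagonal, Matrix.transpose_apply, Matrix.of_apply,
      Module.Basis.toMatrix_apply]
    conv_lhs => rw [← e.sum_repr (x i), ← e.sum_repr (y j)]
    simp only [map_sum, map_smul, LinearMap.sum_apply, LinearMap.smul_apply, smul_eq_mul]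
    refine Finset.sum_congr rfl fun a _ => ?_
    rw [Finset.sum_eq_single a]
    · ring
    · intro b _ hb; rw [he.1 b a hb]; ring
    · simp
  have hq : ((-1 : ℝ) ^ sigNeg (LinearMap.BilinMap.toQuadraticMap B)) *
      (-1) ^ sigNeg (LinearMap.BilinMap.toQuadraticMap B) = 1 := by
    rw [← mul_pow]; simp
  rw [h1, h2, Matrix.det_mul, Matrix.det_mul, Matrix.det_diagonal, Matrix.det_transpose,
    he.prod_eq hs, Module.Basis.det_apply, Module.Basis.det_apply]
  linear_combination -(e.toMatrix x).det * (e.toMatrix y).det * hq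

/-- With its negative counterpart, this reads the orientation off the sign of the volume tensor.
Signs can be followed from point to point, whereas the orthonormal bases chosen in the definition
need not vary continuously. -/
theorem volumeTensor_pos [FiniteDimensional ℝ V₀] {n : ℕ} 
    {B : LinearMap.BilinForm ℝ V₀} (hs : B.IsSymm) (hB : B.Nondegenerate)
    (o : Orientation ℝ V₀ (Fin n)) (b : Module.Basis (Fin n) ℝ V₀) (hb : b.orientation = o) :
    0 < volumeTensor B o b := by
  have hn : Module.finrank ℝ V₀ = n := by simpa using Module.finrank_eq_card_basis b
  obtain ⟨e, -, ⟨h1, h2⟩ | ⟨h1, h2⟩⟩ := volumeTensor_eq (exists_isOrthonormalBasis hn hs hB) o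
  · rw [h2]
    exact (Module.Basis.orientation_eq_iff_det_pos e b).1 (h1.trans hb.symm)
  · rw [h2, AlternatingMap.neg_apply, neg_pos]
    by_contra h
    rcases (not_lt.1 h).lt_or_eq with h | h
    · have := (Module.Basis.orientation_eq_iff_det_pos e b).2 h
      rw [h1, hb] at this
      exact Module.Ray.ne_neg_self o this.symm
    · exact (e.isUnit_det b).ne_zero h.symm

theorem volumeTensor_neg [FiniteDimensional ℝ V₀] {n : ℕ} 
    {B : LinearMap.BilinForm ℝ V₀} (hs : B.IsSymm) (hB : B.Nondegenerate)
    (o : Orientation ℝ V₀ (Fin n)) (b : Module.Basis (Fin n) ℝ V₀) (hb : b.orientation = -o) :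
    volumeTensor B o b < 0 := by
  have hn : Module.finrank ℝ V₀ = n := by simpa using Module.finrank_eq_card_basis b
  obtain ⟨e, -, ⟨h1, h2⟩ | ⟨h1, h2⟩⟩ := volumeTensor_eq (exists_isOrthonormalBasis hn hs hB) o
  · rw [h2]
    by_contra h
    rcases (not_lt.1 h).lt_or_eq with h | h
    · have := (Module.Basis.orientation_eq_iff_det_pos e b).2 h
      rw [h1, hb] at this
      exact Module.Ray.ne_neg_self o this
    · exact (e.isUnit_det b).ne_zero h.symm
  · rw [h2, AlternatingMap.neg_apply, neg_lt_zero]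
    exact (Module.Basis.orientation_eq_iff_det_pos e b).1 (h1.trans hb.symm)

end Volume

/-! ### Blocks of arguments of alternating maps -/

section Append

variable {V : Type*} [AddCommGroup V] [Module ℝ V]

theorem append_update_left {α : Type*} {k j : ℕ} (x : Fin k → α) (i : Fin k) (y : α)
    (w : Fin j → α) :
    Fin.append (Function.update x i y) w = Function.update (Fin.append x w) (Fin.castAdd j i) y := by
  funext a
  refine Fin.addCases (fun b => ?_) (fun b => ?_) a
  · by_cases h : b = i
    · subst h; simp
    · rw [Function.update_of_ne (by simpa using h)]; simp [h]
  · rw [Function.update_of_ne (by simp [Fin.ext_iff]; omega)]; simp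

/-- An alternating map with its last arguments fixed. -/
def fixLast {k j : ℕ} (f : V [⋀^Fin (k + j)]→ₗ[ℝ] ℝ) (w : Fin j → V) : V [⋀^Fin k]→ₗ[ℝ] ℝ where
  toFun x := f (Fin.append x w)
  map_update_add' := by
    intro inst x i y z
    obtain rfl := Subsingleton.elim inst (instDecidableEqFin k)
    simp [append_update_left]
  map_update_smul' := by
    intro inst x i c y
    obtain rfl := Subsingleton.elim inst (instDecidableEqFin k)
    simp [append_update_left]
  map_eq_zero_of_eq' x i i' h hne :=
    f.map_eq_zero_of_eq (i := Fin.castAdd j i) (j := Fin.castAdd j i') _ (by simpa using h)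
      (by simpa using hne)

theorem append_eq_insertNth {α : Type*} {k j : ℕ} (x : Fin k → α) (y : Fin (j + 1) → α) :
    Fin.append x y = ((⟨k, by omega⟩ : Fin (k + j + 1)).insertNth (y 0) (Fin.append x (Fin.tail y)) :
      Fin (k + j + 1) → α) := by
  rw [Fin.eq_insertNth_iff]
  refine ⟨?_, ?_⟩
  · rw [show (⟨k, by omega⟩ : Fin (k + j + 1)) = Fin.natAdd k (0 : Fin (j + 1)) by ext; simp]
    exact Fin.append_right x y 0
  · funext a
    refine Fin.addCases (fun b => ?_) (fun b => ?_) a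
    · simp only [Fin.removeNth, Fin.append_left]
      rw [Fin.succAbove_of_castSucc_lt _ _ (by simp [Fin.lt_def])]
      exact Fin.append_left x y b
    · simp only [Fin.removeNth, Fin.append_right, Fin.tail]
      rw [Fin.succAbove_of_le_castSucc _ _ (by simp [Fin.le_def])]
      exact Fin.append_right x y b.succ

/-- Exchanging two blocks of arguments of an alternating map. -/
theorem alternating_append_comm {n k j : ℕ} (f : V [⋀^Fin n]→ₗ[ℝ] ℝ) (h₁ : n = k + j)
    (h₂ : n = j + k) (x : Fin k → V) (y : Fin j → V) :
    f (Fin.append x y ∘ Fin.cast h₁) = (-1) ^ (k * j) * f (Fin.append y x ∘ Fin.cast h₂) := by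
  induction j generalizing n with
  | zero =>
    simp only [mul_zero, pow_zero, one_mul]
    congr 1
    funext a
    simp [Fin.append, Fin.addCases]
    rw [dif_pos (by omega)]; rfl
  | succ j ih =>
    subst h₁
    -- Moving `y 0` past the `k` vectors of `x` costs `(-1)^k`; the other `j` vectors are moved by
    -- the induction hypothesis for `f` with `y 0` inserted.
    have h1 := f.map_insertNth (⟨k, by omega⟩ : Fin (k + j + 1)) (y 0) (Fin.append x (Fin.tail y))
    rw [show (Fin.append x y ∘ Fin.cast (rfl : k + (j + 1) = k + (j + 1))) = Fin.append x y from rfl,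
      append_eq_insertNth, h1]
    have h2 := ih (f.curryLeft (y 0)) rfl (add_comm k j) (Fin.tail y)
    simp only [AlternatingMap.curryLeft_apply_apply] at h2
    have h3 : f (Matrix.vecCons (y 0) (Fin.append x (Fin.tail y))) = (-1) ^ (k * j) *
        f (Matrix.vecCons (y 0) (Fin.append (Fin.tail y) x ∘ Fin.cast (add_comm k j))) := h2
    rw [h3]
    have h4 : (Matrix.vecCons (y 0) (Fin.append (Fin.tail y) x ∘ Fin.cast (add_comm k j)) :
        Fin (k + j + 1) → V) = Fin.append y x ∘ Fin.cast h₂ := by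
      funext a
      refine Fin.cases ?_ (fun b => ?_) a
      · simp only [Matrix.cons_val_zero, Function.comp_apply]
        rw [show Fin.cast h₂ 0 = Fin.castAdd k (0 : Fin (j + 1)) by ext; simp, Fin.append_left]
      · simp only [Matrix.cons_val_succ, Function.comp_apply]
        by_cases hb : (b : ℕ) < j
        · rw [show Fin.cast (add_comm k j) b = Fin.castAdd k (⟨b, hb⟩ : Fin j) by ext; simp,
            show Fin.cast h₂ b.succ = Fin.castAdd k (⟨b + 1, by omega⟩ : Fin (j + 1)) by ext; simp,
            Fin.append_left, Fin.append_left]; rfl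
        · rw [show Fin.cast (add_comm k j) b = Fin.natAdd j (⟨b - j, by omega⟩ : Fin k) by
              ext; simp; omega,
            show Fin.cast h₂ b.succ = Fin.natAdd (j + 1) (⟨b - j, by omega⟩ : Fin k) by
              ext; simp; omega,
            Fin.append_right, Fin.append_right]
    rw [h4, zsmul_eq_mul]
    push_cast
    ring

end Append

/-! ### Contraction over reciprocal bases, Gram determinants and `H ∘ H` -/

section Contraction

variable {V₀ : Type*} [AddCommGroup V₀] [Module ℝ V₀]

/-- The families `e` and `e'` are reciprocal bases for the bilinear form `B`. -/
structure IsReciprocal {ι : Type*} [DecidableEq ι] (B : LinearMap.BilinForm ℝ V₀)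
    (e : Module.Basis ι ℝ V₀) (e' : ι → V₀) : Prop where
  inner : ∀ i j, B (e' j) (e i) = if i = j then 1 else 0

theorem IsReciprocal.eq_dualBasis {ι : Type*} [DecidableEq ι] [Finite ι]
    {B : LinearMap.BilinForm ℝ V₀} (hB : B.Nondegenerate) {e : Module.Basis ι ℝ V₀} {e' : ι → V₀}
    (h : IsReciprocal B e e') : e' = B.dualBasis hB e := by
  symm
  rw [LinearMap.BilinForm.dualBasis_eq_iff]
  intro i j; rw [h.inner]

theorem isReciprocal_dualBasis {ι : Type*} [DecidableEq ι] [Finite ι]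
    {B : LinearMap.BilinForm ℝ V₀} (hB : B.Nondegenerate) (e : Module.Basis ι ℝ V₀) :
    IsReciprocal B e (B.dualBasis hB e) :=
  ⟨fun i j => LinearMap.BilinForm.apply_dualBasis_left hB e j i⟩

section

variable {ι : Type*} [DecidableEq ι] [Fintype ι] {B : LinearMap.BilinForm ℝ V₀}
  {e : Module.Basis ι ℝ V₀} {e' : ι → V₀}

theorem IsReciprocal.sum_left (hs : B.IsSymm) (h : IsReciprocal B e e')
    (x : V₀) : ∑ i, B x (e' i) • e i = x := by
  conv_rhs => rw [← e.sum_repr x]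
  refine Finset.sum_congr rfl fun i _ => ?_
  congr 1
  conv_lhs => rw [← e.sum_repr x]
  simp only [map_sum, map_smul, LinearMap.sum_apply, LinearMap.smul_apply, smul_eq_mul]
  rw [Finset.sum_eq_single i]
  · rw [hs.eq, h.inner]; simp
  · intro j _ hj; rw [hs.eq, h.inner, if_neg hj, mul_zero]
  · simp

theorem IsReciprocal.sum_right (hB : B.Nondegenerate) (h : IsReciprocal B e e')
    (x : V₀) : ∑ i, B x (e i) • e' i = x := by
  conv_rhs => rw [← (B.dualBasis hB e).sum_repr x]
  refine Finset.sum_congr rfl fun i _ => ?_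
  rw [LinearMap.BilinForm.dualBasis_repr_apply, h.eq_dualBasis hB]

end

/-- The full contraction of two tensors over reciprocal bases does not depend on the bases. -/
theorem contraction_eq {ι κ : Type*} [DecidableEq ι] [Fintype ι] [DecidableEq κ] [Fintype κ]
    {B : LinearMap.BilinForm ℝ V₀} (hs : B.IsSymm) (hB : B.Nondegenerate)
    {e : Module.Basis ι ℝ V₀} {e' : ι → V₀} (he : IsReciprocal B e e')
    {b : Module.Basis κ ℝ V₀} {b' : κ → V₀} (hb : IsReciprocal B b b')
    {k : ℕ} (P Q : MultilinearMap ℝ (fun _ : Fin k => V₀) ℝ) :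
    ∑ a : Fin k → κ, P (fun i => b' (a i)) * Q (fun i => b (a i)) =
      ∑ a : Fin k → ι, P (fun i => e' (a i)) * Q (fun i => e (a i)) := by
  -- Both sides equal the double sum of `∏ B(b'_a, e_c) · P(e'_c) · Q(b_a)`: on the left `P` is
  -- expanded in `e'`, on the right `Q` is expanded in `b`.
  have h1 : ∀ a : Fin k → κ, P (fun i => b' (a i)) =
      ∑ c : Fin k → ι, (∏ i, B (b' (a i)) (e (c i))) * P fun i => e' (c i) := fun a => by
    conv_lhs => rw [show (fun i => b' (a i)) = fun i => ∑ c, B (b' (a i)) (e c) • e' c from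
      funext fun i => (he.sum_right hB _).symm]
    rw [MultilinearMap.map_sum]
    refine Finset.sum_congr rfl fun c _ => ?_
    rw [MultilinearMap.map_smul_univ]; rfl
  have h2 : ∀ c : Fin k → ι, Q (fun i => e (c i)) =
      ∑ a : Fin k → κ, (∏ i, B (b' (a i)) (e (c i))) * Q fun i => b (a i) := fun c => by
    conv_lhs => rw [show (fun i => e (c i)) = fun i => ∑ a, B (b' a) (e (c i)) • b a from
      funext fun i => by
        conv_lhs => rw [← hb.sum_left hs (e (c i))]
        refine Finset.sum_congr rfl fun a _ => ?_
        rw [hs.eq]]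
    rw [MultilinearMap.map_sum]
    refine Finset.sum_congr rfl fun a _ => ?_
    rw [MultilinearMap.map_smul_univ]; rfl
  simp only [h1, h2, Finset.sum_mul, Finset.mul_sum]
  rw [Finset.sum_comm]
  refine Finset.sum_congr rfl fun c _ => Finset.sum_congr rfl fun a _ => ?_
  ring

section

variable {n : ℕ} {B : LinearMap.BilinForm ℝ V₀} {e : Module.Basis (Fin n) ℝ V₀} {e' : Fin n → V₀}

/-- Laplace expansion along the first row. The corner entry is `1` for each of the `n` values of
`c`. In each of the `k` other terms the sum over `c` replaces `e c` by `y j`, and moving `y j` back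
to its place leaves minus the smaller Gram determinant. -/
theorem sum_det_gram_cons (hs : B.IsSymm) (h : IsReciprocal B e e')
    {k : ℕ} (x y : Fin k → V₀) :
    ∑ c, (Matrix.of fun i j => B ((Fin.cons (e' c) x : Fin (k + 1) → V₀) i)
      ((Fin.cons (e c) y : Fin (k + 1) → V₀) j)).det =
        ((n : ℝ) - k) * (Matrix.of fun i j => B (x i) (y j)).det := by
  classical
  rcases k with _ | k
  · simp [h.inner]
  have h1 : ∀ c, (Matrix.of fun i j => B ((Fin.cons (e' c) x : Fin (k + 2) → V₀) i)
      ((Fin.cons (e c) y : Fin (k + 2) → V₀) j)).det =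
      (Matrix.of fun i j => B (x i) (y j)).det -
      ∑ j : Fin (k + 1), (-1) ^ (j : ℕ) * B (e' c) (y j) *
        (Matrix.of fun i j' => B (x i) ((Fin.cons (e c) (j.removeNth y) : Fin (k + 1) → V₀) j')).det
      := fun c => by
    rw [Matrix.det_succ_row_zero, Fin.sum_univ_succ, sub_eq_add_neg, ← Finset.sum_neg_distrib]
    congr 1
    · simp only [Fin.val_zero, pow_zero, one_mul, Matrix.of_apply, Fin.cons_zero]
      rw [h.inner, if_pos rfl, one_mul]
      congr 1
    · refine Finset.sum_congr rfl fun j _ => ?_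
      simp only [Fin.val_succ, pow_succ, Matrix.of_apply, Fin.cons_zero, Fin.cons_succ]
      have : (Matrix.of fun i j => B ((Fin.cons (e' c) x : Fin (k + 2) → V₀) i)
          ((Fin.cons (e c) y : Fin (k + 2) → V₀) j)).submatrix Fin.succ j.succ.succAbove =
          (Matrix.of fun i j' =>
            B (x i) ((Fin.cons (e c) (j.removeNth y) : Fin (k + 1) → V₀) j')) := by
        ext i j'
        refine Fin.cases ?_ (fun m => ?_) j'
        · simp
        · simp [Fin.removeNth]
      rw [this]; ring
  simp only [h1, Finset.sum_sub_distrib, Finset.sum_const, Finset.card_univ, Fintype.card_fin,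
    nsmul_eq_mul]
  rw [Finset.sum_comm]
  have h2 : ∀ j : Fin (k + 1), ∑ c, (-1) ^ (j : ℕ) * B (e' c) (y j) *
        (Matrix.of fun i j' => B (x i) ((Fin.cons (e c) (j.removeNth y) : Fin (k + 1) → V₀) j')).det
      = (Matrix.of fun i j => B (x i) (y j)).det := fun j => by
    let f : V₀ [⋀^Fin (k + 1)]→ₗ[ℝ] ℝ :=
      (Matrix.detRowAlternating (n := Fin (k + 1)) (R := ℝ)).compLinearMap
        (LinearMap.pi fun i => B (x i))
    have hf : ∀ w : Fin (k + 1) → V₀, f w = (Matrix.of fun i j => B (x i) (w j)).det := fun w => by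
      rw [← Matrix.det_transpose]; rfl
    simp only [← hf]
    have h3 : ∀ z, f (Fin.cons z (j.removeNth y)) = f.toMultilinearMap.curryLeft z (j.removeNth y) := fun z => rfl
    have h4 : ∑ c, B (e' c) (y j) • f.toMultilinearMap.curryLeft (e c) = f.toMultilinearMap.curryLeft (y j) := by
      simp only [← map_smul, ← map_sum]
      congr 1
      simpa only [hs.eq] using h.sum_left hs (y j)
    have h5 : f y = (-1) ^ (j : ℕ) * f.toMultilinearMap.curryLeft (y j) (j.removeNth y) := by
      have := f.map_insertNth j (y j) (j.removeNth y)
      rw [Fin.insertNth_self_removeNth, zsmul_eq_mul] at this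
      rw [this]; push_cast; rfl
    rw [h5, ← h4]
    simp only [h3, mul_assoc, ← Finset.mul_sum]
    congr 1
    rw [sum_apply]
    rfl
  rw [Finset.sum_congr rfl fun j _ => h2 j]
  simp
  ring

/-- The `j` contractions are carried out one at a time. Contracting the index next to a block of
length `k` gives the factor `n - k`, and since `n = j + k` these factors multiply to `j!`. -/
theorem sum_det_gram_append (hs : B.IsSymm) (h : IsReciprocal B e e')
    (j k : ℕ) (hn : n = j + k) (x y : Fin k → V₀) :
    ∑ a : Fin j → Fin n, (Matrix.of fun i i' => B (Fin.append (fun i => e' (a i)) x i)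
      (Fin.append (fun i => e (a i)) y i')).det =
        (j.factorial : ℝ) * (Matrix.of fun i j => B (x i) (y j)).det := by
  induction j generalizing k with
  | zero =>
    simp only [Finset.univ_unique, Finset.sum_singleton, Nat.factorial_zero, Nat.cast_one, one_mul]
    have := Matrix.det_submatrix_equiv_self (finCongr (zero_add k))
      (Matrix.of fun i j => B (x i) (y j))
    rw [← this]
    congr 1
    ext i i'
    simp [Fin.append, Fin.addCases, Fin.subNat]
    rfl
  | succ j ih =>
    have h1 := fun c : Fin n => ih (k + 1) (by omega) (Fin.cons (e' c) x) (Fin.cons (e c) y)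
    rw [← (Fin.snocEquiv fun _ => Fin n).sum_comp, Fintype.sum_prod_type]
    have h2 : ∀ (c : Fin n) (a : Fin j → Fin n),
        (Matrix.of fun i i' => B (Fin.append
          (fun i => e' ((Fin.snocEquiv fun _ => Fin n) (c, a) i)) x i)
            (Fin.append (fun i => e ((Fin.snocEquiv fun _ => Fin n) (c, a) i)) y i')).det =
        (Matrix.of fun i i' => B (Fin.append (fun i => e' (a i))
          (Fin.cons (e' c) x : Fin (k + 1) → V₀) i)
            (Fin.append (fun i => e (a i)) (Fin.cons (e c) y : Fin (k + 1) → V₀) i')).det := by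
      intro c a
      have h3 : ∀ g : Fin n → V₀, (fun i => g ((Fin.snocEquiv fun _ => Fin n) (c, a) i)) =
          (Fin.snoc (fun i => g (a i)) (g c) : Fin (j + 1) → V₀) := fun g => by
        funext i
        refine Fin.lastCases ?_ (fun i => ?_) i <;> simp [Fin.snocEquiv]
      rw [h3 e, h3 e', Fin.append_left_snoc, Fin.append_left_snoc]
      exact Matrix.det_submatrix_equiv_self (finCongr (Nat.succ_add_eq_add_succ j k))
        (Matrix.of fun i i' => B (Fin.append (fun i => e' (a i))
          (Fin.cons (e' c) x : Fin (k + 1) → V₀) i)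
            (Fin.append (fun i => e (a i)) (Fin.cons (e c) y : Fin (k + 1) → V₀) i'))
    simp only [h2, h1]
    rw [← Finset.mul_sum, sum_det_gram_cons hs h, Nat.factorial_succ, hn]
    push_cast
    ring

/-- In the Leibniz formula the term of `σ` contracts to `f (x ∘ σ)`, whose sign cancels that of `σ`;
so each of the `k!` permutations contributes `f x`. -/
theorem sum_det_gram_mul (hs : B.IsSymm) (h : IsReciprocal B e e')
    {k : ℕ} (x : Fin k → V₀) (f : V₀ [⋀^Fin k]→ₗ[ℝ] ℝ) :
    ∑ b : Fin k → Fin n, (Matrix.of fun i j => B (x i) (e' (b j))).det * f (fun i => e (b i)) =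
      (k.factorial : ℝ) * f x := by
  have h1 : ∀ σ : Equiv.Perm (Fin k),
      ∑ b : Fin k → Fin n, (∏ i, B (x (σ i)) (e' (b i))) * f (fun i => e (b i)) =
        (Equiv.Perm.sign σ : ℤ) * f x := fun σ => by
    have : f (x ∘ σ) = ∑ b : Fin k → Fin n, (∏ i, B (x (σ i)) (e' (b i))) * f (fun i => e (b i)) := by
      conv_lhs => rw [show x ∘ σ = fun i => ∑ c, B (x (σ i)) (e' c) • e c from
        funext fun i => (h.sum_left hs _).symm]
      have := MultilinearMap.map_sum f.toMultilinearMap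
        (fun (i : Fin k) (c : Fin n) => B (x (σ i)) (e' c) • e c)
      refine this.trans (Finset.sum_congr rfl fun b _ => ?_)
      exact f.toMultilinearMap.map_smul_univ (fun i => B (x (σ i)) (e' (b i))) (fun i => e (b i))
    rw [← this, f.map_perm, Units.smul_def, zsmul_eq_mul]
  simp only [Matrix.det_apply, Finset.sum_mul]
  rw [Finset.sum_comm]
  have h2 : ∀ σ : Equiv.Perm (Fin k), ∑ b : Fin k → Fin n,
      (Equiv.Perm.sign σ • ∏ i, (Matrix.of fun i j => B (x i) (e' (b j))) (σ i) i) *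
        f (fun i => e (b i)) = f x := fun σ => by
    simp only [Units.smul_def, zsmul_eq_mul, Matrix.of_apply, mul_assoc]
    rw [← Finset.mul_sum, h1, ← mul_assoc, ← Int.cast_mul, ← Units.val_mul, Int.units_mul_self]
    simp
  simp only [h2, Finset.sum_const, Finset.card_univ, Fintype.card_perm, Fintype.card_fin,
    nsmul_eq_mul]

/-- The square of the Hodge operator is `(-1)^(k (n - k) + s)`. -/
theorem sum_volumeTensor_mul (hs : B.IsSymm) (hB : B.Nondegenerate) (h : IsReciprocal B e e')
    (o : Orientation ℝ V₀ (Fin n)) {j k : ℕ} (h₁ : n = j + k) (h₂ : n = k + j)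
    (x : Fin k → V₀) (f : V₀ [⋀^Fin k]→ₗ[ℝ] ℝ) :
    ∑ a : Fin j → Fin n, ∑ b : Fin k → Fin n,
      volumeTensor B o (Fin.append (fun i => e' (a i)) x ∘ Fin.cast h₁) *
        (volumeTensor B o (Fin.append (fun i => e' (b i)) (fun i => e (a i)) ∘ Fin.cast h₂) *
          f fun i => e (b i)) =
      (-1) ^ (k * j + sigNeg (LinearMap.BilinMap.toQuadraticMap B)) *
        (j.factorial * k.factorial) * f x := by
  have : FiniteDimensional ℝ V₀ := e.finiteDimensional_of_finite
  have hn : Module.finrank ℝ V₀ = n := by simpa using Module.finrank_eq_card_basis e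
  have h3 : ∀ (a : Fin j → Fin n) (b : Fin k → Fin n),
      volumeTensor B o (Fin.append (fun i => e' (a i)) x ∘ Fin.cast h₁) *
        (volumeTensor B o (Fin.append (fun i => e' (b i)) (fun i => e (a i)) ∘ Fin.cast h₂) *
          f fun i => e (b i)) =
      (-1) ^ (k * j + sigNeg (LinearMap.BilinMap.toQuadraticMap B)) *
        ((Matrix.of fun i i' => B (Fin.append (fun i => e' (a i)) x i)
          (Fin.append (fun i => e (a i)) (fun i => e' (b i)) i')).det * f fun i => e (b i)) := by
    intro a b
    -- Exchanging the blocks of the second factor costs `(-1)^(k j)` and puts the `a`-vectors first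
    -- in both, after which the product is a Gram determinant up to `(-1)^s`.
    rw [alternating_append_comm (volumeTensor B o) h₂ h₁, pow_add]
    have h4 := volumeTensor_mul hn hs hB o (Fin.append (fun i => e' (a i)) x ∘ Fin.cast h₁)
      (Fin.append (fun i => e (a i)) (fun i => e' (b i)) ∘ Fin.cast h₁)
    have h5 := Matrix.det_submatrix_equiv_self (finCongr h₁)
      (Matrix.of fun i i' => B (Fin.append (fun i => e' (a i)) x i)
          (Fin.append (fun i => e (a i)) (fun i => e' (b i)) i'))
    rw [← h5]
    rw [show (Matrix.of fun i i' => B (Fin.append (fun i => e' (a i)) x i)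
          (Fin.append (fun i => e (a i)) (fun i => e' (b i)) i')).submatrix
          (finCongr h₁) (finCongr h₁) = Matrix.of fun i i' =>
          B ((Fin.append (fun i => e' (a i)) x ∘ Fin.cast h₁) i)
          ((Fin.append (fun i => e (a i)) (fun i => e' (b i)) ∘ Fin.cast h₁) i') from rfl]
    linear_combination (-1) ^ (k * j) * (f fun i => e (b i)) * h4
  simp only [h3]
  -- For fixed `b`, the sum over `a` contracts the Gram determinant to `j!` times that of `x`
  -- against `e'_b`. The sum over `b` then evaluates `f` at `x`, with the factor `k!`.
  rw [Finset.sum_comm]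
  simp only [← Finset.mul_sum, ← Finset.sum_mul, sum_det_gram_append hs h j k h₁]
  simp only [mul_assoc, ← Finset.mul_sum, sum_det_gram_mul hs h]

end

end Contraction

/-! ### The Hodge operator on super alternating tensors -/

section Hodge

variable {V₀ V₁ : Type*} [AddCommGroup V₀] [Module ℝ V₀] [AddCommGroup V₁] [Module ℝ V₁]

theorem fillFirst_apply {V : Type*} [AddCommGroup V] [Module ℝ V] {k j : ℕ}
    (T : MultilinearMap ℝ (fun _ : Fin (k + j) => V) ℝ) (u : Fin k → V) (w : Fin j → V) :
    fillFirst T u w = T (Fin.append u w) := by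
  unfold fillFirst
  rw [MultilinearMap.currySum_apply, MultilinearMap.domDomCongr_apply]
  congr 1
  funext i
  refine Fin.addCases (fun x => ?_) (fun x => ?_) i
  · simp
  · simp

/-- A multilinear map with its last arguments fixed. -/
def fixLastMul {V : Type*} [AddCommGroup V] [Module ℝ V] {k j : ℕ}
    (T : MultilinearMap ℝ (fun _ : Fin (k + j) => V) ℝ) (w : Fin j → V) :
    MultilinearMap ℝ (fun _ : Fin k => V) ℝ where
  toFun x := T (Fin.append x w)
  map_update_add' := by
    intro inst x i y z
    obtain rfl := Subsingleton.elim inst (instDecidableEqFin k)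
    simp [append_update_left]
  map_update_smul' := by
    intro inst x i c y
    obtain rfl := Subsingleton.elim inst (instDecidableEqFin k)
    simp [append_update_left]

/-- A super alternating tensor with its odd arguments fixed, as an alternating map. -/
def evenSlots {k l : ℕ} (T : SuperTensor V₀ V₁ (k + l)) (hT : IsSuperAlternating T)
    (y : Fin l → V₀ × V₁) (hy : ∀ i, HasParity 1 (y i)) : V₀ [⋀^Fin k]→ₗ[ℝ] ℝ where
  toMultilinearMap := (fixLastMul T y).compLinearMap (fun _ => LinearMap.inl ℝ V₀ V₁)
  map_eq_zero_of_eq' x i i' h hne := by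
    change T (Fin.append (fun i => (x i, (0 : V₁))) y) = 0
    refine hT.eq_zero_of_eq (ε := Fin.append (fun _ => 0) (fun _ => 1)) (i := Fin.castAdd l i)
      (j := Fin.castAdd l i') (fun a => ?_) (by simpa using hne) (by simp [h]) (by simp)
    refine Fin.addCases (fun b => ?_) (fun b => ?_) a
    · simp [hasParity_zero_iff]
    · simpa using hy b

variable [FiniteDimensional ℝ V₀] {n : ℕ}

/-- The values of the Hodge operator on even arguments followed by odd ones. -/
def hodgeBlock (B : LinearMap.BilinForm ℝ V₀) (hB : B.Nondegenerate)
    (o : Orientation ℝ V₀ (Fin n)) {r : ℕ} (k l j : ℕ) (hr : r = k + l)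
    (hn : n = k + j) (T : SuperTensor V₀ V₁ r) : SuperTensor V₀ V₁ (j + l) :=
  ((Nat.factorial k : ℝ)⁻¹) • ∑ a : Fin k → Fin (Module.finrank ℝ V₀),
      ((LinearMap.mul' ℝ ℝ).compMultilinearMap
        (((fillFirst ((volumeTensor B o).toMultilinearMap.domDomCongr (finCongr hn))
            (fun i => (B.toDual hB).symm ((Module.finBasis ℝ V₀).coord (a i)))).compLinearMap
              (fun _ => LinearMap.fst ℝ V₀ V₁)).domCoprod
          (fillFirst (T.domDomCongr (finCongr hr))
            (fun i => (Module.finBasis ℝ V₀ (a i), (0 : V₁)))))).domDomCongr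
        finSumFinEquiv

theorem hodge_eq (B : LinearMap.BilinForm ℝ V₀) (hB : B.Nondegenerate)
    (o : Orientation ℝ V₀ (Fin n)) {r r' : ℕ} (k l j : ℕ) (hr : r = k + l) (hr' : r' = j + l)
    (hn : n = k + j) (T : SuperTensor V₀ V₁ r) (v : Fin r' → V₀ × V₁) :
    hodge B hB o k l j hr hr' hn T v =
      superExtend j l (hodgeBlock B hB o k l j hr hn T) (v ∘ Fin.cast hr'.symm) := rfl

/-- The Hodge operator can be computed in any basis. -/
theorem hodgeBlock_apply {B : LinearMap.BilinForm ℝ V₀} (hs : B.IsSymm) (hB : B.Nondegenerate)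
    {ι : Type*} [DecidableEq ι] [Fintype ι]
    {e : Module.Basis ι ℝ V₀} {e' : ι → V₀} (he : IsReciprocal B e e')
    (o : Orientation ℝ V₀ (Fin n)) {r : ℕ} (k l j : ℕ) (hr : r = k + l)
    (hn : n = k + j) (T : SuperTensor V₀ V₁ r) (v : Fin (j + l) → V₀ × V₁) :
    hodgeBlock B hB o k l j hr hn T v = ((k.factorial : ℝ)⁻¹) * ∑ a : Fin k → ι,
      volumeTensor B o
        (Fin.append (fun i => e' (a i)) (fun x => (v (Fin.castAdd l x)).1) ∘ Fin.cast hn) *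
      T (Fin.append (fun i => (e (a i), (0 : V₁))) (fun y => v (Fin.natAdd j y)) ∘ Fin.cast hr) := by
  subst hr hn
  -- The vectors dual under `B` to the coordinate forms are the reciprocal base of the basis used in
  -- the definition, so that independence of the basis applies.
  have hb : IsReciprocal B (Module.finBasis ℝ V₀)
      (fun i => (B.toDual hB).symm ((Module.finBasis ℝ V₀).coord i)) := ⟨fun i j => by
    rw [← LinearMap.BilinForm.toDual_def hB, LinearEquiv.apply_symm_apply]
    simp [Finsupp.single_apply]⟩
  have key := contraction_eq hs hB he hb
    (fixLast (volumeTensor B o) (fun x => (v (Fin.castAdd l x)).1)).toMultilinearMap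
    ((fixLastMul T (fun y => v (Fin.natAdd j y))).compLinearMap (fun _ => LinearMap.inl ℝ V₀ V₁))
  refine Eq.trans ?_ (congrArg (fun t => ((k.factorial : ℝ)⁻¹) * t) key)
  unfold hodgeBlock
  rw [smul_apply, sum_apply, smul_eq_mul]
  congr 1
  refine Finset.sum_congr rfl fun a _ => ?_
  rw [MultilinearMap.domDomCongr_apply, LinearMap.compMultilinearMap_apply,
    MultilinearMap.domCoprod_apply, LinearMap.mul'_apply, MultilinearMap.compLinearMap_apply,
    fillFirst_apply, fillFirst_apply]
  congr 1

/-- The even arguments enter only through the volume tensor, which alternates. The odd ones enter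
only through `T`, and there the sign for exchanging odd neighbours is `+1`. -/
theorem isBlockAlternating_hodgeBlock {B : LinearMap.BilinForm ℝ V₀} (hs : B.IsSymm)
    (hB : B.Nondegenerate) (o : Orientation ℝ V₀ (Fin n)) {r : ℕ} (k l j : ℕ) (hr : r = k + l)
    (hn : n = k + j) {T : SuperTensor V₀ V₁ r} (hT : IsSuperAlternating T) :
    IsBlockAlternating j l (hodgeBlock B hB o k l j hr hn T) := by
  subst hr hn
  have he := isReciprocal_dualBasis hB (Module.finBasis ℝ V₀)
  refine ⟨fun v hv a b hab hb => ?_, fun v hv a b hab ha => ?_⟩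
  · rw [hodgeBlock_apply hs hB he, hodgeBlock_apply hs hB he, ← mul_neg, ← Finset.sum_neg_distrib]
    congr 1
    refine Finset.sum_congr rfl fun c _ => ?_
    rw [← neg_mul]
    obtain ⟨a, rfl⟩ : ∃ a' : Fin j, a = Fin.castAdd l a' := ⟨⟨a, by omega⟩, rfl⟩
    obtain ⟨b, rfl⟩ : ∃ b' : Fin j, b = Fin.castAdd l b' := ⟨⟨b, hb⟩, rfl⟩
    congr 1
    · rw [← AlternatingMap.map_swap (i := Fin.natAdd k a) (j := Fin.natAdd k b)]
      · congr 1
        funext x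
        refine Fin.addCases (fun y => ?_) (fun y => ?_) x
        · rw [Function.comp_apply, Function.comp_apply, Equiv.swap_apply_of_ne_of_ne
            (by simp [Fin.ext_iff]; omega) (by simp [Fin.ext_iff]; omega)]
          simp
        · simp only [Function.comp_apply, Fin.cast_refl, id_eq, Fin.append_right]
          rw [← (Fin.natAdd_injective j k).map_swap, Fin.append_right,
            ← (Fin.castAdd_injective j l).map_swap]
      · intro h
        have := (Fin.natAdd_injective j k) h
        subst this; omega
    · congr 1
      funext x
      refine Fin.addCases (fun y => ?_) (fun y => ?_) x
      · simp
      · simp only [Function.comp_apply, Fin.cast_refl, id_eq, Fin.append_right]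
        rw [Equiv.swap_apply_of_ne_of_ne (by simp [Fin.ext_iff]; omega)
          (by simp [Fin.ext_iff]; omega)]
  · rw [hodgeBlock_apply hs hB he, hodgeBlock_apply hs hB he]
    congr 1
    refine Finset.sum_congr rfl fun c _ => ?_
    obtain ⟨a, rfl⟩ : ∃ a' : Fin l, a = Fin.natAdd j a' := ⟨⟨a - j, by omega⟩, by ext; simp; omega⟩
    obtain ⟨b, rfl⟩ : ∃ b' : Fin l, b = Fin.natAdd j b' := ⟨⟨b - j, by omega⟩, by ext; simp; omega⟩
    congr 1
    · congr 1
      funext x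
      refine Fin.addCases (fun y => ?_) (fun y => ?_) x
      · simp
      · simp only [Function.comp_apply, Fin.cast_refl, id_eq, Fin.append_right]
        rw [Equiv.swap_apply_of_ne_of_ne (by simp [Fin.ext_iff]; omega)
          (by simp [Fin.ext_iff]; omega)]
    · have h := hT (Fin.append (fun i => (Module.finBasis ℝ V₀ (c i), (0 : V₁)))
        (fun y => v (Fin.natAdd j y))) (Fin.append (fun _ => 0) (fun _ => 1)) (fun x => by
          refine Fin.addCases (fun y => ?_) (fun y => ?_) x
          · simp [hasParity_zero_iff]
          · simpa using hv (Fin.natAdd j y)) (Fin.natAdd k a) (Fin.natAdd k b)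
          (by simp at hab ⊢; omega)
      simp only [Fin.append_right, Fin.val_one, mul_one, pow_one, neg_neg, one_mul] at h
      refine Eq.trans ?_ h.symm
      congr 1
      funext x
      refine Fin.addCases (fun y => ?_) (fun y => ?_) x
      · rw [Function.comp_apply, Function.comp_apply, Equiv.swap_apply_of_ne_of_ne
          (by simp [Fin.ext_iff]; omega) (by simp [Fin.ext_iff]; omega)]
        simp
      · simp only [Function.comp_apply, Fin.cast_refl, id_eq, Fin.append_right]
        rw [← (Fin.natAdd_injective l k).map_swap, Fin.append_right,
          ← (Fin.natAdd_injective l j).map_swap]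

theorem isSuperAlternating_hodge {B : LinearMap.BilinForm ℝ V₀} (hs : B.IsSymm)
    (hB : B.Nondegenerate) (o : Orientation ℝ V₀ (Fin n)) {r r' : ℕ} (k l j : ℕ) (hr : r = k + l)
    (hr' : r' = j + l) (hn : n = k + j) {T : SuperTensor V₀ V₁ r} (hT : IsSuperAlternating T) :
    IsSuperAlternating (hodge B hB o k l j hr hr' hn T) := by
  subst hr'
  exact (isBlockAlternating_hodgeBlock hs hB o k l j hr hn hT).isSuperAlternating_superExtend

/-- On arguments of the right sorted type only the identity shuffle contributes, so the operator
reduces to its block formula. -/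
theorem hodge_apply_sorted {B : LinearMap.BilinForm ℝ V₀} (hs : B.IsSymm) (hB : B.Nondegenerate)
    {ι : Type*} [DecidableEq ι] [Fintype ι]
    {e : Module.Basis ι ℝ V₀} {e' : ι → V₀} (he : IsReciprocal B e e')
    (o : Orientation ℝ V₀ (Fin n)) {r r' : ℕ} (k l j : ℕ) (hr : r = k + l) (hr' : r' = j + l)
    (hn : n = k + j) (T : SuperTensor V₀ V₁ r) {v : Fin r' → V₀ × V₁}
    (hv : ∀ x : Fin r', HasParity (if (x : ℕ) < j then 0 else 1) (v x)) :
    hodge B hB o k l j hr hr' hn T v = ((k.factorial : ℝ)⁻¹) * ∑ a : Fin k → ι,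
      volumeTensor B o (Fin.append (fun i => e' (a i))
        (fun x => (v (Fin.cast hr'.symm (Fin.castAdd l x))).1) ∘ Fin.cast hn) *
      T (Fin.append (fun i => (e (a i), (0 : V₁)))
        (fun y => v (Fin.cast hr'.symm (Fin.natAdd j y))) ∘ Fin.cast hr) := by
  rw [hodge_eq, superExtend_apply_sorted (κ := j) (v := v ∘ Fin.cast hr'.symm) _ (by omega) (fun x => hv (Fin.cast hr'.symm x)), if_pos rfl,
    hodgeBlock_apply hs hB he]
  rfl

theorem hodge_apply_sorted_of_ne {B : LinearMap.BilinForm ℝ V₀} (hB : B.Nondegenerate)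
    (o : Orientation ℝ V₀ (Fin n)) {r r' : ℕ} (k l j : ℕ) (hr : r = k + l) (hr' : r' = j + l)
    (hn : n = k + j) (T : SuperTensor V₀ V₁ r) {v : Fin r' → V₀ × V₁} {κ : ℕ} (hκ : κ ≤ r')
    (hv : ∀ x : Fin r', HasParity (if (x : ℕ) < κ then 0 else 1) (v x)) (hne : κ ≠ j) :
    hodge B hB o k l j hr hr' hn T v = 0 := by
  rw [hodge_eq, superExtend_apply_sorted (κ := κ) (v := v ∘ Fin.cast hr'.symm) _ (by omega) (fun x => hv (Fin.cast hr'.symm x)), if_neg hne]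

theorem hodgeBlock_add {B : LinearMap.BilinForm ℝ V₀} (hs : B.IsSymm) (hB : B.Nondegenerate)
    (o : Orientation ℝ V₀ (Fin n)) {r : ℕ} (k l j : ℕ) (hr : r = k + l)
    (hn : n = k + j) (T S : SuperTensor V₀ V₁ r) :
    hodgeBlock B hB o k l j hr hn (T + S) =
      hodgeBlock B hB o k l j hr hn T + hodgeBlock B hB o k l j hr hn S := by
  ext v
  rw [add_apply]
  simp only [hodgeBlock_apply hs hB (isReciprocal_dualBasis hB (Module.finBasis ℝ V₀)),
    add_apply, mul_add, Finset.sum_add_distrib]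

theorem hodgeBlock_smul {B : LinearMap.BilinForm ℝ V₀} (hs : B.IsSymm) (hB : B.Nondegenerate)
    (o : Orientation ℝ V₀ (Fin n)) {r : ℕ} (k l j : ℕ) (hr : r = k + l)
    (hn : n = k + j) (c : ℝ) (T : SuperTensor V₀ V₁ r) :
    hodgeBlock B hB o k l j hr hn (c • T) = c • hodgeBlock B hB o k l j hr hn T := by
  ext v
  rw [smul_apply]
  simp only [hodgeBlock_apply hs hB (isReciprocal_dualBasis hB (Module.finBasis ℝ V₀)),
    smul_apply, smul_eq_mul, Finset.mul_sum]
  refine Finset.sum_congr rfl fun a _ => ?_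
  ring

/-- The Hodge operator as a linear map. -/
def hodgeLinear {B : LinearMap.BilinForm ℝ V₀} (hs : B.IsSymm) (hB : B.Nondegenerate)
    (o : Orientation ℝ V₀ (Fin n)) {r r' : ℕ} (k l j : ℕ) (hr : r = k + l) (hr' : r' = j + l)
    (hn : n = k + j) : SuperTensor V₀ V₁ r →ₗ[ℝ] SuperTensor V₀ V₁ r' where
  toFun T := hodge B hB o k l j hr hr' hn T
  map_add' T S := by
    ext v
    rw [add_apply]
    simp only [hodge_eq, hodgeBlock_add hs hB, superExtend_apply, blockPart_apply,
      add_apply, mul_add, Finset.sum_add_distrib]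
  map_smul' c T := by
    ext v
    simp only [RingHom.id_apply]
    rw [smul_apply]
    simp only [hodge_eq, hodgeBlock_smul hs hB, superExtend_apply, blockPart_apply,
      smul_apply, smul_eq_mul, Finset.mul_sum]
    refine Finset.sum_congr rfl fun a _ => ?_
    ring

end Hodge

/-! ### The algebra of `H d H` -/

section HodgeExteriorHodge

variable {V₀ V₁ : Type*} [AddCommGroup V₀] [Module ℝ V₀] [AddCommGroup V₁] [Module ℝ V₁]
  {n : ℕ}

theorem IsSuperAlternating.domDomCongr_finCongr {r r' : ℕ} {T : SuperTensor V₀ V₁ r}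
    (hT : IsSuperAlternating T) (h : r = r') : IsSuperAlternating (T.domDomCongr (finCongr h)) := by
  subst h; exact hT

theorem sum_pi_eq_insertNth {k : ℕ} (i : Fin (k + 1)) (F : (Fin (k + 1) → Fin n) → ℝ) :
    ∑ a, F a = ∑ c : Fin n, ∑ a : Fin k → Fin n, F (i.insertNth c a) := by
  rw [← (Fin.insertNthEquiv (fun _ => Fin n) i).sum_comp, Fintype.sum_prod_type]
  rfl

theorem comp_insertNth {α β : Type*} {k : ℕ} (i : Fin (k + 1)) (g : α → β) (c : α) (a : Fin k → α) :
    (fun x => g ((i.insertNth c a : Fin (k + 1) → α) x)) =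
      (i.insertNth (g c) (fun x => g (a x)) : Fin (k + 1) → β) := by
  funext x
  refine Fin.succAboveCases i ?_ (fun y => ?_) x <;> simp

theorem Fin.cast_comp_append_insertNth_last {α : Type*} {n j k : ℕ} (h : n = j + 1 + k)
    (h' : n = j + (k + 1)) (a : Fin j → α) (c : α) (z : Fin k → α) :
    Fin.append ((Fin.last j).insertNth c a : Fin (j + 1) → α) z ∘ Fin.cast h =
      Fin.append a (Fin.cons c z : Fin (k + 1) → α) ∘ Fin.cast h' := by
  subst h
  rw [Fin.insertNth_last', Fin.append_left_snoc]
  rfl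

/-- Antisymmetrization of a contraction: the sum over the places of a distinguished argument. -/
theorem sum_alternating_mul_removeNth {j k : ℕ} (f : V₀ [⋀^Fin n]→ₗ[ℝ] ℝ) (h : n = j + 1 + k)
    (h' : n = j + (k + 1)) (e' : Fin n → V₀) (z : Fin k → V₀)
    (G : Fin n → (Fin j → Fin n) → ℝ) :
    ∑ a : Fin (j + 1) → Fin n, f (Fin.append (fun i => e' (a i)) z ∘ Fin.cast h) *
      ∑ i : Fin (j + 1), (-1) ^ (i : ℕ) * G (a i) (i.removeNth a) =
    (j + 1 : ℝ) * ((-1) ^ j * ∑ c, ∑ a : Fin j → Fin n,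
      f (Fin.append (fun i => e' (a i)) (Fin.cons (e' c) z : Fin (k + 1) → V₀) ∘ Fin.cast h') *
        G c a) := by
  let F : V₀ [⋀^Fin (j + 1)]→ₗ[ℝ] ℝ := fixLast (f.domDomCongr (finCongr h)) z
  have hF : ∀ x, F x = f (Fin.append x z ∘ Fin.cast h) := fun x => rfl
  simp only [Finset.mul_sum, ← hF]
  rw [Finset.sum_comm]
  -- Moving the distinguished vector from place `i` to the last place `j` costs `(-1)^(i + j)`. The
  -- given sign `(-1)^i` then leaves `(-1)^j`, and all `j + 1` values of `i` contribute equally.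
  have h1 : ∀ i : Fin (j + 1), ∑ a : Fin (j + 1) → Fin n,
      F (fun i => e' (a i)) * ((-1) ^ (i : ℕ) * G (a i) (i.removeNth a)) =
      ∑ c, ∑ a : Fin j → Fin n, (-1) ^ j *
      (f (Fin.append (fun i => e' (a i)) (Fin.cons (e' c) z : Fin (k + 1) → V₀) ∘ Fin.cast h') *
        G c a) := fun i => by
    rw [sum_pi_eq_insertNth i]
    refine Finset.sum_congr rfl fun c _ => Finset.sum_congr rfl fun a _ => ?_
    rw [comp_insertNth, Fin.insertNth_apply_same, Fin.removeNth_insertNth, F.map_insertNth,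
      ← Fin.cast_comp_append_insertNth_last h h', ← hF, F.map_insertNth, zsmul_eq_mul, zsmul_eq_mul]
    have hq : ∀ m : ℕ, ((-1 : ℝ) ^ m) * (-1) ^ m = 1 := fun m => by
      rw [← mul_pow]; simp
    push_cast
    linear_combination (G c a * F (Matrix.vecCons (e' c) fun x => e' (a x))) * (hq i - hq j)
  rw [Finset.sum_congr rfl fun i _ => h1 i]
  simp only [Finset.sum_const, Finset.card_univ, Fintype.card_fin, nsmul_eq_mul, Finset.mul_sum]
  push_cast
  rfl

variable [FiniteDimensional ℝ V₀]

/-- The algebraic part of the formula for the divergence: `H d H` in terms of a covariant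
derivative `L`. -/
theorem hodge_exterior_hodge {B : LinearMap.BilinForm ℝ V₀} (hs : B.IsSymm) (hB : B.Nondegenerate)
    {e : Module.Basis (Fin n) ℝ V₀} {e' : Fin n → V₀} (he : IsReciprocal B e e')
    (o : Orientation ℝ V₀ (Fin n)) {r k l j : ℕ} (hr : r + 1 = (k + 1) + l) (hr' : r = k + l)
    (hn : n = (k + 1) + j) (hn' : n = (j + 1) + k) (hD' : j + l + 1 = (j + 1) + l)
    (L : V₀ →ₗ[ℝ] SuperTensor V₀ V₁ (r + 1)) (hL : ∀ v, IsSuperAlternating (L v))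
    (D : SuperTensor V₀ V₁ (j + l + 1))
    (hD : ∀ v, D v = ∑ i : Fin (j + l + 1), (-1) ^ (i : ℕ) *
      hodge B hB o (k + 1) l j hr rfl hn (L (v i).1) (i.removeNth v))
    {w : Fin r → V₀ × V₁} (hw : ∀ x : Fin r, HasParity (if (x : ℕ) < k then 0 else 1) (w x)) :
    hodge B hB o (j + 1) l k hD' hr' hn' D w =
      (-1) ^ ((k + 2) * j + sigNeg (LinearMap.BilinMap.toQuadraticMap B)) *
        ∑ c, L (e c) (Fin.cons (e' c, 0) w) := by
  rw [hodge_apply_sorted hs hB he o (j + 1) l k hD' hr' hn' D hw]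
  set z : Fin k → V₀ := fun x => (w (Fin.cast hr'.symm (Fin.castAdd l x))).1 with hz
  set y : Fin l → V₀ × V₁ := fun x => w (Fin.cast hr'.symm (Fin.natAdd k x)) with hy
  have hyo : ∀ x, HasParity 1 (y x) := fun x => by
    have := hw (Fin.cast hr'.symm (Fin.natAdd k x))
    rwa [if_neg (by simp)] at this
  let τ : Fin n → V₀ [⋀^Fin (k + 1)]→ₗ[ℝ] ℝ := fun c =>
    evenSlots ((L (e c)).domDomCongr (finCongr hr)) ((hL (e c)).domDomCongr_finCongr hr) y hyo
  have hτ : ∀ c x, τ c x = L (e c) (Fin.append (fun i => (x i, (0 : V₁))) y ∘ Fin.cast hr) :=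
    fun c x => rfl
  -- `G c a` is the value of the Hodge dual of `L (e c)` on the even vectors `e_a` followed by the
  -- odd vectors `y`.
  let G : Fin n → (Fin j → Fin n) → ℝ := fun c a => (((k + 1).factorial : ℝ)⁻¹) *
    ∑ b : Fin (k + 1) → Fin n,
      volumeTensor B o (Fin.append (fun i => e' (b i)) (fun i => e (a i)) ∘ Fin.cast hn) *
        τ c fun i => e (b i)
  have hDG : ∀ a : Fin (j + 1) → Fin n,
      D (Fin.append (fun i => (e (a i), (0 : V₁))) y ∘ Fin.cast hD') =
        ∑ i : Fin (j + 1), (-1) ^ (i : ℕ) * G (a i) (i.removeNth a) := fun a => by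
    rw [hD, ← (finCongr hD').symm.sum_comp, Fin.sum_univ_add]
    -- The summands of the alternation that differentiate along one of the odd arguments `y` vanish,
    -- since `L` sees only the even component.
    have h0 : ∀ i : Fin l, ((Fin.append (fun i => (e (a i), (0 : V₁))) y ∘ Fin.cast hD')
        ((finCongr hD').symm (Fin.natAdd (j + 1) i))).1 = 0 := fun i => by
      simpa using hasParity_one_iff.1 (hyo i)
    have h00 : hodge (V₁ := V₁) B hB o (k + 1) l j hr rfl hn 0 = 0 :=
      (hodgeLinear hs hB o (k + 1) l j hr rfl hn).map_zero
    rw [Finset.sum_eq_zero (f := fun i : Fin l => _) (fun i _ => by rw [h0, map_zero, h00]; simp),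
      add_zero]
    refine Finset.sum_congr rfl fun i _ => ?_
    have hi : ((Fin.append (fun i => (e (a i), (0 : V₁))) y ∘ Fin.cast hD')
        ((finCongr hD').symm (Fin.castAdd l i))).1 = e (a i) := by simp
    have hx1 : ∀ x : Fin j, (((finCongr hD').symm (Fin.castAdd l i)).removeNth
        (Fin.append (fun i => (e (a i), (0 : V₁))) y ∘ Fin.cast hD')) (Fin.castAdd l x) =
        (e (i.removeNth a x), (0 : V₁)) := fun x => by
      simp only [Fin.removeNth, Function.comp_apply]
      rw [← Fin.append_left (fun i => (e (a i), (0 : V₁))) y]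
      congr 1
      rcases lt_or_ge (x.castSucc) i with hlt | hlt
      · rw [Fin.succAbove_of_castSucc_lt _ _ hlt, Fin.succAbove_of_castSucc_lt _ _ (by
          rw [Fin.lt_def] at *; simpa using hlt)]
        ext; simp
      · rw [Fin.succAbove_of_le_castSucc _ _ hlt, Fin.succAbove_of_le_castSucc _ _ (by
          rw [Fin.le_def] at *; simpa using hlt)]
        ext; simp
    have hx2 : ∀ x : Fin l, (((finCongr hD').symm (Fin.castAdd l i)).removeNth
        (Fin.append (fun i => (e (a i), (0 : V₁))) y ∘ Fin.cast hD')) (Fin.natAdd j x) = y x :=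
      fun x => by
      simp only [Fin.removeNth, Function.comp_apply]
      rw [← Fin.append_right (fun i => (e (a i), (0 : V₁))) y]
      congr 1
      rw [Fin.succAbove_of_le_castSucc _ _ (by rw [Fin.le_def]; simp; omega)]
      ext; simp; omega
    rw [hi, hodge_apply_sorted hs hB he o (k + 1) l j hr rfl hn]
    · simp only [Fin.cast_refl, id_eq, hx1, hx2]
      rfl
    · intro x
      refine Fin.addCases (fun x => ?_) (fun x => ?_) x
      · rw [hx1, if_pos (by simp)]; simp [hasParity_zero_iff]
      · rw [hx2, if_neg (by simp)]; exact hyo x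
  simp only [hDG]
  have hn'' : n = j + (k + 1) := by omega
  rw [sum_alternating_mul_removeNth (volumeTensor B o) hn' hn'']
  -- Here the two Hodge operators meet. Applied to the `(k+1)`-form `τ c` they give it back up to
  -- sign and factorials, evaluated at the extra vector `e' c` and `z`.
  have hc : ∀ c, ∑ a : Fin j → Fin n, volumeTensor B o (Fin.append (fun i => e' (a i))
      (Fin.cons (e' c) z : Fin (k + 1) → V₀) ∘ Fin.cast hn'') * G c a =
      (((k + 1).factorial : ℝ)⁻¹) *
      ((-1) ^ ((k + 1) * j + sigNeg (LinearMap.BilinMap.toQuadraticMap B)) *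
        (j.factorial * (k + 1).factorial) * L (e c) (Fin.cons (e' c, 0) w)) := fun c => by
    have h1 := sum_volumeTensor_mul hs hB he o hn'' hn (Fin.cons (e' c) z) (τ c)
    have h2 : τ c (Fin.cons (e' c) z) = L (e c) (Fin.cons (e' c, 0) w) := by
      rw [hτ]
      congr 1
      funext x
      refine Fin.cases ?_ (fun x => ?_) x
      · rw [Function.comp_apply, show Fin.cast hr 0 = Fin.castAdd l (0 : Fin (k + 1)) by ext; simp,
          Fin.append_left]
        simp
      · rw [Fin.cons_succ, Function.comp_apply]
        by_cases hx : (x : ℕ) < k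
        · rw [show Fin.cast hr x.succ = Fin.castAdd l (⟨x, hx⟩ : Fin k).succ by ext; simp,
            Fin.append_left, Fin.cons_succ]
          have := hw x
          rw [if_pos hx, hasParity_zero_iff] at this
          ext
          · rfl
          · exact this.symm
        · rw [show Fin.cast hr x.succ = Fin.natAdd (k + 1) (⟨x - k, by omega⟩ : Fin l) by
            ext; simp; omega, Fin.append_right]
          simp only [hy]
          congr 1
          ext; simp; omega
    rw [← h2, ← h1, Finset.mul_sum]
    refine Finset.sum_congr rfl fun a _ => ?_
    simp only [G, Finset.mul_sum]
    refine Finset.sum_congr rfl fun b _ => ?_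
    ring
  simp only [hc, ← Finset.mul_sum]
  -- The factor `(-1)^j` from the alternation turns `(-1)^((k+1)j)` into `(-1)^((k+2)j)`, and the
  -- factorials cancel because `(j+1)! = (j+1) · j!`.
  rw [Nat.factorial_succ j]
  have h1 : ((j : ℝ) + 1) ≠ 0 := by positivity
  have h2 : (j.factorial : ℝ) ≠ 0 := by positivity
  have h3 : ((k + 1).factorial : ℝ) ≠ 0 := by positivity
  push_cast
  field_simp
  ring

end HodgeExteriorHodge

/-! ### Directional derivatives of functions on the manifold -/

section Derivative

open Filter Topology

variable {n : ℕ} {M : Type*} [TopologicalSpace M] [ChartedSpace (EuclideanSpace ℝ (Fin n)) M]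

/-- The function `f` is differentiable at `p`, with derivative `c` along `v`. -/
def HasDerivAlong (f : M → ℝ) (p : M) (v : TangentSpace (𝓡 n) p) (c : ℝ) : Prop :=
  MDifferentiableAt (𝓡 n) 𝓘(ℝ, ℝ) f p ∧ (mfderiv (𝓡 n) 𝓘(ℝ, ℝ) f p v : ℝ) = c

variable {p : M} {v : TangentSpace (𝓡 n) p} {f g : M → ℝ} {a b : ℝ}

theorem HasDerivAlong.unique (h : HasDerivAlong f p v a) (h' : HasDerivAlong f p v b) : a = b :=
  h.2.symm.trans h'.2

theorem HasDerivAlong.congr (h : HasDerivAlong f p v a) (hfg : g =ᶠ[𝓝 p] f) :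
    HasDerivAlong g p v a :=
  ⟨h.1.congr_of_eventuallyEq hfg, by rw [hfg.mfderiv_eq]; exact h.2⟩

theorem hasDerivAlong_const (c : ℝ) : HasDerivAlong (fun _ : M => c) p v 0 :=
  ⟨mdifferentiableAt_const, by rw [mfderiv_const]; rfl⟩

theorem HasDerivAlong.of_hasMFDerivAt {L : TangentSpace (𝓡 n) p →L[ℝ] ℝ}
    (h : HasMFDerivAt (𝓡 n) 𝓘(ℝ, ℝ) f p L) (hL : L v = a) : HasDerivAlong f p v a :=
  ⟨h.mdifferentiableAt, by rw [h.mfderiv]; exact hL⟩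

theorem HasDerivAlong.exists_hasMFDerivAt (h : HasDerivAlong f p v a) :
    ∃ L : TangentSpace (𝓡 n) p →L[ℝ] ℝ, HasMFDerivAt (𝓡 n) 𝓘(ℝ, ℝ) f p L ∧ L v = a :=
  ⟨_, h.1.hasMFDerivAt, h.2⟩

theorem HasDerivAlong.add (hf : HasDerivAlong f p v a) (hg : HasDerivAlong g p v b) :
    HasDerivAlong (fun q => f q + g q) p v (a + b) := by
  obtain ⟨K, hK, rfl⟩ := hf.exists_hasMFDerivAt
  obtain ⟨L, hL, rfl⟩ := hg.exists_hasMFDerivAt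
  exact .of_hasMFDerivAt (L := K + L) (hK.add hL) rfl

theorem HasDerivAlong.mul (hf : HasDerivAlong f p v a) (hg : HasDerivAlong g p v b) :
    HasDerivAlong (fun q => f q * g q) p v (a * g p + f p * b) := by
  obtain ⟨K, hK, rfl⟩ := hf.exists_hasMFDerivAt
  obtain ⟨L, hL, rfl⟩ := hg.exists_hasMFDerivAt
  refine .of_hasMFDerivAt (L := f p • L + g p • K) (hK.mul hL) ?_
  simp only [add_apply, smul_apply, smul_eq_mul]
  ring

theorem HasDerivAlong.const_mul (c : ℝ) (hf : HasDerivAlong f p v a) :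
    HasDerivAlong (fun q => c * f q) p v (c * a) := by
  simpa using (hasDerivAlong_const (p := p) (v := v) c).mul hf

theorem HasDerivAlong.sum {ι : Type*} (s : Finset ι) {f : ι → M → ℝ} {a : ι → ℝ}
    (h : ∀ i ∈ s, HasDerivAlong (f i) p v (a i)) :
    HasDerivAlong (fun q => ∑ i ∈ s, f i q) p v (∑ i ∈ s, a i) := by
  classical
  induction s using Finset.induction_on with
  | empty => simpa using hasDerivAlong_const (p := p) (v := v) 0
  | insert i s hi ih =>
    simp only [Finset.sum_insert hi]
    exact (h i (Finset.mem_insert_self i s)).add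
      (ih fun j hj => h j (Finset.mem_insert_of_mem hj))

theorem HasDerivAlong.prod {ι : Type*} [DecidableEq ι] (s : Finset ι) {f : ι → M → ℝ} {a : ι → ℝ}
    (h : ∀ i ∈ s, HasDerivAlong (f i) p v (a i)) :
    HasDerivAlong (fun q => ∏ i ∈ s, f i q) p v (∑ i ∈ s, (∏ j ∈ s.erase i, f j p) * a i) := by
  induction s using Finset.induction_on with
  | empty => simpa using hasDerivAlong_const (p := p) (v := v) 1
  | insert i s hi ih =>
    simp only [Finset.prod_insert hi, Finset.sum_insert hi, Finset.erase_insert hi]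
    have := (h i (Finset.mem_insert_self i s)).mul
      (ih fun j hj => h j (Finset.mem_insert_of_mem hj))
    convert! this using 2
    · ring
    · rw [Finset.mul_sum]
      refine Finset.sum_congr rfl fun j hj => ?_
      have hij : i ≠ j := fun h => hi (h ▸ hj)
      rw [Finset.erase_insert_of_ne hij, Finset.prod_insert (by simp [hi]), mul_assoc]

theorem HasDerivAlong.comp {φ : ℝ → ℝ} {c : ℝ} (hf : HasDerivAlong f p v a)
    (hφ : HasDerivAt φ c (f p)) : HasDerivAlong (fun q => φ (f q)) p v (c * a) := by
  have h1 : HasMFDerivAt 𝓘(ℝ, ℝ) 𝓘(ℝ, ℝ) φ (f p) _ := hφ.hasFDerivAt.hasMFDerivAt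
  refine .of_hasMFDerivAt (h1.comp p hf.1.hasMFDerivAt) ?_
  exact (mul_comm _ _).trans (congrArg (c * ·) hf.2)

/-- If the entries of a matrix have derivative zero, then so does its determinant. -/
theorem HasDerivAlong.det {k : ℕ} {A : M → Matrix (Fin k) (Fin k) ℝ}
    (h : ∀ i j, HasDerivAlong (fun q => A q i j) p v 0) :
    HasDerivAlong (fun q => (A q).det) p v 0 := by
  classical
  simp only [Matrix.det_apply']
  have := HasDerivAlong.sum Finset.univ fun (σ : Equiv.Perm (Fin k)) _ =>
    (HasDerivAlong.prod Finset.univ (fun i _ => h (σ i) i)).const_mul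
      ((Equiv.Perm.sign σ : ℤ) : ℝ)
  simpa using this

/-- Every linear form on a tangent space is the differential of a function. -/
theorem exists_smoothFunNear_hasDerivAlong [IsManifold (𝓡 n) ∞ M]
    (l : TangentSpace (𝓡 n) p →ₗ[ℝ] ℝ) :
    ∃ f : M → ℝ, (∃ U : Set M, IsOpen U ∧ p ∈ U ∧ SmoothFunOn (n := n) f U) ∧ f p = 0 ∧
      ∀ v, HasDerivAlong f p v (l v) := by
  let l' : EuclideanSpace ℝ (Fin n) →L[ℝ] ℝ := LinearMap.toContinuousLinearMap l
  have h1 : HasMFDerivAt 𝓘(ℝ, EuclideanSpace ℝ (Fin n)) 𝓘(ℝ, ℝ)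
      (fun x => l' x - l' (extChartAt (𝓡 n) p p)) (extChartAt (𝓡 n) p p) l' :=
    (l'.hasFDerivAt.sub_const _).hasMFDerivAt
  refine ⟨fun q => l' (extChartAt (𝓡 n) p q) - l' (extChartAt (𝓡 n) p p),
    ⟨(chartAt (EuclideanSpace ℝ (Fin n)) p).source, (chartAt _ p).open_source,
      mem_chart_source _ p, ?_⟩, sub_self _, fun v => ?_⟩
  · exact ((l'.contDiff.sub contDiff_const).contMDiff).comp_contMDiffOn contMDiffOn_extChartAt
  -- At its own base point the preferred chart has the identity as derivative, so composing `l` with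
  -- the centred chart gives a function with differential `l`.
  · have h2 := hasMFDerivAt_extChartAt (I := 𝓡 n) (mem_chart_source (EuclideanSpace ℝ (Fin n)) p)
    rw [mfderiv_chartAt_eq_tangentCoordChange (mem_chart_source _ p)] at h2
    refine .of_hasMFDerivAt (h1.comp p h2) ?_
    exact congrArg l' (tangentCoordChange_self (I := 𝓡 n) (mem_extChartAt_source p))

/-- Smoothness of a function on some neighbourhood of `p`. -/
def SmoothFunNear (f : M → ℝ) (p : M) : Prop :=
  ∃ U : Set M, IsOpen U ∧ p ∈ U ∧ SmoothFunOn (n := n) f U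

theorem SmoothFunNear.mdifferentiableAt (h : SmoothFunNear (n := n) f p) :
    MDifferentiableAt (𝓡 n) 𝓘(ℝ, ℝ) f p := by
  obtain ⟨U, hU, hp, h⟩ := h
  exact (h.contMDiffAt (hU.mem_nhds hp)).mdifferentiableAt (by simp)

end Derivative

/-! ### Smooth super vector fields near a point -/

section Fields

open Filter Topology

variable {n : ℕ} {M : Type*} [TopologicalSpace M] [ChartedSpace (EuclideanSpace ℝ (Fin n)) M]
  [IsManifold (𝓡 n) ∞ M] {W : Type*} [NormedAddCommGroup W] [NormedSpace ℝ W]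

/-- Smoothness of a super vector field on some neighbourhood of `p`. -/
def SmoothFieldNear (X : SuperField n M W) (p : M) : Prop :=
  ∃ U : Set M, IsOpen U ∧ p ∈ U ∧ SmoothFieldOn X U

theorem SmoothFieldOn.mono {X : SuperField n M W} {U V : Set M} (h : SmoothFieldOn X U)
    (hVU : V ⊆ U) : SmoothFieldOn X V := ⟨h.1.mono hVU, h.2.mono hVU⟩

theorem SmoothFieldOn.add {X Y : SuperField n M W} {U : Set M} (hX : SmoothFieldOn X U)
    (hY : SmoothFieldOn Y U) : SmoothFieldOn (fun q => X q + Y q) U :=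
  ⟨hX.1.add_section hY.1, hX.2.add hY.2⟩

theorem SmoothFieldOn.smul {f : M → ℝ} {X : SuperField n M W} {U : Set M}
    (hf : SmoothFunOn (n := n) f U) (hX : SmoothFieldOn X U) :
    SmoothFieldOn (fun q => f q • X q) U :=
  ⟨hf.smul_section hX.1, ContMDiffOn.smul hf hX.2⟩

theorem smoothFieldOn_zero (U : Set M) : SmoothFieldOn (fun q => (0 : SuperTangent n M W q)) U := by
  refine ⟨?_, contMDiffOn_const⟩
  exact (Bundle.contMDiff_zeroSection ℝ (TangentSpace (𝓡 n) : M → Type _)).contMDiffOn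

theorem SmoothFieldOn.evenPart {X : SuperField n M W} {U : Set M} (hX : SmoothFieldOn X U) :
    SmoothFieldOn (fun q => SuperGeometry.evenPart (X q)) U :=
  ⟨hX.1, contMDiffOn_const⟩

theorem SmoothFieldOn.oddPart {X : SuperField n M W} {U : Set M} (hX : SmoothFieldOn X U) :
    SmoothFieldOn (fun q => SuperGeometry.oddPart (X q)) U :=
  ⟨(smoothFieldOn_zero U (W := W)).1, hX.2⟩

variable {p : M} {X Y : SuperField n M W}

theorem SmoothFieldOn.smoothFieldNear {U : Set M} (h : SmoothFieldOn X U) (hU : IsOpen U)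
    (hp : p ∈ U) : SmoothFieldNear X p := ⟨U, hU, hp, h⟩

theorem SmoothFieldNear.add (hX : SmoothFieldNear X p) (hY : SmoothFieldNear Y p) :
    SmoothFieldNear (fun q => X q + Y q) p := by
  obtain ⟨U, hU, hp, h⟩ := hX
  obtain ⟨V, hV, hp', h'⟩ := hY
  exact ⟨U ∩ V, hU.inter hV, ⟨hp, hp'⟩,
    (h.mono Set.inter_subset_left).add (h'.mono Set.inter_subset_right)⟩

theorem SmoothFieldNear.smul {f : M → ℝ} (hf : SmoothFunNear (n := n) f p)
    (hX : SmoothFieldNear X p) : SmoothFieldNear (fun q => f q • X q) p := by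
  obtain ⟨U, hU, hp, h⟩ := hf
  obtain ⟨V, hV, hp', h'⟩ := hX
  exact ⟨U ∩ V, hU.inter hV, ⟨hp, hp'⟩,
    SmoothFieldOn.smul (ContMDiffOn.mono h Set.inter_subset_left) (h'.mono Set.inter_subset_right)⟩

theorem smoothFunNear_const (c : ℝ) : SmoothFunNear (n := n) (fun _ : M => c) p :=
  ⟨Set.univ, isOpen_univ, trivial, contMDiffOn_const⟩

theorem smoothFieldNear_zero : SmoothFieldNear (fun q => (0 : SuperTangent n M W q)) p :=
  ⟨Set.univ, isOpen_univ, trivial, smoothFieldOn_zero _⟩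

theorem SmoothFieldNear.evenPart (hX : SmoothFieldNear X p) :
    SmoothFieldNear (fun q => SuperGeometry.evenPart (X q)) p := by
  obtain ⟨U, hU, hp, h⟩ := hX
  exact ⟨U, hU, hp, h.evenPart⟩

theorem SmoothFieldNear.oddPart (hX : SmoothFieldNear X p) :
    SmoothFieldNear (fun q => SuperGeometry.oddPart (X q)) p := by
  obtain ⟨U, hU, hp, h⟩ := hX
  exact ⟨U, hU, hp, h.oddPart⟩

theorem SmoothFieldNear.const_smul (c : ℝ) (hX : SmoothFieldNear X p) :
    SmoothFieldNear (fun q => c • X q) p :=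
  SmoothFieldNear.smul (smoothFunNear_const c) hX

theorem SmoothFieldNear.sum {ι : Type*} (s : Finset ι) {X : ι → SuperField n M W}
    (h : ∀ i ∈ s, SmoothFieldNear (X i) p) : SmoothFieldNear (fun q => ∑ i ∈ s, X i q) p := by
  classical
  induction s using Finset.induction_on with
  | empty => simpa using smoothFieldNear_zero
  | insert i s hi ih =>
    simp only [Finset.sum_insert hi]
    exact (h i (Finset.mem_insert_self i s)).add
      (ih fun j hj => h j (Finset.mem_insert_of_mem hj))

/-- Finitely many fields which are smooth near `p` are smooth on a common neighbourhood. -/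
theorem exists_common_smoothFieldOn {ι : Type*} [Finite ι] {X : ι → SuperField n M W}
    (h : ∀ i, SmoothFieldNear (X i) p) :
    ∃ U : Set M, IsOpen U ∧ p ∈ U ∧ ∀ i, SmoothFieldOn (X i) U := by
  choose U hU hp hX using h
  exact ⟨⋂ i, U i, isOpen_iInter_of_finite hU, Set.mem_iInter.2 hp,
    fun i => (hX i).mono (Set.iInter_subset _ i)⟩

end Fields

/-! ### The flat derivative and parallel fields -/

section FlatDerivative

open Filter Topology

variable {n : ℕ} {M : Type*} [TopologicalSpace M] [ChartedSpace (EuclideanSpace ℝ (Fin n)) M]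
  [IsManifold (𝓡 n) ∞ M] {W : Type*} [NormedAddCommGroup W] [NormedSpace ℝ W]
  {p : M} {X Y : SuperField n M W} {C : SuperConnection n M W}

theorem SmoothFieldOn.congr {U : Set M} (hX : SmoothFieldOn X U) (h : ∀ q ∈ U, Y q = X q) :
    SmoothFieldOn Y U :=
  ⟨hX.1.congr fun q hq => by rw [h q hq], hX.2.congr fun q hq => by rw [h q hq]⟩

/-- The covariant derivative of a field at a point depends only on its germ. -/
theorem SuperConnection.cov_congr (hX : SmoothFieldNear X p) (h : ∀ᶠ q in 𝓝 p, Y q = X q) :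
    C.cov Y p = C.cov X p := by
  classical
  obtain ⟨U, hU, hp, hX⟩ := hX
  obtain ⟨V, hV, hVo, hpV⟩ := eventually_nhds_iff.1 h
  have hUV : IsOpen (U ∩ V) := hU.inter hVo
  have hX := hX.mono (Set.inter_subset_left (t := V))
  set D : SuperField n M W := fun q => Y q - X q with hD
  -- No bump function is required: `f` only has to be smooth on `U ∩ V`, where it is zero. Since `f
  -- • D = D` everywhere, the Leibniz rule shows that the derivative of `D` at `p` vanishes.
  set f : M → ℝ := fun q => if q ∈ U ∩ V then 0 else 1 with hf
  have hD0 : ∀ q ∈ U ∩ V, D q = 0 := fun q hq => by rw [hD]; simp [hV q hq.2]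
  have hDs : SmoothFieldOn D (U ∩ V) := (smoothFieldOn_zero _).congr hD0
  have hfs : SmoothFunOn (n := n) f (U ∩ V) :=
    (contMDiffOn_const (c := (0 : ℝ))).congr fun q hq => by simp only [hf, if_pos hq]
  have hfD : (fun q => f q • D q) = D := by
    funext q
    by_cases hq : q ∈ U ∩ V
    · rw [hD0 q hq, smul_zero]
    · simp only [hf, if_neg hq, one_smul]
  have h0 : C.cov D p = 0 := by
    refine LinearMap.ext fun v => ?_
    have := C.leibniz _ hUV f D hfs hDs p ⟨hp, hpV⟩ v
    rwa [hfD, hD0 p ⟨hp, hpV⟩, smul_zero, show f p = 0 from if_pos ⟨hp, hpV⟩, zero_smul,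
      zero_add] at this
  have hY : Y = fun q => X q + D q := by funext q; simp [hD]
  rw [hY, C.add _ hUV X D hX hDs p ⟨hp, hpV⟩, h0, add_zero]

variable (C) in
/-- The derivative of super vector fields in even directions which is given by `C` on the even part
and by the flat connection of `M × W` on the odd part. -/
def SuperConnection.flat (Y : SuperField n M W) (p : M) :
    TangentSpace (𝓡 n) p →ₗ[ℝ] SuperTangent n M W p :=
  LinearMap.prod
    (LinearMap.fst ℝ _ _ ∘ₗ C.cov (fun q => evenPart (Y q)) p ∘ₗ LinearMap.inl ℝ _ _)
    (mvfderiv (𝓡 n) (fun q => (Y q).2) p : TangentSpace (𝓡 n) p →ₗ[ℝ] W)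

theorem SuperConnection.flat_fst (v : TangentSpace (𝓡 n) p) :
    (C.flat Y p v).1 = (C.cov (fun q => evenPart (Y q)) p (v, 0)).1 := rfl

theorem SuperConnection.flat_snd (v : TangentSpace (𝓡 n) p) :
    (C.flat Y p v).2 = mvfderiv (𝓡 n) (fun q => (Y q).2) p v := rfl

theorem SmoothFieldNear.mdifferentiableAt_snd (hX : SmoothFieldNear X p) :
    MDifferentiableAt (𝓡 n) 𝓘(ℝ, W) (fun q => (X q).2) p := by
  obtain ⟨U, hU, hp, hX⟩ := hX
  exact (hX.2.contMDiffAt (hU.mem_nhds hp)).mdifferentiableAt (by simp)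

theorem SuperConnection.cov_add (hX : SmoothFieldNear X p) (hY : SmoothFieldNear Y p) :
    C.cov (fun q => X q + Y q) p = C.cov X p + C.cov Y p := by
  obtain ⟨U, hU, hp, h⟩ := hX
  obtain ⟨V, hV, hp', h'⟩ := hY
  exact C.add _ (hU.inter hV) X Y (h.mono Set.inter_subset_left) (h'.mono Set.inter_subset_right)
    p ⟨hp, hp'⟩

theorem SuperConnection.cov_smul {f : M → ℝ} (hf : SmoothFunNear (n := n) f p)
    (hX : SmoothFieldNear X p) (v : SuperTangent n M W p) :
    C.cov (fun q => f q • X q) p v = act f p v • X p + f p • C.cov X p v := by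
  obtain ⟨U, hU, hp, h⟩ := hf
  obtain ⟨V, hV, hp', h'⟩ := hX
  exact C.leibniz _ (hU.inter hV) f X (ContMDiffOn.mono h Set.inter_subset_left)
    (h'.mono Set.inter_subset_right) p ⟨hp, hp'⟩ v

theorem SuperConnection.flat_congr (hX : SmoothFieldNear X p) (h : ∀ᶠ q in 𝓝 p, Y q = X q) :
    C.flat Y p = C.flat X p := by
  have h1 : C.cov (fun q => evenPart (Y q)) p = C.cov (fun q => evenPart (X q)) p :=
    SuperConnection.cov_congr hX.evenPart (h.mono fun q hq => by rw [hq])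
  have h2 : (fun q => (Y q).2) =ᶠ[𝓝 p] fun q => (X q).2 := h.mono fun q hq => by
    simp only [hq]
  refine LinearMap.ext fun v => Prod.ext ?_ ?_
  · rw [SuperConnection.flat_fst, SuperConnection.flat_fst, h1]
  · have := h2.mfderiv_eq (I := 𝓡 n) (I' := 𝓘(ℝ, W))
    exact congrArg (fun l : TangentSpace (𝓡 n) p →L[ℝ] W => l v) this

theorem SuperConnection.flat_add (hX : SmoothFieldNear X p) (hY : SmoothFieldNear Y p) :
    C.flat (fun q => X q + Y q) p = C.flat X p + C.flat Y p := by
  refine LinearMap.ext fun v => Prod.ext ?_ ?_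
  · simp only [SuperConnection.flat_fst, map_add, LinearMap.add_apply, Prod.fst_add]
    rw [SuperConnection.cov_add hX.evenPart hY.evenPart]; rfl
  · simp only [LinearMap.add_apply, Prod.snd_add, SuperConnection.flat_snd]
    have := mvfderiv_add hX.mdifferentiableAt_snd hY.mdifferentiableAt_snd
    exact congrArg (fun l => l v) this

theorem SuperConnection.flat_smul {f : M → ℝ} (hf : SmoothFunNear (n := n) f p)
    (hX : SmoothFieldNear X p) {v : TangentSpace (𝓡 n) p} {c : ℝ} (hc : HasDerivAlong f p v c) :
    C.flat (fun q => f q • X q) p v = c • X p + f p • C.flat X p v := by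
  refine Prod.ext ?_ ?_
  · simp only [SuperConnection.flat_fst, map_smul, Prod.fst_add, Prod.smul_fst]
    rw [SuperConnection.cov_smul hf hX.evenPart, ← hc.2]; rfl
  · simp only [Prod.snd_add, Prod.smul_snd, SuperConnection.flat_snd]
    have := mvfderiv_smul hf.mdifferentiableAt hX.mdifferentiableAt_snd
    refine (congrArg (fun l => l v) this).trans ?_
    rw [← hc.2, add_comm]
    rfl

theorem SuperConnection.cov_zero : C.cov (fun q => (0 : SuperTangent n M W q)) p = 0 := by
  refine LinearMap.ext fun v => ?_
  have h := SuperConnection.cov_smul (C := C) (smoothFunNear_const (n := n) (p := p) 0)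
    (smoothFieldNear_zero (W := W)) v
  simpa using h

theorem SuperConnection.flat_evenPart (v : TangentSpace (𝓡 n) p) :
    C.flat (fun q => evenPart (Y q)) p v = evenPart (C.flat Y p v) := by
  refine Prod.ext rfl ?_
  rw [SuperConnection.flat_snd]
  exact congrArg (fun l => l v) (mvfderiv_const (0 : W))

theorem SuperConnection.flat_oddPart (v : TangentSpace (𝓡 n) p) :
    C.flat (fun q => oddPart (Y q)) p v = oddPart (C.flat Y p v) := by
  refine Prod.ext ?_ rfl
  exact congrArg (fun l => (l (v, 0)).1) (SuperConnection.cov_zero (C := C) (p := p))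

theorem SuperConnection.flat_const_smul (c : ℝ) (hX : SmoothFieldNear X p) :
    C.flat (fun q => c • X q) p = c • C.flat X p := by
  refine LinearMap.ext fun v => ?_
  rw [SuperConnection.flat_smul (smoothFunNear_const c) hX (hasDerivAlong_const c)]
  simp

theorem SuperConnection.flat_zero : C.flat (fun q => (0 : SuperTangent n M W q)) p = 0 := by
  simpa using SuperConnection.flat_const_smul (C := C) 0 (smoothFieldNear_zero (p := p))

theorem SuperConnection.flat_sum {ι : Type*} (s : Finset ι) {X : ι → SuperField n M W}
    (h : ∀ i ∈ s, SmoothFieldNear (X i) p) :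
    C.flat (fun q => ∑ i ∈ s, X i q) p = ∑ i ∈ s, C.flat (X i) p := by
  classical
  induction s using Finset.induction_on with
  | empty => simpa using SuperConnection.flat_zero
  | insert i s hi ih =>
    have hs : ∀ j ∈ s, SmoothFieldNear (X j) p := fun j hj => h j (Finset.mem_insert_of_mem hj)
    simp only [Finset.sum_insert hi]
    rw [SuperConnection.flat_add (h i (Finset.mem_insert_self i s)) (SmoothFieldNear.sum s hs),
      ih hs]

theorem SuperConnection.flat_odd_const (w : W) :
    C.flat (fun q => ((0, w) : SuperTangent n M W q)) p = 0 := by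
  refine LinearMap.ext fun v => Prod.ext ?_ ?_
  · exact congrArg (fun l => (l (v, 0)).1) (SuperConnection.cov_zero (C := C) (p := p))
  · exact congrArg (fun l => l v) (mvfderiv_const w)

theorem smoothFieldOn_odd_const (w : W) (U : Set M) :
    SmoothFieldOn (fun q => ((0, w) : SuperTangent n M W q)) U :=
  ⟨(smoothFieldOn_zero U (W := W)).1, contMDiffOn_const⟩

theorem smoothFieldNear_odd_const (w : W) :
    SmoothFieldNear (fun q => ((0, w) : SuperTangent n M W q)) p :=
  ⟨Set.univ, isOpen_univ, trivial, smoothFieldOn_odd_const w _⟩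

variable (C) in
/-- The field `X` is smooth near `p`, and its flat derivative in the direction `v` vanishes. -/
structure IsParallel (X : SuperField n M W) (p : M) (v : TangentSpace (𝓡 n) p) : Prop where
  smooth : SmoothFieldNear X p
  flat_eq : C.flat X p v = 0

variable {v : TangentSpace (𝓡 n) p}

theorem SmoothFieldNear.isParallel_zero (hX : SmoothFieldNear X p) : IsParallel C X p 0 :=
  ⟨hX, map_zero _⟩

theorem IsParallel.evenPart (hX : IsParallel C X p v) :
    IsParallel C (fun q => SuperGeometry.evenPart (X q)) p v :=
  ⟨hX.smooth.evenPart, by rw [SuperConnection.flat_evenPart, hX.flat_eq, map_zero]⟩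

theorem IsParallel.oddPart (hX : IsParallel C X p v) :
    IsParallel C (fun q => SuperGeometry.oddPart (X q)) p v :=
  ⟨hX.smooth.oddPart, by rw [SuperConnection.flat_oddPart, hX.flat_eq, map_zero]⟩

theorem IsParallel.sum {ι : Type*} (s : Finset ι) {X : ι → SuperField n M W}
    (h : ∀ i ∈ s, IsParallel C (X i) p v) : IsParallel C (fun q => ∑ i ∈ s, X i q) p v :=
  ⟨.sum s fun i hi => (h i hi).smooth, by
    rw [SuperConnection.flat_sum s fun i hi => (h i hi).smooth, LinearMap.sum_apply,
      Finset.sum_eq_zero fun i hi => (h i hi).flat_eq]⟩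

theorem IsParallel.const_smul (c : ℝ) (hX : IsParallel C X p v) :
    IsParallel C (fun q => c • X q) p v :=
  ⟨hX.smooth.const_smul c, by
    rw [SuperConnection.flat_const_smul c hX.smooth, LinearMap.smul_apply, hX.flat_eq, smul_zero]⟩

theorem IsParallel.add (hX : IsParallel C X p v) (hY : IsParallel C Y p v) :
    IsParallel C (fun q => X q + Y q) p v :=
  ⟨hX.smooth.add hY.smooth, by
    rw [SuperConnection.flat_add hX.smooth hY.smooth, LinearMap.add_apply, hX.flat_eq, hY.flat_eq,
      add_zero]⟩

theorem isParallel_odd_const (w : W) :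
    IsParallel C (fun q => ((0, w) : SuperTangent n M W q)) p v :=
  ⟨smoothFieldNear_odd_const w, by rw [SuperConnection.flat_odd_const]; rfl⟩

theorem SuperMetric.smoothFunNear_inner (g : SuperMetric n M W) (hX : SmoothFieldNear X p)
    (hY : SmoothFieldNear Y p) : SmoothFunNear (n := n) (fun q => g.inner q (X q) (Y q)) p := by
  obtain ⟨U, hU, hp, h⟩ := hX
  obtain ⟨V, hV, hp', h'⟩ := hY
  exact ⟨U ∩ V, hU.inter hV, ⟨hp, hp'⟩, g.smooth _ (hU.inter hV) X Y
    (h.mono Set.inter_subset_left) (h'.mono Set.inter_subset_right)⟩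

theorem SuperMetric.inner_evenPart (g : SuperMetric n M W) (x y : SuperTangent n M W p) :
    g.inner p (SuperGeometry.evenPart x) (SuperGeometry.evenPart y) = g.even p x.1 y.1 := by
  change g.even p x.1 y.1 + g.odd p 0 0 = _
  simp

theorem SuperMetric.smoothFunNear_even (g : SuperMetric n M W) (hX : SmoothFieldNear X p)
    (hY : SmoothFieldNear Y p) : SmoothFunNear (n := n) (fun q => g.even q (X q).1 (Y q).1) p := by
  simpa only [g.inner_evenPart] using g.smoothFunNear_inner hX.evenPart hY.evenPart

/-- The flat derivative is compatible with the metric of `TM`. -/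
theorem SuperConnection.IsCompatible.hasDerivAlong_even {g : SuperMetric n M W}
    (hC : C.IsCompatible g) (hX : SmoothFieldNear X p) (hY : SmoothFieldNear Y p)
    (v : TangentSpace (𝓡 n) p) :
    HasDerivAlong (fun q => g.even q (X q).1 (Y q).1) p v
      (g.even p (C.flat X p v).1 (Y p).1 + g.even p (X p).1 (C.flat Y p v).1) := by
  refine ⟨(g.smoothFunNear_even hX hY).mdifferentiableAt, ?_⟩
  obtain ⟨U, hU, hp, h⟩ := hX
  obtain ⟨V, hV, hp', h'⟩ := hY
  have key := hC (U ∩ V) (hU.inter hV) (fun q => SuperGeometry.evenPart (X q))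
    (fun q => SuperGeometry.evenPart (Y q)) 0 0
    (h.mono Set.inter_subset_left).evenPart (h'.mono Set.inter_subset_right).evenPart
    (fun q _ => hasParity_evenPart _) p ⟨hp, hp'⟩ (v, 0) (by simp [hasParity_zero_iff])
  simp only [g.inner_evenPart] at key
  refine Eq.trans key ?_
  rw [SuperConnection.flat_fst, SuperConnection.flat_fst]
  simp [SuperMetric.inner, evenPart_apply]
  rfl

/-- Torsion freeness, expressed by the flat derivative. -/
theorem SuperConnection.IsTorsionFree.superBracket_eq (hC : C.IsTorsionFree)
    (hX : SmoothFieldNear X p) (hY : SmoothFieldNear Y p) :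
    superBracket X Y p = C.flat Y p (X p).1 - C.flat X p (Y p).1 := by
  -- The odd component of the bracket is by definition a difference of derivatives of `W`-valued
  -- functions; only the even component uses the torsion.
  refine Prod.ext ?_ rfl
  obtain ⟨U, hU, hp, h⟩ := hX
  obtain ⟨V, hV, hp', h'⟩ := hY
  have key := hC (U ∩ V) (hU.inter hV) (fun q => SuperGeometry.evenPart (X q))
    (fun q => SuperGeometry.evenPart (Y q)) 0 0
    (h.mono Set.inter_subset_left).evenPart (h'.mono Set.inter_subset_right).evenPart
    (fun q _ => hasParity_evenPart _) (fun q _ => hasParity_evenPart _) p ⟨hp, hp'⟩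
  have key := congrArg Prod.fst key
  simp only [Fin.val_zero, mul_zero, pow_zero, one_smul] at key
  exact key.symm

end FlatDerivative

/-! ### The tensors `A` and `B` comparing the super connection with the flat derivative -/

section MixedDerivative

open Filter Topology

variable {n : ℕ} {M : Type*} [TopologicalSpace M] [ChartedSpace (EuclideanSpace ℝ (Fin n)) M]
  [IsManifold (𝓡 n) ∞ M] {W : Type*} [NormedAddCommGroup W] [NormedSpace ℝ W]
  {p : M} {X Y : SuperField n M W} {C : SuperConnection n M W}

theorem SuperConnection.cov_const_add (x y : W) :
    C.cov (fun q => ((0, x + y) : SuperTangent n M W q)) p =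
      C.cov (fun q => ((0, x) : SuperTangent n M W q)) p +
        C.cov (fun q => ((0, y) : SuperTangent n M W q)) p := by
  rw [← SuperConnection.cov_add (smoothFieldNear_odd_const x) (smoothFieldNear_odd_const y)]
  congr 1
  funext q
  simp

theorem SuperConnection.cov_const_smul (c : ℝ) (x : W) :
    C.cov (fun q => ((0, c • x) : SuperTangent n M W q)) p =
      c • C.cov (fun q => ((0, x) : SuperTangent n M W q)) p := by
  refine LinearMap.ext fun v => ?_
  have h := SuperConnection.cov_smul (C := C) (smoothFunNear_const (n := n) (p := p) c)
    (smoothFieldNear_odd_const x) v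
  have h0 : act (fun _ : M => c) p v = 0 := (hasDerivAlong_const (v := v.1) c).2
  rw [h0, zero_smul, zero_add] at h
  rw [LinearMap.smul_apply, ← h]
  congr 2
  funext q
  simp

variable (C) in
/-- The even covariant derivative of odd constants: the deviation of `C` from the flat
derivative. -/
def SuperConnection.mixed (p : M) : TangentSpace (𝓡 n) p →ₗ[ℝ] W →ₗ[ℝ] W :=
  LinearMap.mk₂ ℝ (fun v w => (C.cov (fun q => ((0, w) : SuperTangent n M W q)) p (v, 0)).2)
    (fun v v' w => by
      rw [show ((v + v', (0 : W)) : SuperTangent n M W p) = (v, 0) + (v', 0) by simp, map_add]; rfl)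
    (fun c v w => by
      rw [show ((c • v, (0 : W)) : SuperTangent n M W p) = c • (v, 0) by simp, map_smul]; rfl)
    (fun v w w' => by rw [SuperConnection.cov_const_add]; rfl)
    (fun c v w => by rw [SuperConnection.cov_const_smul]; rfl)

variable (C) in
/-- The odd covariant derivative of odd constants. -/
def SuperConnection.oddOdd (p : M) : W →ₗ[ℝ] W →ₗ[ℝ] TangentSpace (𝓡 n) p :=
  LinearMap.mk₂ ℝ (fun u w => (C.cov (fun q => ((0, w) : SuperTangent n M W q)) p (0, u)).1)
    (fun v v' w => by
      rw [show ((0, v + v') : SuperTangent n M W p) = (0, v) + (0, v') by simp, map_add]; rfl)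
    (fun c v w => by
      rw [show ((0, c • v) : SuperTangent n M W p) = c • (0, v) by simp, map_smul]; rfl)
    (fun v w w' => by rw [SuperConnection.cov_const_add]; rfl)
    (fun c v w => by rw [SuperConnection.cov_const_smul]; rfl)

variable (C) in
/-- The odd covariant derivative `∇_u`, as an endomorphism of the fibre. -/
def SuperConnection.oddEnd (p : M) (u : W) : SuperTangent n M W p →ₗ[ℝ] SuperTangent n M W p :=
  LinearMap.prod (C.oddOdd p u ∘ₗ LinearMap.snd ℝ _ _) ((C.mixed p).flip u ∘ₗ LinearMap.fst ℝ _ _)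

theorem SuperConnection.oddEnd_apply (u : W) (x : SuperTangent n M W p) :
    C.oddEnd p u x = (C.oddOdd p u x.2, C.mixed p x.1 u) := rfl

theorem SuperConnection.cov_sum {ι : Type*} (s : Finset ι) {X : ι → SuperField n M W}
    (h : ∀ i ∈ s, SmoothFieldNear (X i) p) :
    C.cov (fun q => ∑ i ∈ s, X i q) p = ∑ i ∈ s, C.cov (X i) p := by
  classical
  induction s using Finset.induction_on with
  | empty => simpa using SuperConnection.cov_zero
  | insert i s hi ih =>
    have hs : ∀ j ∈ s, SmoothFieldNear (X j) p := fun j hj => h j (Finset.mem_insert_of_mem hj)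
    simp only [Finset.sum_insert hi]
    rw [SuperConnection.cov_add (h i (Finset.mem_insert_self i s)) (SmoothFieldNear.sum s hs),
      ih hs]

theorem SuperConnection.cov_parity (hX : SmoothFieldNear X p) {a b : Fin 2}
    (h : ∀ q, HasParity b (X q)) {v : SuperTangent n M W p} (hv : HasParity a v) :
    HasParity (a + b) (C.cov X p v) := by
  obtain ⟨U, hU, hp, hX⟩ := hX
  exact C.parity U hU X a b hX (fun q _ => h q) p hp v hv

theorem SuperConnection.cov_const_even (w : W) (v : TangentSpace (𝓡 n) p) :
    C.cov (fun q => ((0, w) : SuperTangent n M W q)) p (v, 0) = (0, C.mixed p v w) := by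
  have h := SuperConnection.cov_parity (C := C) (p := p) (smoothFieldNear_odd_const w)
    (a := 0) (b := 1) (fun q => by simp [hasParity_one_iff]) (v := (v, 0))
    (by simp [hasParity_zero_iff])
  exact Prod.ext (by simpa [hasParity_one_iff] using h) rfl

theorem SuperConnection.cov_const_odd (w u : W) :
    C.cov (fun q => ((0, w) : SuperTangent n M W q)) p (0, u) = (C.oddOdd p u w, 0) := by
  have h := SuperConnection.cov_parity (C := C) (p := p) (smoothFieldNear_odd_const w)
    (a := 1) (b := 1) (fun q => by simp [hasParity_one_iff]) (v := (0, u))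
    (by simp [hasParity_one_iff])
  exact Prod.ext rfl (by simpa [hasParity_zero_iff] using h)

/-- An odd field is a combination of constants. -/
theorem SuperConnection.cov_oddPart [FiniteDimensional ℝ W] (hX : SmoothFieldNear X p)
    (v : SuperTangent n M W p) :
    C.cov (fun q => oddPart (X q)) p v =
      (0, (C.flat X p v.1).2) + C.cov (fun q => ((0, (X p).2) : SuperTangent n M W q)) p v := by
  let b := Module.finBasis ℝ W
  have hco : ∀ i, SmoothFunNear (n := n) (fun q => b.coord i (X q).2) p := fun i => by
    obtain ⟨U, hU, hp, hX⟩ := hX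
    exact ⟨U, hU, hp,
      (LinearMap.toContinuousLinearMap (b.coord i)).contMDiff.comp_contMDiffOn hX.2⟩
  have hd : ∀ i, HasDerivAlong (fun q => b.coord i (X q).2) p v.1
      (b.coord i (C.flat X p v.1).2) := fun i => by
    refine .of_hasMFDerivAt ((LinearMap.toContinuousLinearMap (b.coord i)).hasMFDerivAt.comp p
      hX.mdifferentiableAt_snd.hasMFDerivAt) rfl
  have h1 : (fun q => oddPart (X q)) = fun q => ∑ i, b.coord i (X q).2 •
      ((0, b i) : SuperTangent n M W q) := by
    funext q
    refine Prod.ext ?_ ?_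
    · simp [oddPart_apply, Prod.fst_sum]
    · simp only [oddPart_apply, Prod.snd_sum, Prod.smul_snd]
      exact (b.sum_repr _).symm
  have h2 : ∀ x : W, C.cov (fun q => ((0, x) : SuperTangent n M W q)) p =
      ∑ i, b.coord i x • C.cov (fun q => ((0, b i) : SuperTangent n M W q)) p := fun x => by
    simp only [← SuperConnection.cov_const_smul]
    rw [← SuperConnection.cov_sum _ fun i _ => smoothFieldNear_odd_const _]
    congr 1
    funext q
    refine Prod.ext ?_ ?_
    · simp [Prod.fst_sum]
    · simp only [Prod.snd_sum]
      exact (b.sum_repr _).symm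
  rw [h1, SuperConnection.cov_sum _ fun i _ => (smoothFieldNear_odd_const (b i)).smul (hco i),
    LinearMap.sum_apply, h2, LinearMap.sum_apply,
    Finset.sum_congr rfl fun i _ => SuperConnection.cov_smul (hco i)
      (smoothFieldNear_odd_const (b i)) v, Finset.sum_add_distrib]
  congr 1
  refine Prod.ext ?_ ?_
  · simp [Prod.fst_sum]
  · simp only [Prod.snd_sum, Prod.smul_snd]
    refine Eq.trans (Finset.sum_congr rfl fun i _ => ?_) (b.sum_repr _)
    exact congrArg (fun c : ℝ => c • b i) (hd i).2

theorem SuperConnection.cov_eq_evenPart_add (hX : SmoothFieldNear X p) :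
    C.cov X p = C.cov (fun q => evenPart (X q)) p + C.cov (fun q => oddPart (X q)) p := by
  rw [← SuperConnection.cov_add hX.evenPart hX.oddPart]
  simp only [evenPart_add_oddPart]

/-- On the even part both derivatives agree. The odd part is a combination of constants, and the
Leibniz rule differentiates the coefficients as the flat derivative does and leaves `A` on the
constants. -/
theorem SuperConnection.cov_even [FiniteDimensional ℝ W] (hX : SmoothFieldNear X p)
    (v : TangentSpace (𝓡 n) p) :
    C.cov X p (v, 0) = C.flat X p v + (0, C.mixed p v (X p).2) := by
  rw [SuperConnection.cov_eq_evenPart_add hX, LinearMap.add_apply, SuperConnection.cov_oddPart hX,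
    SuperConnection.cov_const_even, ← add_assoc]
  congr 1
  have h := SuperConnection.cov_parity (C := C) (p := p) hX.evenPart
    (a := 0) (b := 0) (fun q => hasParity_evenPart _) (v := (v, 0))
    (by simp [hasParity_zero_iff])
  refine Prod.ext ?_ ?_
  · simp [SuperConnection.flat_fst]
  · simp only [Prod.snd_add]
    rw [show (C.cov (fun q => evenPart (X q)) p (v, 0)).2 = 0 by
      simpa [hasParity_zero_iff] using h, zero_add]

/-- An odd direction is purely algebraic. The bracket of an even field with a constant odd field
vanishes, so zero torsion turns `∇_u X` into `∇_X u`; on odd fields the coefficients are not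
differentiated. -/
theorem SuperConnection.IsTorsionFree.cov_odd [FiniteDimensional ℝ W] (hC : C.IsTorsionFree)
    (hX : SmoothFieldNear X p) (u : W) :
    C.cov X p (0, u) = C.oddEnd p u (X p) := by
  rw [SuperConnection.cov_eq_evenPart_add hX, LinearMap.add_apply, SuperConnection.cov_oddPart hX,
    SuperConnection.cov_const_odd, SuperConnection.oddEnd_apply]
  have h1 : C.cov (fun q => evenPart (X q)) p (0, u) = (0, C.mixed p (X p).1 u) := by
    obtain ⟨U, hU, hp, h⟩ := hX.evenPart
    have key := hC U hU (fun q => evenPart (X q)) (fun q => ((0, u) : SuperTangent n M W q)) 0 1 h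
      (smoothFieldOn_odd_const u U) (fun q _ => hasParity_evenPart _)
      (fun q _ => by simp [hasParity_one_iff]) p hp
    rw [SuperConnection.IsTorsionFree.superBracket_eq hC hX.evenPart (smoothFieldNear_odd_const u),
      SuperConnection.flat_odd_const] at key
    simp only [Fin.val_zero, zero_mul, pow_zero, one_smul, LinearMap.zero_apply, map_zero, sub_zero]
      at key
    rw [sub_eq_zero] at key
    rw [← key]
    exact SuperConnection.cov_const_even u (X p).1
  rw [h1]
  simp

/-- For two odd fields the super torsion contains the sum `∇_X Y + ∇_Y X`, and constants have
bracket zero. -/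
theorem SuperConnection.IsTorsionFree.oddOdd_antisymm (hC : C.IsTorsionFree) (u w : W) :
    C.oddOdd p u w = - C.oddOdd p w u := by
  have key := hC Set.univ isOpen_univ (fun q => ((0, w) : SuperTangent n M W q))
    (fun q => ((0, u) : SuperTangent n M W q)) 1 1 (smoothFieldOn_odd_const w _)
    (smoothFieldOn_odd_const u _) (fun q _ => by simp [hasParity_one_iff])
    (fun q _ => by simp [hasParity_one_iff]) p trivial
  rw [SuperConnection.IsTorsionFree.superBracket_eq hC (smoothFieldNear_odd_const w)
    (smoothFieldNear_odd_const u), SuperConnection.flat_odd_const, SuperConnection.flat_odd_const,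
    SuperConnection.cov_const_odd, SuperConnection.cov_const_odd] at key
  have key := congrArg Prod.fst key
  simp at key
  exact eq_neg_of_add_eq_zero_right key

/-- Compatibility in the odd direction `u`, where the derivative of `⟨w, X⟩` is zero: `0 = ⟨∇_u w,
X⟩ - ⟨w, ∇_u X⟩`, with `∇_u X = A_X u`. -/
theorem SuperConnection.IsLeviCivita.even_oddOdd [FiniteDimensional ℝ W] {g : SuperMetric n M W}
    (hC : C.IsLeviCivita g) (hX : SmoothFieldNear X p) (u w : W) :
    g.even p (C.oddOdd p u w) (X p).1 = g.odd p w (C.mixed p (X p).1 u) := by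
  obtain ⟨U, hU, hp, h⟩ := hX.evenPart
  have key := hC.2 U hU (fun q => ((0, w) : SuperTangent n M W q)) (fun q => evenPart (X q)) 1 1
    (smoothFieldOn_odd_const w U) h (fun q _ => by simp [hasParity_one_iff]) p hp (0, u)
    (by simp [hasParity_one_iff])
  rw [SuperConnection.cov_const_odd, SuperConnection.IsTorsionFree.cov_odd hC.1 hX.evenPart] at key
  have h0 : ∀ f : M → ℝ, act f p ((0, u) : SuperTangent n M W p) = 0 := fun f =>
    map_zero (mfderiv (𝓡 n) 𝓘(ℝ, ℝ) f p)
  rw [h0] at key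
  simp [SuperMetric.inner, SuperConnection.oddEnd_apply, evenPart_apply] at key
  linarith

/-- The antisymmetry of `B` and that of the symplectic form combine. Hence `A_x` is self-adjoint for
the symplectic form, which makes `σ(y, A_x u)` antisymmetric in `u` and `y`. -/
theorem SuperConnection.IsLeviCivita.odd_mixed [FiniteDimensional ℝ W] {g : SuperMetric n M W}
    (hC : C.IsLeviCivita g) (hX : SmoothFieldNear X p) (u w : W) :
    g.odd p w (C.mixed p (X p).1 u) = g.odd p (C.mixed p (X p).1 w) u := by
  rw [← hC.even_oddOdd hX, hC.1.oddOdd_antisymm, map_neg, LinearMap.neg_apply, hC.even_oddOdd hX,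
    (g.odd_alt p).neg_eq]

end MixedDerivative

/-! ### Frames flat at a point -/

section ParallelFrame

open Filter Topology

variable {n : ℕ} {M : Type*} [TopologicalSpace M] [ChartedSpace (EuclideanSpace ℝ (Fin n)) M]

theorem SmoothFunOn.sum {U : Set M} {ι : Type*} (s : Finset ι) {f : ι → M → ℝ}
    (h : ∀ i ∈ s, SmoothFunOn (n := n) (f i) U) :
    SmoothFunOn (n := n) (fun q => ∑ i ∈ s, f i q) U := by
  classical
  induction s using Finset.induction_on with
  | empty => simpa [SmoothFunOn] using contMDiffOn_const
  | insert i s hi ih =>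
    simp only [Finset.sum_insert hi]
    exact ContMDiffOn.add (h i (Finset.mem_insert_self i s))
      (ih fun j hj => h j (Finset.mem_insert_of_mem hj))

theorem SmoothFunOn.prod {U : Set M} {ι : Type*} (s : Finset ι) {f : ι → M → ℝ}
    (h : ∀ i ∈ s, SmoothFunOn (n := n) (f i) U) :
    SmoothFunOn (n := n) (fun q => ∏ i ∈ s, f i q) U := by
  classical
  induction s using Finset.induction_on with
  | empty => simpa [SmoothFunOn] using contMDiffOn_const
  | insert i s hi ih =>
    simp only [Finset.prod_insert hi]
    exact ContMDiffOn.mul (h i (Finset.mem_insert_self i s))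
      (ih fun j hj => h j (Finset.mem_insert_of_mem hj))

theorem SmoothFunOn.det {U : Set M} {k : ℕ} {A : M → Matrix (Fin k) (Fin k) ℝ}
    (h : ∀ i j, SmoothFunOn (n := n) (fun q => A q i j) U) :
    SmoothFunOn (n := n) (fun q => (A q).det) U := by
  simp only [Matrix.det_apply']
  exact SmoothFunOn.sum _ fun σ _ => ContMDiffOn.mul contMDiffOn_const
    (SmoothFunOn.prod _ fun i _ => h _ _)

theorem SmoothFunOn.adjugate {U : Set M} {k : ℕ} {A : M → Matrix (Fin k) (Fin k) ℝ}
    (h : ∀ i j, SmoothFunOn (n := n) (fun q => A q i j) U) (i j : Fin k) :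
    SmoothFunOn (n := n) (fun q => (A q).adjugate i j) U := by
  simp only [Matrix.adjugate_apply]
  refine SmoothFunOn.det fun a b => ?_
  by_cases ha : a = j
  · subst ha
    simpa [SmoothFunOn] using contMDiffOn_const
  · simpa [Matrix.updateRow_ne ha] using h a b

variable [IsManifold (𝓡 n) ∞ M] {W : Type*} [NormedAddCommGroup W] [NormedSpace ℝ W]

theorem finrank_tangentSpace (p : M) : Module.finrank ℝ (TangentSpace (𝓡 n) p) = n :=
  finrank_euclideanSpace_fin

/-- Vectors which have a reciprocal family form a basis. -/
theorem exists_basis_of_reciprocal {V : Type*} [AddCommGroup V] [Module ℝ V]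
    [FiniteDimensional ℝ V] {k : ℕ} (hV : Module.finrank ℝ V = k) {B : LinearMap.BilinForm ℝ V}
    {e e' : Fin k → V} (h : ∀ i j, B (e' j) (e i) = if i = j then 1 else 0) :
    ∃ b : Module.Basis (Fin k) ℝ V, ∀ i, b i = e i := by
  have hli : LinearIndependent ℝ e := by
    rw [Fintype.linearIndependent_iff]
    intro c hc i
    have := congrArg (B (e' i)) hc
    simpa [h] using this
  exact ⟨basisOfLinearIndependentOfCardEqFinrank' e hli (by simp [hV]), fun i => by simp⟩

/-- An even local frame around `p` with a reciprocal frame, both flat at `p`. -/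
structure ParallelFrame (C : SuperConnection n M W) (g : SuperMetric n M W) (p : M) where
  U : Set M
  isOpen : IsOpen U
  mem : p ∈ U
  field : Fin n → SuperField n M W
  dual : Fin n → SuperField n M W
  smooth_field : ∀ i, SmoothFieldOn (field i) U
  smooth_dual : ∀ i, SmoothFieldOn (dual i) U
  even_field : ∀ i q, (field i q).2 = 0
  inner : ∀ q ∈ U, ∀ i j, g.even q (dual j q).1 (field i q).1 = if i = j then 1 else 0
  flat_field : ∀ i, C.flat (field i) p = 0
  flat_dual : ∀ i, C.flat (dual i) p = 0

theorem SmoothFieldOn.const_smul {X : SuperField n M W} {U : Set M} (c : ℝ)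
    (hX : SmoothFieldOn X U) : SmoothFieldOn (fun q => c • X q) U :=
  SmoothFieldOn.smul contMDiffOn_const hX

theorem SmoothFieldOn.sum {U : Set M} {ι : Type*} (s : Finset ι) {X : ι → SuperField n M W}
    (h : ∀ i ∈ s, SmoothFieldOn (X i) U) : SmoothFieldOn (fun q => ∑ i ∈ s, X i q) U := by
  classical
  induction s using Finset.induction_on with
  | empty => simpa using smoothFieldOn_zero U
  | insert i s hi ih =>
    simp only [Finset.sum_insert hi]
    exact (h i (Finset.mem_insert_self i s)).add
      (ih fun j hj => h j (Finset.mem_insert_of_mem hj))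

theorem SuperMetric.smoothFunOn_even (g : SuperMetric n M W) {X Y : SuperField n M W} {U : Set M}
    (hU : IsOpen U) (hX : SmoothFieldOn X U) (hY : SmoothFieldOn Y U) :
    SmoothFunOn (n := n) (fun q => g.even q (X q).1 (Y q).1) U := by
  have := g.smooth U hU _ _ hX.evenPart hY.evenPart
  simpa [evenPart_apply] using this

theorem SmoothFunOn.continuousOn {U : Set M} {f : M → ℝ} (hf : SmoothFunOn (n := n) f U) :
    ContinuousOn f U := ContMDiffOn.continuousOn hf

variable {C : SuperConnection n M W} {g : SuperMetric n M W} {p : M}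

/-- A smooth frame can be corrected so that it becomes flat at a point. -/
theorem exists_flat_fields {E : Fin n → SuperField n M W} (hE : ∀ i, SmoothFieldNear (E i) p)
    {e' : Fin n → TangentSpace (𝓡 n) p}
    (h : ∀ i j, g.even p (e' j) (E i p).1 = if i = j then 1 else 0) :
    ∃ F : Fin n → SuperField n M W, (∀ i, SmoothFieldNear (F i) p) ∧ (∀ i q, (F i q).2 = 0) ∧
      (∀ i, (F i p).1 = (E i p).1) ∧ ∀ i, C.flat (F i) p = 0 := by
  obtain ⟨b, hb⟩ := exists_basis_of_reciprocal (finrank_tangentSpace p) h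
  have hrec : IsReciprocal (g.even p) b e' := ⟨fun i j => by rw [hb, h]⟩
  -- The coefficients vanish at `p`, so the values there are unchanged. Their differentials are
  -- minus the components of the derivative of `E c`, which the correction therefore cancels.
  have hφ := fun c d : Fin n => exists_smoothFunNear_hasDerivAlong (p := p)
    (-(g.even p (e' d) ∘ₗ LinearMap.fst ℝ _ _ ∘ₗ C.flat (E c) p))
  choose φ hφs hφ0 hφd using hφ
  have hs : ∀ c d, SmoothFieldNear (fun q => φ c d q • evenPart (E d q)) p := fun c d =>
    (hE d).evenPart.smul (hφs c d)
  refine ⟨fun c q => evenPart (E c q) + ∑ d, φ c d q • evenPart (E d q), fun c =>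
    (hE c).evenPart.add (SmoothFieldNear.sum _ fun d _ => hs c d), fun c q => ?_, fun c => ?_,
    fun c => LinearMap.ext fun v => ?_⟩
  · simp [evenPart_apply, Prod.snd_sum]
  · simp [evenPart_apply, hφ0]
  · rw [SuperConnection.flat_add (hE c).evenPart (SmoothFieldNear.sum _ fun d _ => hs c d),
      SuperConnection.flat_sum _ fun d _ => hs c d, LinearMap.add_apply, LinearMap.sum_apply,
      Finset.sum_congr rfl fun d _ => SuperConnection.flat_smul (hφs c d) (hE d).evenPart
        (hφd c d v), SuperConnection.flat_evenPart]
    simp only [hφ0, zero_smul, add_zero]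
    refine Prod.ext ?_ ?_
    · have := hrec.sum_left (g.even_symm p) (C.flat (E c) p v).1
      simp only [Prod.fst_add, Prod.fst_neg, Prod.fst_sum, Prod.smul_fst, evenPart_apply, LinearMap.neg_apply,
        LinearMap.comp_apply, LinearMap.fst_apply, neg_smul, Finset.sum_neg_distrib,
        LinearMap.zero_apply, Prod.fst_zero]
      rw [add_neg_eq_zero]
      conv_lhs => rw [← this]
      refine Finset.sum_congr rfl fun i _ => ?_
      rw [(g.even_symm p).eq, hb]
    · simp [evenPart_apply, Prod.snd_sum]

/-- Flatness of the frame is obtained by correcting it at `p`. Flatness of the reciprocal frame then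
follows, because the pairings of the two frames are constant and the metric of `TM` is parallel. -/
theorem SuperConnection.IsCompatible.nonempty_parallelFrame (hC : C.IsCompatible g)
    {E : Fin n → SuperField n M W} (hE : ∀ i, SmoothFieldNear (E i) p)
    {e' : Fin n → TangentSpace (𝓡 n) p}
    (h : ∀ i j, g.even p (e' j) (E i p).1 = if i = j then 1 else 0) :
    Nonempty (ParallelFrame C g p) := by
  obtain ⟨F, hF, hF2, hFE, hflat⟩ := exists_flat_fields (C := C) hE h
  obtain ⟨V, hV, hpV, hFV⟩ := exists_common_smoothFieldOn hF
  let G : M → Matrix (Fin n) (Fin n) ℝ := fun q => .of fun i j => g.even q (F i q).1 (F j q).1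
  have hG : ∀ i j, SmoothFunOn (n := n) (fun q => G q i j) V := fun i j =>
    g.smoothFunOn_even hV (hFV i) (hFV j)
  obtain ⟨b, hb⟩ := exists_basis_of_reciprocal (finrank_tangentSpace p) h
  have hp0 : (G p).det ≠ 0 := by
    have := (LinearMap.BilinForm.nondegenerate_iff_det_ne_zero b).1 (g.even_nondegenerate p)
    convert this using 2
    ext i j
    rw [LinearMap.BilinForm.toMatrix_apply, hb, hb, ← hFE, ← hFE]; rfl
  let U := V ∩ (fun q => (G q).det) ⁻¹' {0}ᶜ
  have hU : IsOpen U := (SmoothFunOn.det hG).continuousOn.isOpen_inter_preimage hV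
    isOpen_compl_singleton
  have hpU : p ∈ U := ⟨hpV, hp0⟩
  -- Cramer's rule for the inverse Gram matrix, which shows that the reciprocal frame is smooth
  -- wherever the Gram determinant is nonzero.
  let F' : Fin n → SuperField n M W := fun j q =>
    ((G q).det)⁻¹ • ∑ k, (G q).adjugate j k • F k q
  have hF'U : ∀ j, SmoothFieldOn (F' j) U := fun j => by
    refine SmoothFieldOn.smul (ContMDiffOn.inv₀ ((SmoothFunOn.det hG).mono Set.inter_subset_left)
      fun q hq => hq.2) (SmoothFieldOn.sum _ fun k _ => SmoothFieldOn.smul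
      ((SmoothFunOn.adjugate hG j k).mono Set.inter_subset_left)
      ((hFV k).mono Set.inter_subset_left))
  have hin : ∀ q ∈ U, ∀ i j, g.even q (F' j q).1 (F i q).1 = if i = j then 1 else 0 := by
    intro q hq i j
    have h1 : ((G q).adjugate * G q) j i = (G q).det * (if i = j then 1 else 0) := by
      rw [Matrix.adjugate_mul, Matrix.smul_apply, Matrix.one_apply, smul_eq_mul]
      simp only [eq_comm]
    have h2 : g.even q (F' j q).1 (F i q).1 = ((G q).det)⁻¹ * ((G q).adjugate * G q) j i := by
      simp only [F', Prod.smul_fst, Prod.fst_sum, map_smul, map_sum, LinearMap.smul_apply,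
        LinearMap.sum_apply, smul_eq_mul, Matrix.mul_apply]
      rfl
    rw [h2, h1, inv_mul_cancel_left₀ hq.2]
  refine ⟨⟨U, hU, hpU, F, F', fun i => (hFV i).mono Set.inter_subset_left, hF'U, hF2, hin, hflat,
    fun j => LinearMap.ext fun v => Prod.ext ?_ ?_⟩⟩
  · obtain ⟨b, hb⟩ := exists_basis_of_reciprocal (finrank_tangentSpace p) (hin p hpU)
    have hrec : IsReciprocal (g.even p) b (fun i => (F' i p).1) :=
      ⟨fun i j => by rw [hb, hin p hpU]⟩
    -- The derivative of `F' j` is recovered from its pairings with the frame. Each pairing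
    -- vanishes: `⟨F' j, F i⟩` is constant near `p` and `F i` is flat at `p`.
    have := hrec.sum_right (g.even_nondegenerate p) (C.flat (F' j) p v).1
    refine this.symm.trans (Finset.sum_eq_zero fun i _ => ?_)
    have h1 := hC.hasDerivAlong_even ⟨U, hU, hpU, hF'U j⟩ (hF i) v
    have h2 : HasDerivAlong (fun q => g.even q (F' j q).1 (F i q).1) p v 0 :=
      (hasDerivAlong_const (if i = j then 1 else 0)).congr
        (eventually_of_mem (hU.mem_nhds hpU) fun q hq => hin q hq i j)
    have h3 := h1.unique h2
    rw [hflat i] at h3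
    rw [hb, show g.even p (C.flat (F' j) p v).1 (F i p).1 = 0 by simpa using h3, zero_smul]
  · have h1 : (fun q => evenPart (F' j q)) = F' j := by
      funext q
      refine Prod.ext rfl ?_
      simp [evenPart_apply, F', Prod.snd_sum, hF2]
    rw [← h1, SuperConnection.flat_evenPart]
    rfl

namespace ParallelFrame

variable (P : ParallelFrame C g p)

/-- The basis of the tangent space at `q` given by the frame. -/
def basisAt {q : M} (hq : q ∈ P.U) : Module.Basis (Fin n) ℝ (TangentSpace (𝓡 n) q) :=
  (exists_basis_of_reciprocal (finrank_tangentSpace q) (P.inner q hq)).choose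

theorem basisAt_apply {q : M} (hq : q ∈ P.U) (i : Fin n) : P.basisAt hq i = (P.field i q).1 :=
  (exists_basis_of_reciprocal (finrank_tangentSpace q) (P.inner q hq)).choose_spec i

theorem isReciprocal {q : M} (hq : q ∈ P.U) :
    IsReciprocal (g.even q) (P.basisAt hq) (fun i => (P.dual i q).1) :=
  ⟨fun i j => by rw [P.basisAt_apply, P.inner q hq]⟩

theorem smoothFieldNear_field (i : Fin n) : SmoothFieldNear (P.field i) p :=
  ⟨P.U, P.isOpen, P.mem, P.smooth_field i⟩

theorem smoothFieldNear_dual (i : Fin n) : SmoothFieldNear (P.dual i) p :=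
  ⟨P.U, P.isOpen, P.mem, P.smooth_dual i⟩

theorem isParallel_field (i : Fin n) (v : TangentSpace (𝓡 n) p) : IsParallel C (P.field i) p v :=
  ⟨P.smoothFieldNear_field i, by rw [P.flat_field]; rfl⟩

theorem isParallel_dual (i : Fin n) (v : TangentSpace (𝓡 n) p) : IsParallel C (P.dual i) p v :=
  ⟨P.smoothFieldNear_dual i, by rw [P.flat_dual]; rfl⟩

/-- The extension of a vector at `p` to a field which is flat at `p`. -/
def extend (w : SuperTangent n M W p) : SuperField n M W := fun q =>
  ∑ i, g.even p w.1 (P.dual i p).1 • P.field i q + (0, w.2)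

theorem extend_apply_self (w : SuperTangent n M W p) : P.extend w p = w := by
  refine Prod.ext ?_ ?_
  · have := (P.isReciprocal P.mem).sum_left (g.even_symm p) w.1
    simp only [P.basisAt_apply] at this
    simpa [extend, Prod.fst_sum] using this
  · simp [extend, Prod.snd_sum, P.even_field]

theorem extend_add (w w' : SuperTangent n M W p) (q : M) :
    P.extend (w + w') q = P.extend w q + P.extend w' q := by
  simp only [extend, Prod.fst_add, Prod.snd_add, map_add, LinearMap.add_apply, add_smul,
    Finset.sum_add_distrib]
  rw [show ((0, w.2 + w'.2) : SuperTangent n M W q) = (0, w.2) + (0, w'.2) by simp]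
  abel

theorem extend_smul (c : ℝ) (w : SuperTangent n M W p) (q : M) :
    P.extend (c • w) q = c • P.extend w q := by
  simp only [extend, Prod.smul_fst, Prod.smul_snd, map_smul, LinearMap.smul_apply, smul_add,
    Finset.smul_sum, smul_eq_mul, mul_smul]
  congr 1
  simp

theorem isParallel_extend (w : SuperTangent n M W p) (v : TangentSpace (𝓡 n) p) :
    IsParallel C (P.extend w) p v :=
  (IsParallel.sum _ fun i _ => (P.isParallel_field i v).const_smul _).add (isParallel_odd_const _)

theorem smoothFieldOn_extend (w : SuperTangent n M W p) : SmoothFieldOn (P.extend w) P.U :=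
  (SmoothFieldOn.sum _ fun i _ => (P.smooth_field i).const_smul _).add (smoothFieldOn_odd_const _ _)

theorem hasParity_extend {a : Fin 2} {w : SuperTangent n M W p} (hw : HasParity a w) (q : M) :
    HasParity a (P.extend w q) := by
  rcases parity_cases a with rfl | rfl
  · rw [hasParity_zero_iff] at hw ⊢
    simp [extend, Prod.snd_sum, P.even_field, hw]
  · rw [hasParity_one_iff] at hw ⊢
    simp [extend, hw]

/-- A field which is smooth near `p` is a combination, with smooth coefficients, of flat fields. -/
theorem exists_expansion [FiniteDimensional ℝ W] (P : ParallelFrame C g p) {X : SuperField n M W}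
    (hX : SmoothFieldNear X p) (hX0 : X p = 0) :
    ∃ (f : Fin n ⊕ Fin (Module.finrank ℝ W) → M → ℝ)
      (Y : Fin n ⊕ Fin (Module.finrank ℝ W) → SuperField n M W),
      (∀ i, SmoothFunNear (n := n) (f i) p) ∧ (∀ i, f i p = 0) ∧ (∀ i, SmoothFieldNear (Y i) p) ∧
        ∀ᶠ q in 𝓝 p, X q = ∑ i, f i q • Y i q := by
  let b := Module.finBasis ℝ W
  refine ⟨Sum.elim (fun i q => g.even q (X q).1 (P.dual i q).1) (fun j q => b.coord j (X q).2),
    Sum.elim P.field (fun j q => (0, b j)), ?_, ?_, ?_, ?_⟩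
  · rintro (i | j)
    · exact g.smoothFunNear_even hX (P.smoothFieldNear_dual i)
    · obtain ⟨U, hU, hp, hX⟩ := hX
      exact ⟨U, hU, hp,
        (LinearMap.toContinuousLinearMap (b.coord j)).contMDiff.comp_contMDiffOn hX.2⟩
  · rintro (i | j) <;> simp [hX0]
  · rintro (i | j)
    · exact P.smoothFieldNear_field i
    · exact smoothFieldNear_odd_const _
  · refine eventually_of_mem (P.isOpen.mem_nhds P.mem) fun q hq => ?_
    rw [Fintype.sum_sum_type]
    refine Prod.ext ?_ ?_
    · have := (P.isReciprocal hq).sum_left (g.even_symm q) (X q).1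
      simp only [P.basisAt_apply] at this
      simpa [Prod.fst_sum] using this.symm
    · simp [Prod.snd_sum, P.even_field, b.sum_repr]

end ParallelFrame

end ParallelFrame

/-! ### The tensor derivative induced by the flat derivative -/

section TensorDerivative

open Filter Topology

variable {n : ℕ} {M : Type*} [TopologicalSpace M] [ChartedSpace (EuclideanSpace ℝ (Fin n)) M]
  [IsManifold (𝓡 n) ∞ M] {W : Type*} [NormedAddCommGroup W] [NormedSpace ℝ W]
  {C : SuperConnection n M W} {g : SuperMetric n M W} {p : M} {r : ℕ}

/-- The values of a tensor field on smooth fields are differentiable at `p`. -/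
def IsDifferentiableAt (T : SuperTensorField n M W r) (p : M) : Prop :=
  ∀ X : Fin r → SuperField n M W, (∀ i, SmoothFieldNear (X i) p) →
    MDifferentiableAt (𝓡 n) 𝓘(ℝ, ℝ) (fun q => T q (fun i => X i q)) p

theorem update_field_apply (X : Fin r → SuperField n M W) (i : Fin r) (Y : SuperField n M W)
    (q : M) : (fun j => Function.update X i Y j q) = Function.update (fun j => X j q) i (Y q) := by
  funext j
  by_cases h : j = i
  · subst h; simp
  · simp [h]

/-- Replacing an argument of a tensor field by one with the same value at `p`. -/
theorem HasDerivAlong.replace_one [FiniteDimensional ℝ W] (P : ParallelFrame C g p)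
    {T : SuperTensorField n M W r} (hT : IsDifferentiableAt T p) {v : TangentSpace (𝓡 n) p}
    {X : Fin r → SuperField n M W} (hX : ∀ i, SmoothFieldNear (X i) p) (i : Fin r)
    {Y : SuperField n M W} (hY : SmoothFieldNear Y p) (hYX : Y p = X i p) {c : ℝ}
    (h : HasDerivAlong (fun q => T q (fun j => Function.update X i Y j q)) p v c) :
    HasDerivAlong (fun q => T q (fun j => X j q)) p v
      (c + T p (Function.update (fun j => X j p) i (C.flat (X i) p v - C.flat Y p v))) := by
  -- The difference of the two fields vanishes at `p`, hence is `∑ f_a Z_a` with `f_a(p) = 0`. Both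
  -- its flat derivative and its contribution to the derivative of `T` then involve only the
  -- differentials of `f_a` and the values `Z_a(p)`.
  have hZ : SmoothFieldNear (fun q => X i q + (-1 : ℝ) • Y q) p := (hX i).add (hY.const_smul _)
  obtain ⟨f, Z, hf, hf0, hZs, hev⟩ := P.exists_expansion hZ (by simp [hYX])
  have hfd : ∀ a, ∃ d : ℝ, HasDerivAlong (f a) p v d := fun a =>
    ⟨_, (hf a).mdifferentiableAt, rfl⟩
  have hTZ : ∀ a, ∃ d : ℝ,
      HasDerivAlong (fun q => T q (fun j => Function.update X i (Z a) j q)) p v d :=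
    fun a => ⟨_, hT _ fun j => by
      by_cases hj : j = i
      · subst hj; simpa using hZs a
      · simpa [hj] using hX j, rfl⟩
  choose df hfd using hfd
  choose dT hTZ using hTZ
  have h1 := h.add (HasDerivAlong.sum Finset.univ fun a _ => (hfd a).mul (hTZ a))
  have h2 : C.flat (X i) p v - C.flat Y p v =
      ∑ a, df a • Z a p := by
    have h3 : C.flat (fun q => X i q + (-1 : ℝ) • Y q) p v =
        C.flat (X i) p v - C.flat Y p v := by
      rw [SuperConnection.flat_add (hX i) (hY.const_smul _), SuperConnection.flat_const_smul _ hY]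
      simp [sub_eq_add_neg]
    rw [← h3, SuperConnection.flat_congr (SmoothFieldNear.sum _ fun a _ => (hZs a).smul (hf a)) hev,
      SuperConnection.flat_sum _ fun a _ => (hZs a).smul (hf a), LinearMap.sum_apply]
    refine Finset.sum_congr rfl fun a _ => ?_
    rw [SuperConnection.flat_smul (hf a) (hZs a) (hfd a), hf0, zero_smul, add_zero]
  rw [h2, MultilinearMap.map_update_sum]
  simp only [hf0, zero_mul, add_zero, update_field_apply] at h1
  simp only [MultilinearMap.map_update_smul, smul_eq_mul]
  refine h1.congr (hev.mono fun q hq => ?_)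
  simp only
  have h4 : (fun j => X j q) = Function.update (fun j => X j q) i (Y q + ∑ a, f a q • Z a q) := by
    rw [← hq]
    simp
  conv_lhs => rw [h4]
  rw [MultilinearMap.map_update_add, MultilinearMap.map_update_sum]
  simp only [MultilinearMap.map_update_smul, smul_eq_mul]

/-- Replacing the arguments of a tensor field by ones with the same values at `p`. -/
theorem HasDerivAlong.replace [FiniteDimensional ℝ W] (P : ParallelFrame C g p)
    {T : SuperTensorField n M W r} (hT : IsDifferentiableAt T p) {v : TangentSpace (𝓡 n) p}
    {X Y : Fin r → SuperField n M W} (hX : ∀ i, SmoothFieldNear (X i) p)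
    (hY : ∀ i, SmoothFieldNear (Y i) p) (hYX : ∀ i, Y i p = X i p) {c : ℝ}
    (h : HasDerivAlong (fun q => T q (fun j => Y j q)) p v c) :
    HasDerivAlong (fun q => T q (fun j => X j q)) p v
      (c + ∑ i, T p (Function.update (fun j => X j p) i
        (C.flat (X i) p v - C.flat (Y i) p v))) := by
  -- The arguments are exchanged one at a time; as the fields agree at `p`, earlier replacements do
  -- not affect the correction terms of later ones.
  have key : ∀ s : Finset (Fin r), HasDerivAlong
      (fun q => T q (fun j => s.piecewise X Y j q)) p v
      (c + ∑ i ∈ s, T p (Function.update (fun j => X j p) i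
        (C.flat (X i) p v - C.flat (Y i) p v))) := by
    intro s
    induction s using Finset.induction_on with
    | empty => simpa using h
    | insert i s hi ih =>
      have hs : ∀ j, SmoothFieldNear ((insert i s).piecewise X Y j) p := fun j => by
        by_cases hj : j ∈ insert i s
        · rw [Finset.piecewise_eq_of_mem _ _ _ hj]; exact hX j
        · rw [Finset.piecewise_eq_of_notMem _ _ _ hj]; exact hY j
      have hval : (fun j => (insert i s).piecewise X Y j p) = fun j => X j p := by
        funext j
        by_cases hj : j ∈ insert i s
        · rw [Finset.piecewise_eq_of_mem _ _ _ hj]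
        · rw [Finset.piecewise_eq_of_notMem _ _ _ hj]; exact hYX j
      have h1 : Function.update ((insert i s).piecewise X Y) i (Y i) = s.piecewise X Y := by
        rw [Finset.piecewise_insert, Function.update_idem]
        conv_rhs => rw [← Function.update_eq_self i (s.piecewise X Y)]
        rw [Finset.piecewise_eq_of_notMem _ _ _ hi]
      have h2 := HasDerivAlong.replace_one P hT (v := v) hs i (hY i) (by
        rw [Finset.piecewise_eq_of_mem _ _ _ (Finset.mem_insert_self i s)]; exact hYX i)
        (c := c + ∑ i ∈ s, T p (Function.update (fun j => X j p) i
          (C.flat (X i) p v - C.flat (Y i) p v))) (by rw [h1]; exact ih)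
      rw [hval, Finset.piecewise_eq_of_mem _ _ _ (Finset.mem_insert_self i s)] at h2
      rw [Finset.sum_insert hi]
      convert! h2 using 1
      ring
  simpa using key Finset.univ

variable (C) in
/-- `L` is the derivative at `p` of the tensor field `T` with respect to the flat derivative of
fields. -/
def HasTensorDeriv (T : SuperTensorField n M W r) (p : M)
    (L : TangentSpace (𝓡 n) p →ₗ[ℝ] SuperTensor (TangentSpace (𝓡 n) p) W r) : Prop :=
  ∀ (v : TangentSpace (𝓡 n) p) (X : Fin r → SuperField n M W), (∀ i, IsParallel C (X i) p v) →
    HasDerivAlong (fun q => T q (fun i => X i q)) p v (L v (fun i => X i p))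

variable {T : SuperTensorField n M W r}
  {L : TangentSpace (𝓡 n) p →ₗ[ℝ] SuperTensor (TangentSpace (𝓡 n) p) W r}

/-- Every smooth field is parallel in the direction zero, so differentiability on arbitrary smooth
fields is contained in the notion. -/
theorem HasTensorDeriv.isDifferentiableAt (h : HasTensorDeriv C T p L) : IsDifferentiableAt T p :=
  fun X hX => (h 0 X fun i => (hX i).isParallel_zero).1

/-- The product rule. -/
theorem HasTensorDeriv.hasDerivAlong [FiniteDimensional ℝ W] (h : HasTensorDeriv C T p L)
    (P : ParallelFrame C g p) {X : Fin r → SuperField n M W} (hX : ∀ i, SmoothFieldNear (X i) p)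
    (v : TangentSpace (𝓡 n) p) :
    HasDerivAlong (fun q => T q (fun j => X j q)) p v (L v (fun j => X j p) +
      ∑ i, T p (Function.update (fun j => X j p) i (C.flat (X i) p v))) := by
  have h1 := h v (fun i => P.extend (X i p)) fun i => P.isParallel_extend _ v
  have h2 := HasDerivAlong.replace P h.isDifferentiableAt hX
    (fun i => (P.isParallel_extend (X i p) v).smooth) (fun i => P.extend_apply_self _) h1
  simpa only [(P.isParallel_extend _ v).flat_eq, sub_zero, P.extend_apply_self] using h2

/-- The derivative is defined by differentiating `T` on the parallel extensions of vectors at `p`.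
It is multilinear because extension is linear, and any other parallel fields with the same values
give the same result. -/
theorem IsDifferentiableAt.exists_hasTensorDeriv [FiniteDimensional ℝ W]
    (hT : IsDifferentiableAt T p) (P : ParallelFrame C g p) :
    ∃ L, HasTensorDeriv C T p L := by
  have hd : ∀ (w : Fin r → SuperTangent n M W p) (v : TangentSpace (𝓡 n) p), HasDerivAlong
      (fun q => T q (fun i => P.extend (w i) q)) p v
        (mfderiv (𝓡 n) 𝓘(ℝ, ℝ) (fun q => T q (fun i => P.extend (w i) q)) p v) := fun w v =>
    ⟨hT _ fun i => (P.isParallel_extend (w i) v).smooth, rfl⟩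
  have hu : ∀ (w : Fin r → SuperTangent n M W p) i x q,
      (fun j => P.extend (Function.update w i x j) q) =
        Function.update (fun j => P.extend (w j) q) i (P.extend x q) := fun w i x q => by
    funext j
    by_cases hj : j = i
    · subst hj; simp
    · simp [hj]
  let L : TangentSpace (𝓡 n) p →ₗ[ℝ] SuperTensor (TangentSpace (𝓡 n) p) W r :=
    { toFun := fun v =>
        { toFun := fun w => mfderiv (𝓡 n) 𝓘(ℝ, ℝ) (fun q => T q (fun i => P.extend (w i) q)) p v
          map_update_add' := by
            intro inst w i x y
            obtain rfl := Subsingleton.elim inst (instDecidableEqFin r)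
            refine (hd _ v).unique (((hd _ v).add (hd _ v)).congr (.of_forall fun q => ?_))
            simp only [hu, P.extend_add, MultilinearMap.map_update_add]
          map_update_smul' := by
            intro inst w i c x
            obtain rfl := Subsingleton.elim inst (instDecidableEqFin r)
            refine (hd _ v).unique (((hd _ v).const_mul c).congr (.of_forall fun q => ?_))
            simp only [hu, P.extend_smul, MultilinearMap.map_update_smul, smul_eq_mul] }
      map_add' := fun v v' => by
        ext w
        exact map_add (mfderiv (𝓡 n) 𝓘(ℝ, ℝ) (fun q => T q (fun i => P.extend (w i) q)) p) v v'
      map_smul' := fun c v => by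
        ext w
        exact map_smul (mfderiv (𝓡 n) 𝓘(ℝ, ℝ) (fun q => T q (fun i => P.extend (w i) q)) p) c v }
  refine ⟨L, fun v X hX => ?_⟩
  have := HasDerivAlong.replace P hT (fun i => (hX i).smooth)
    (fun i => (P.isParallel_extend (X i p) v).smooth) (fun i => P.extend_apply_self _)
    (hd (fun i => X i p) v)
  simp only [(hX _).flat_eq, (P.isParallel_extend _ v).flat_eq, sub_zero,
    MultilinearMap.map_update_zero, Finset.sum_const_zero] at this
  convert! this using 1
  exact (add_zero _).symm

/-- Parallel extensions keep their parity at every point, so the exchange rule for `T` holds along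
them and can be differentiated at `p`. -/
theorem HasTensorDeriv.isSuperAlternating (h : HasTensorDeriv C T p L) (P : ParallelFrame C g p)
    (hT : ∀ q, IsSuperAlternating (T q)) (v : TangentSpace (𝓡 n) p) :
    IsSuperAlternating (L v) := by
  intro w ε hw i j hij
  have h1 := h v (fun i => P.extend (w i)) fun i => P.isParallel_extend _ v
  have h2 := h v (fun a => P.extend ((w ∘ Equiv.swap i j) a)) fun i => P.isParallel_extend _ v
  simp only [P.extend_apply_self] at h1 h2
  refine h1.unique ((h2.const_mul _).congr (.of_forall fun q => ?_))
  exact hT q _ ε (fun a => P.hasParity_extend (hw a) q) i j hij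

theorem IsSuperForm.isDifferentiableAt (h : IsSuperForm T) (p : M) : IsDifferentiableAt T p := by
  intro X hX
  obtain ⟨U, hU, hp, hX⟩ := exists_common_smoothFieldOn hX
  exact SmoothFunNear.mdifferentiableAt ⟨U, hU, hp, h.smooth U hU X hX⟩

end TensorDerivative

/-! ### The volume tensor and the Hodge operator are parallel -/

section HodgeDerivative

open Filter Topology

/-- A form of top degree is a multiple of the determinant of any basis, and coordinates are pairings
with the reciprocal vectors. -/
theorem IsReciprocal.volumeTensor_eq {V₀ : Type*} [AddCommGroup V₀] [Module ℝ V₀] {n : ℕ}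
    {B : LinearMap.BilinForm ℝ V₀} {e : Module.Basis (Fin n) ℝ V₀} {e' : Fin n → V₀}
    (h : IsReciprocal B e e') (o : Orientation ℝ V₀ (Fin n)) (y : Fin n → V₀) :
    volumeTensor B o y = volumeTensor B o e * (Matrix.of fun i j => B (e' i) (y j)).det := by
  conv_lhs => rw [AlternatingMap.eq_smul_basis_det e (volumeTensor B o)]
  rw [AlternatingMap.smul_apply, Module.Basis.det_apply, smul_eq_mul]
  congr 2
  ext i j
  rw [Module.Basis.toMatrix_apply, Matrix.of_apply]
  conv_rhs => rw [← e.sum_repr (y j), map_sum]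
  simp [-Module.Basis.sum_repr, h.inner]

/-- Valid for arbitrary arguments and as a finite sum of products, this form can be differentiated
term by term. -/
theorem hodge_apply_expand {V₀ V₁ : Type*} [AddCommGroup V₀] [Module ℝ V₀]
    [AddCommGroup V₁] [Module ℝ V₁] [FiniteDimensional ℝ V₀] {n : ℕ}
    {B : LinearMap.BilinForm ℝ V₀} (hs : B.IsSymm) (hB : B.Nondegenerate)
    {e : Module.Basis (Fin n) ℝ V₀} {e' : Fin n → V₀} (he : IsReciprocal B e e')
    (o : Orientation ℝ V₀ (Fin n)) {r r' : ℕ} (k l j : ℕ) (hr : r = k + l) (hr' : r' = j + l)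
    (hn : n = k + j) (T : SuperTensor V₀ V₁ r) (w : Fin r' → V₀ × V₁) :
    hodge B hB o k l j hr hr' hn T w =
      open scoped Classical in
      ∑ σ : Equiv.Perm (Fin (j + l)) with IsShuffle j l σ, ((Equiv.Perm.sign σ : ℤ) : ℝ) *
        (((k.factorial : ℝ)⁻¹) * ∑ a : Fin k → Fin n,
          volumeTensor B o (Fin.append (fun i => e' (a i))
            (fun x => (evenPart (w (Fin.cast hr'.symm (σ (Fin.castAdd l x))))).1) ∘ Fin.cast hn) *
          T (Fin.append (fun i => (e (a i), (0 : V₁)))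
            (fun y => oddPart (w (Fin.cast hr'.symm (σ (Fin.natAdd j y))))) ∘ Fin.cast hr)) := by
  rw [hodge_eq, superExtend_apply]
  refine Finset.sum_congr rfl fun σ _ => ?_
  rw [blockPart_apply, hodgeBlock_apply hs hB he]
  simp

variable {n : ℕ} {M : Type*} [TopologicalSpace M] [ChartedSpace (EuclideanSpace ℝ (Fin n)) M]
  [IsManifold (𝓡 n) ∞ M] {W : Type*} [NormedAddCommGroup W] [NormedSpace ℝ W]
  {C : SuperConnection n M W} {g : SuperMetric n M W} {p : M}

/-- The sign of the volume tensor on a frame is locally constant. -/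
theorem eventually_sign_volumeTensor (P : ParallelFrame C g p) (o : ManifoldOrientation n M) :
    ∃ s : SignType, ∀ᶠ q in 𝓝 p,
      SignType.sign (volumeTensor (g.even q) (o.at_ q) (fun i => (P.field i q).1)) = s := by
  obtain ⟨V, hV, hpV, X, hX, ho⟩ := o.smooth p
  have hXs : ∀ i, SmoothFieldOn (W := W) (fun q => ((X i q, 0) : SuperTangent n M W q)) V :=
    fun i => ⟨hX i, contMDiffOn_const⟩
  let d : M → ℝ := fun q => (Matrix.of fun i j => g.even q (P.dual i q).1 (X j q)).det
  have hd : SmoothFunOn (n := n) d (P.U ∩ V) := SmoothFunOn.det fun i j =>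
    g.smoothFunOn_even (P.isOpen.inter hV) ((P.smooth_dual i).mono Set.inter_subset_left)
      ((hXs j).mono Set.inter_subset_right)
  have hvol : ∀ q ∈ P.U, volumeTensor (g.even q) (o.at_ q) (fun i => X i q) =
      volumeTensor (g.even q) (o.at_ q) (fun i => (P.field i q).1) * d q := fun q hq => by
    rw [(P.isReciprocal hq).volumeTensor_eq]
    congr 2
    funext i
    exact P.basisAt_apply hq i
  -- On the frame supplied by the orientation the sign is constant. The given frame differs from it
  -- by the factor `d`, which is continuous and nonzero at `p`.
  have hsX : ∃ s : SignType, s ≠ 0 ∧ ∀ q ∈ V,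
      SignType.sign (volumeTensor (g.even q) (o.at_ q) (fun i => X i q)) = s := by
    rcases ho with ho | ho
    · refine ⟨1, one_ne_zero, fun q hq => ?_⟩
      obtain ⟨b, hb, hbo⟩ := ho q hq
      have := volumeTensor_pos (g.even_symm q) (g.even_nondegenerate q) (o.at_ q) b hbo
      rw [show (b : Fin n → _) = fun i => X i q from funext hb] at this
      exact sign_pos this
    · refine ⟨-1, by decide, fun q hq => ?_⟩
      obtain ⟨b, hb, hbo⟩ := ho q hq
      have := volumeTensor_neg (g.even_symm q) (g.even_nondegenerate q) (o.at_ q) b hbo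
      rw [show (b : Fin n → _) = fun i => X i q from funext hb] at this
      exact sign_neg this
  obtain ⟨s, hs0, hs⟩ := hsX
  have hpU : p ∈ P.U ∩ V := ⟨P.mem, hpV⟩
  have hUV := (P.isOpen.inter hV).mem_nhds hpU
  have hdp : d p ≠ 0 := fun h0 => by
    have h1 := hs p hpV
    rw [hvol p P.mem, h0, mul_zero, sign_zero] at h1
    exact hs0 h1.symm
  have hdc : ContinuousAt d p := hd.continuousOn.continuousAt hUV
  have hsd : ∀ᶠ q in 𝓝 p, SignType.sign (d q) = SignType.sign (d p) := by
    have := (continuousAt_sign_of_ne_zero hdp).tendsto.comp hdc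
    rwa [nhds_discrete SignType, tendsto_pure] at this
  refine ⟨s * SignType.sign (d p), ?_⟩
  filter_upwards [hsd, hUV] with q hq hqU
  rw [← hs q hqU.2, hvol q hqU.1, sign_mul, ← hq, mul_assoc, ← sign_mul,
    sign_pos (mul_self_pos.2 fun h0 => ?_), mul_one]
  have h1 := hs q hqU.2
  rw [hvol q hqU.1, h0, mul_zero, sign_zero] at h1
  exact hs0 h1.symm

theorem hasDerivAlong_even_of_isParallel (hC : C.IsCompatible g) {X Y : SuperField n M W}
    {v : TangentSpace (𝓡 n) p} (hX : IsParallel C X p v) (hY : IsParallel C Y p v) :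
    HasDerivAlong (fun q => g.even q (X q).1 (Y q).1) p v 0 := by
  simpa [hX.flat_eq, hY.flat_eq] using hC.hasDerivAlong_even hX.smooth hY.smooth v

/-- The volume tensor is parallel. -/
theorem hasDerivAlong_volumeTensor (hC : C.IsCompatible g) (P : ParallelFrame C g p)
    (o : ManifoldOrientation n M) {v : TangentSpace (𝓡 n) p} {Y : Fin n → SuperField n M W}
    (hY : ∀ i, IsParallel C (Y i) p v) :
    HasDerivAlong (fun q => volumeTensor (g.even q) (o.at_ q) (fun i => (Y i q).1)) p v 0 := by
  let G : M → Matrix (Fin n) (Fin n) ℝ :=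
    fun q => .of fun i j => g.even q (P.field i q).1 (P.field j q).1
  let h : M → ℝ := fun q => volumeTensor (g.even q) (o.at_ q) (fun i => (P.field i q).1)
  have hG : HasDerivAlong (fun q => (G q).det) p v 0 := HasDerivAlong.det fun i j =>
    hasDerivAlong_even_of_isParallel hC (P.isParallel_field i v) (P.isParallel_field j v)
  have hh : ∀ q, h q * h q =
      (-1) ^ sigNeg (LinearMap.BilinMap.toQuadraticMap (g.even q)) * (G q).det := fun q =>
    volumeTensor_mul (finrank_tangentSpace q) (g.even_symm q) (g.even_nondegenerate q) _ _ _
  -- The orthonormal bases behind the volume tensor need not depend smoothly on `q`, so smoothness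
  -- is read off the Gram determinant. Taking absolute values removes the factor `(-1)^s`, and the
  -- sign of `h` is locally constant.
  have habs : ∀ q, |h q| = Real.sqrt |(G q).det| := fun q => by
    have := congrArg abs (hh q)
    rw [abs_mul, abs_mul (_ ^ _), abs_neg_one_pow, one_mul, ← sq] at this
    rw [← this, Real.sqrt_sq (abs_nonneg _)]
  have hGp : (G p).det ≠ 0 := by
    have := (LinearMap.BilinForm.nondegenerate_iff_det_ne_zero (P.basisAt P.mem)).1
      (g.even_nondegenerate p)
    convert this using 2
    ext i j
    rw [LinearMap.BilinForm.toMatrix_apply, P.basisAt_apply, P.basisAt_apply]; rfl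
  obtain ⟨s, hs⟩ := eventually_sign_volumeTensor P o
  have hd : HasDerivAlong h p v 0 := by
    have h1 := (hG.comp ((hasDerivAt_abs hGp).sqrt (abs_ne_zero.2 hGp))).const_mul (s : ℝ)
    rw [mul_zero, mul_zero] at h1
    refine h1.congr ?_
    filter_upwards [hs] with q hq
    rw [← habs q, ← hq]
    exact (sign_mul_abs _).symm
  -- For general parallel arguments the volume is `h` times a determinant of pairings of parallel
  -- fields, which has derivative zero.
  have h2 := hd.mul (HasDerivAlong.det (A := fun q => .of fun i j =>
    g.even q (P.dual i q).1 (Y j q).1) fun i j =>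
      hasDerivAlong_even_of_isParallel hC (P.isParallel_dual i v) (hY j))
  rw [zero_mul, mul_zero, add_zero] at h2
  refine h2.congr (eventually_of_mem (P.isOpen.mem_nhds P.mem) fun q hq => ?_)
  simp only
  rw [(P.isReciprocal hq).volumeTensor_eq]
  congr 2
  funext i
  exact P.basisAt_apply hq i

theorem append_field_apply {α : Type*} {β : α → Type*} {k j m : ℕ} (h : m = k + j)
    (x : Fin k → ∀ q, β q) (y : Fin j → ∀ q, β q) (q : α) :
    (fun i => (Fin.append x y ∘ Fin.cast h) i q) =
      Fin.append (fun i => x i q) (fun i => y i q) ∘ Fin.cast h := by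
  subst h
  funext i
  refine Fin.addCases (fun i => ?_) (fun i => ?_) i <;> simp

theorem isParallel_append {k j m : ℕ} (h : m = k + j) {v : TangentSpace (𝓡 n) p}
    {X : Fin k → SuperField n M W} {Y : Fin j → SuperField n M W}
    (hX : ∀ i, IsParallel C (X i) p v) (hY : ∀ i, IsParallel C (Y i) p v) (i : Fin m) :
    IsParallel C ((Fin.append X Y ∘ Fin.cast h) i) p v := by
  subst h
  refine Fin.addCases (fun i => ?_) (fun i => ?_) i
  · simpa using hX i
  · simpa using hY i

/-- The Hodge operator is parallel. -/
theorem HasTensorDeriv.hodgeField (hC : C.IsCompatible g) (P : ParallelFrame C g p)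
    (o : ManifoldOrientation n M) {r r' : ℕ} (k l j : ℕ) (hr : r = k + l) (hr' : r' = j + l)
    (hn : n = k + j) {η : SuperTensorField n M W r}
    {L : TangentSpace (𝓡 n) p →ₗ[ℝ] SuperTensor (TangentSpace (𝓡 n) p) W r}
    (h : HasTensorDeriv C η p L) :
    HasTensorDeriv C (hodgeField g o k l j hr hr' hn η) p
      (hodgeLinear (g.even_symm p) (g.even_nondegenerate p) (o.at_ p) k l j hr hr' hn ∘ₗ L) := by
  classical
  intro v X hX
  have hexp : ∀ q ∈ P.U, ∀ T : SuperTensor (TangentSpace (𝓡 n) q) W r,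
      hodge (g.even q) (g.even_nondegenerate q) (o.at_ q) k l j hr hr' hn T (fun i => X i q) =
      ∑ σ : Equiv.Perm (Fin (j + l)) with IsShuffle j l σ, ((Equiv.Perm.sign σ : ℤ) : ℝ) *
        (((k.factorial : ℝ)⁻¹) * ∑ a : Fin k → Fin n,
          volumeTensor (g.even q) (o.at_ q) (fun i => ((Fin.append (fun i => P.dual (a i))
            (fun x q => evenPart (X (Fin.cast hr'.symm (σ (Fin.castAdd l x))) q)) ∘
              Fin.cast hn) i q).1) *
          T (fun i => (Fin.append (fun i => P.field (a i))
            (fun y q => oddPart (X (Fin.cast hr'.symm (σ (Fin.natAdd j y))) q)) ∘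
              Fin.cast hr) i q)) := by
    intro q hq T
    rw [hodge_apply_expand (g.even_symm q) (g.even_nondegenerate q) (P.isReciprocal hq)]
    refine Finset.sum_congr rfl fun σ _ => ?_
    congr 2
    refine Finset.sum_congr rfl fun a _ => ?_
    congr 2
    · funext i
      have := congrFun (append_field_apply hn (fun i => P.dual (a i)) (fun x q =>
        evenPart (X (Fin.cast hr'.symm (σ (Fin.castAdd l x))) q)) q) i
      rw [this]
      subst hn
      refine Fin.addCases (fun i => ?_) (fun i => ?_) i <;> simp
    · rw [append_field_apply hr]
      congr 2
      funext i
      rw [P.basisAt_apply hq]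
      exact Prod.ext rfl (P.even_field _ q).symm
  -- In every product the volume factor has derivative zero and the arguments of `η` are parallel.
  -- What remains is the same expansion with `L v` in place of `η`.
  have key := HasDerivAlong.sum (Finset.univ.filter (IsShuffle j l)) fun σ _ =>
    ((HasDerivAlong.sum Finset.univ fun (a : Fin k → Fin n) _ =>
      (hasDerivAlong_volumeTensor hC P o (isParallel_append hn
        (fun i => P.isParallel_dual (a i) v)
        (fun x => (hX (Fin.cast hr'.symm (σ (Fin.castAdd l x)))).evenPart))).mul
      (h v _ (isParallel_append hr (fun i => P.isParallel_field (a i) v)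
        (fun y => (hX (Fin.cast hr'.symm (σ (Fin.natAdd j y)))).oddPart)))).const_mul
          ((k.factorial : ℝ)⁻¹)).const_mul ((Equiv.Perm.sign σ : ℤ) : ℝ)
  simp only [zero_mul, zero_add] at key
  refine (?_ : HasDerivAlong _ p v _)
  rw [show (hodgeLinear (g.even_symm p) (g.even_nondegenerate p) (o.at_ p) k l j hr hr' hn ∘ₗ L) v
    (fun i => X i p) = _ from hexp p P.mem (L v)]
  exact key.congr (eventually_of_mem (P.isOpen.mem_nhds P.mem) fun q hq => hexp q hq (η q))

end HodgeDerivative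

/-! ### The exterior derivative as alternation of the tensor derivative -/

section ExteriorDerivative

open Filter Topology

section Algebra

variable {V₀ V₁ : Type*} [AddCommGroup V₀] [Module ℝ V₀] [AddCommGroup V₁] [Module ℝ V₁]

theorem sum_Iio_succAbove_castSucc {r : ℕ} {i j : Fin (r + 1)} (h : i ≤ j) (f : Fin (r + 2) → ℕ) :
    ∑ a ∈ Finset.Iio j, f (i.castSucc.succAbove a) =
      ∑ a ∈ (Finset.Iio j.succ).erase i.castSucc, f a := by
  refine (Finset.sum_map _ i.castSucc.succAboveEmb f).symm.trans ?_
  congr 1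
  ext a
  simp only [Finset.mem_map, Finset.mem_Iio, Finset.mem_erase]
  constructor
  · rintro ⟨b, hb, rfl⟩
    refine ⟨Fin.succAbove_ne _ _, ?_⟩
    refine lt_of_lt_of_le ?_ (Fin.succ_le_succ_iff.2 (le_refl j))
    rcases lt_or_ge b.castSucc i.castSucc with h' | h'
    · change i.castSucc.succAbove b < _
      rw [Fin.succAbove_of_castSucc_lt _ _ h']
      exact (Fin.castSucc_lt_castSucc_iff.2 hb).trans Fin.castSucc_lt_succ
    · change i.castSucc.succAbove b < _
      rw [Fin.succAbove_of_le_castSucc _ _ h']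
      exact Fin.succ_lt_succ_iff.2 hb
  · rintro ⟨ha, hb⟩
    obtain ⟨c, rfl⟩ := Fin.exists_succAbove_eq ha
    refine ⟨c, ?_, rfl⟩
    rcases lt_or_ge c.castSucc i.castSucc with h' | h'
    · exact lt_of_lt_of_le (Fin.castSucc_lt_castSucc_iff.1 h') h
    · rw [Fin.succAbove_of_le_castSucc _ _ h'] at hb
      exact Fin.succ_lt_succ_iff.1 hb

theorem sum_Iio_succAbove_succ {r : ℕ} {i j : Fin (r + 1)} (h : i ≤ j) (f : Fin (r + 2) → ℕ) :
    ∑ a ∈ Finset.Iio i, f (j.succ.succAbove a) = ∑ a ∈ Finset.Iio i.castSucc, f a := by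
  refine (Finset.sum_map _ j.succ.succAboveEmb f).symm.trans ?_
  congr 1
  ext a
  simp only [Finset.mem_map, Finset.mem_Iio]
  constructor
  · rintro ⟨b, hb, rfl⟩
    change j.succ.succAbove b < _
    rw [Fin.succAbove_of_castSucc_lt _ _ (by
      rw [Fin.lt_def]; simp only [Fin.val_castSucc, Fin.val_succ]; omega)]
    exact Fin.castSucc_lt_castSucc_iff.2 hb
  · intro ha
    refine ⟨a.castPred (by rintro rfl; exact absurd ha (by simp [Fin.lt_def])), ?_, ?_⟩
    · rw [Fin.lt_def] at ha ⊢; simpa using ha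
    · change j.succ.succAbove _ = _
      rw [Fin.succAbove_of_castSucc_lt _ _ (by
        rw [Fin.lt_def] at ha ⊢; simp only [Fin.castSucc_castPred, Fin.val_succ] at *
        simp only [Fin.val_castSucc] at ha; omega)]
      simp

/-- The two ways of collecting the correction terms in the exterior derivative. -/
theorem IsSuperAlternating.sum_update_eq {r : ℕ} {T : SuperTensor V₀ V₁ (r + 1)}
    (hT : IsSuperAlternating T) {x : Fin (r + 2) → V₀ × V₁} {ε : Fin (r + 2) → Fin 2}
    (hx : ∀ i, HasParity (ε i) (x i)) {N : Fin (r + 2) → Fin (r + 2) → V₀ × V₁}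
    (hN : ∀ i j, HasParity (ε j) (N i j)) (hN0 : ∀ i j, ε i = 1 → N i j = 0) :
    ∑ i : Fin (r + 2), ∑ j : Fin (r + 1), (-1 : ℝ) ^ (i : ℕ) *
        T (Function.update (i.removeNth x) j (N i (i.succAbove j))) =
      - ∑ i : Fin (r + 1), ∑ j ∈ Finset.Ici i,
      (-1 : ℝ) ^ ((i : ℕ) + (j : ℕ) + 1
          + (ε i.castSucc : ℕ) * (∑ a ∈ Finset.Iio i.castSucc, (ε a : ℕ))
          + (ε j.succ : ℕ) * (∑ a ∈ (Finset.Iio j.succ).erase i.castSucc, (ε a : ℕ))) *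
        T (Fin.cons (N i.castSucc j.succ - N j.succ i.castSucc)
          (j.removeNth (i.castSucc.removeNth x))) := by
  -- Ordered pairs of distinct places are grouped by the unordered pair. Its two terms, moved to the
  -- front, have opposite signs and combine to `T` of the difference.
  rw [Fin.sum_sum_eq_sum_triangle_add, ← Finset.sum_neg_distrib]
  refine Finset.sum_congr rfl fun i _ => ?_
  rw [← Finset.sum_neg_distrib]
  refine Finset.sum_congr rfl fun j hj => ?_
  rw [Finset.mem_Ici] at hj
  have H₁ : i.castSucc.succAbove j = j.succ := by simp [Fin.succAbove_of_le_castSucc, hj]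
  have H₂ : j.predAbove i.castSucc = i := by simp [Fin.predAbove_of_le_castSucc, hj]
  have H₃ : j.succ.succAbove i = i.castSucc := by simp [Fin.succAbove_of_castSucc_lt, hj]
  have hupd : ∀ (u : Fin (r + 1) → V₀ × V₁) (e : Fin (r + 1) → Fin 2) (k : Fin (r + 1))
      (y : V₀ × V₁), (∀ a, HasParity (e a) (u a)) → HasParity (e k) y →
      T (Function.update u k y) = (-1) ^ ((k : ℕ) + (e k : ℕ) * ∑ a ∈ Finset.Iio k, (e a : ℕ)) *
        T (Fin.cons y (k.removeNth u)) := by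
    intro u e k y hu hy
    rw [hT.apply_eq_cons k (Function.update u k y) e (fun a => by
      by_cases ha : a = k
      · subst ha; simpa using hy
      · simpa [ha] using hu a)]
    simp
  have hsub : T (Fin.cons (N i.castSucc j.succ - N j.succ i.castSucc)
      (j.removeNth (i.castSucc.removeNth x))) =
    T (Fin.cons (N i.castSucc j.succ) (j.removeNth (i.castSucc.removeNth x))) -
      T (Fin.cons (N j.succ i.castSucc) (j.removeNth (i.castSucc.removeNth x))) := by
    have := map_sub T.curryLeft (N i.castSucc j.succ) (N j.succ i.castSucc)
    exact congrArg (fun S => S (j.removeNth (i.castSucc.removeNth x))) this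
  have hsw : i.removeNth (j.succ.removeNth x) = j.removeNth (i.castSucc.removeNth x) := by
    rw [Fin.removeNth_removeNth_eq_swap x j i.castSucc, H₂, H₁]
  have h1 : (-1 : ℝ) ^ (i : ℕ) * T (Function.update (i.castSucc.removeNth x) j
        (N i.castSucc j.succ)) = (-1) ^ ((i : ℕ) + (j : ℕ)
          + (ε i.castSucc : ℕ) * (∑ a ∈ Finset.Iio i.castSucc, (ε a : ℕ))
          + (ε j.succ : ℕ) * (∑ a ∈ (Finset.Iio j.succ).erase i.castSucc, (ε a : ℕ))) *
      T (Fin.cons (N i.castSucc j.succ) (j.removeNth (i.castSucc.removeNth x))) := by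
    rw [hupd (i.castSucc.removeNth x) (i.castSucc.removeNth ε) j (N i.castSucc j.succ) (fun a => hx _) (by
      change HasParity (ε (i.castSucc.succAbove j)) _; rw [H₁]; exact hN _ _)]
    -- The sign to be matched also contains the exponent that belongs to the place `i`. It is zero
    -- for an even argument; for an odd one the term itself vanishes, since nothing is
    -- differentiated in an odd direction.
    rcases parity_cases (ε i.castSucc) with h0 | h0
    · rw [h0, Fin.val_zero, zero_mul, add_zero, ← mul_assoc, ← pow_add,
        ← sum_Iio_succAbove_castSucc hj]
      simp only [Fin.removeNth, H₁]
      congr 2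
      ring
    · rw [hN0 _ _ h0]
      rw [T.map_coord_zero (m := Fin.cons 0 _) 0 (by simp)]
      simp
  have h2 : (-1 : ℝ) ^ ((j : ℕ) + 1) * T (Function.update (j.succ.removeNth x) i
        (N j.succ i.castSucc)) = (-1) ^ ((i : ℕ) + (j : ℕ) + 1
          + (ε i.castSucc : ℕ) * (∑ a ∈ Finset.Iio i.castSucc, (ε a : ℕ))
          + (ε j.succ : ℕ) * (∑ a ∈ (Finset.Iio j.succ).erase i.castSucc, (ε a : ℕ))) *
      T (Fin.cons (N j.succ i.castSucc) (j.removeNth (i.castSucc.removeNth x))) := by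
    rw [hupd (j.succ.removeNth x) (j.succ.removeNth ε) i (N j.succ i.castSucc) (fun a => hx _) (by
      change HasParity (ε (j.succ.succAbove i)) _; rw [H₃]; exact hN _ _), hsw]
    rcases parity_cases (ε j.succ) with h0 | h0
    · rw [h0, Fin.val_zero, zero_mul, add_zero, ← mul_assoc, ← pow_add,
        ← sum_Iio_succAbove_succ hj]
      simp only [Fin.removeNth, H₃]
      congr 2
      ring
    · rw [hN0 _ _ h0]
      rw [T.map_coord_zero (m := Fin.cons 0 _) 0 (by simp)]
      simp
  rw [H₁, H₃, hsub, Fin.val_castSucc, Fin.val_succ, h1, h2]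
  ring

end Algebra

variable {n : ℕ} {M : Type*} [TopologicalSpace M] [ChartedSpace (EuclideanSpace ℝ (Fin n)) M]
  [IsManifold (𝓡 n) ∞ M] {W : Type*} [NormedAddCommGroup W] [NormedSpace ℝ W]
  {C : SuperConnection n M W} {g : SuperMetric n M W} {p : M}

/-- The alternation of the derivative of a tensor field. -/
def alternation {V₀ V₁ : Type*} [AddCommGroup V₀] [Module ℝ V₀] [AddCommGroup V₁] [Module ℝ V₁]
    {r : ℕ} (L : V₀ →ₗ[ℝ] SuperTensor V₀ V₁ r) : SuperTensor V₀ V₁ (r + 1) :=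
  ∑ i : Fin (r + 1), (-1 : ℝ) ^ (i : ℕ) • LinearMap.uncurryMid i (L ∘ₗ LinearMap.fst ℝ V₀ V₁)

theorem alternation_apply {V₀ V₁ : Type*} [AddCommGroup V₀] [Module ℝ V₀] [AddCommGroup V₁]
    [Module ℝ V₁] {r : ℕ} (L : V₀ →ₗ[ℝ] SuperTensor V₀ V₁ r) (v : Fin (r + 1) → V₀ × V₁) :
    alternation L v = ∑ i : Fin (r + 1), (-1 : ℝ) ^ (i : ℕ) * L (v i).1 (i.removeNth v) := by
  unfold alternation
  rw [sum_apply]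
  rfl

theorem SuperConnection.flat_parity {a : Fin 2} {X : SuperField n M W} {U : Set M} (hU : IsOpen U)
    (hp : p ∈ U) (hX : SmoothFieldOn X U) (h : ∀ q ∈ U, HasParity a (X q))
    (v : TangentSpace (𝓡 n) p) : HasParity a (C.flat X p v) := by
  have hXn : SmoothFieldNear X p := ⟨U, hU, hp, hX⟩
  rcases parity_cases a with rfl | rfl
  · have := SuperConnection.flat_congr (C := C) hXn.evenPart (Y := X)
      (eventually_of_mem (hU.mem_nhds hp) fun q hq => (evenPart_of_even (h q hq)).symm)
    rw [this, SuperConnection.flat_evenPart]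
    exact hasParity_evenPart _
  · have := SuperConnection.flat_congr (C := C) hXn.oddPart (Y := X)
      (eventually_of_mem (hU.mem_nhds hp) fun q hq => (oddPart_of_odd (h q hq)).symm)
    rw [this, SuperConnection.flat_oddPart]
    exact hasParity_oddPart _

/-- The product rule splits every `X_i(φ(…))` into a value of `L` and terms with a flat derivative
in one slot. The former are the alternation; the latter sum to minus the bracket terms, because the
super bracket is the antisymmetrized flat derivative. -/
theorem HasTensorDeriv.isExtDerivAt [FiniteDimensional ℝ W] (hC : C.IsTorsionFree)
    (P : ParallelFrame C g p) {r : ℕ} {φ : SuperTensorField n M W r}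
    {L : TangentSpace (𝓡 n) p →ₗ[ℝ] SuperTensor (TangentSpace (𝓡 n) p) W r}
    (h : HasTensorDeriv C φ p L) (hφ : IsSuperAlternating (φ p)) :
    IsExtDerivAt φ p (alternation L) := by
  intro U hU hp ε X hX hε
  have hXn : ∀ i, SmoothFieldNear (X i) p := fun i => ⟨U, hU, hp, hX i⟩
  have h1 : extDerivSumAct φ ε X p = ∑ i : Fin (r + 1), (-1 : ℝ) ^ (i : ℕ) *
      (L (X i p).1 (i.removeNth fun a => X a p) + ∑ j : Fin r, φ p (Function.update
        (i.removeNth fun a => X a p) j (C.flat (X (i.succAbove j)) p (X i p).1))) := by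
    refine Finset.sum_congr rfl fun i _ => ?_
    have h2 := (h.hasDerivAlong P (X := i.removeNth X) (fun j => hXn _) (X i p).1).2
    rw [show act (fun q => φ q (i.removeNth fun a => X a q)) p (X i p) = _ from h2]
    -- An odd field annihilates functions, so its Koszul sign is irrelevant; for an even field the
    -- sign is absent.
    rcases parity_cases (ε i) with h0 | h0
    · rw [h0, Fin.val_zero, zero_mul, add_zero]; rfl
    · have : (X i p).1 = 0 := by simpa [h0, hasParity_one_iff] using hε i p hp
      simp only [this, map_zero, MultilinearMap.map_update_zero, Finset.sum_const_zero, add_zero]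
      simp
  rw [h1]
  simp only [mul_add, Finset.sum_add_distrib, Finset.mul_sum]
  rw [alternation_apply, add_assoc, left_eq_add]
  rcases r with _ | r
  · simp [extDerivSumBracket]
  · rw [hφ.sum_update_eq (x := fun a => X a p) (ε := ε) (fun i => hε i p hp)
      (N := fun i j => C.flat (X j) p (X i p).1)
      (fun i j => SuperConnection.flat_parity hU hp (hX j) (hε j) _) (fun i j h0 => by
        have : (X i p).1 = 0 := by simpa [h0, hasParity_one_iff] using hε i p hp
        rw [this, map_zero])]
    simp only [extDerivSumBracket, hC.superBracket_eq (hXn _) (hXn _)]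
    exact neg_add_cancel _

/-- Every homogeneous tuple at `p` extends to homogeneous fields on a neighbourhood, so the formula
determines the tensor and the choice in the definition of `d` is harmless. -/
theorem IsExtDerivAt.unique (P : ParallelFrame C g p) {r : ℕ} {φ : SuperTensorField n M W r}
    {D D' : SuperTensor (TangentSpace (𝓡 n) p) W (r + 1)} (h : IsExtDerivAt φ p D)
    (h' : IsExtDerivAt φ p D') : D = D' := by
  refine superTensor_ext_homogeneous fun w ε hw => ?_
  have h1 := h P.U P.isOpen P.mem ε (fun i => P.extend (w i))
    (fun i => P.smoothFieldOn_extend _) (fun i q _ => P.hasParity_extend (hw i) q)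
  have h2 := h' P.U P.isOpen P.mem ε (fun i => P.extend (w i))
    (fun i => P.smoothFieldOn_extend _) (fun i q _ => P.hasParity_extend (hw i) q)
  simp only [P.extend_apply_self] at h1 h2
  rw [h1, h2]

theorem HasTensorDeriv.superExtDeriv_eq [FiniteDimensional ℝ W] (hC : C.IsTorsionFree)
    (P : ParallelFrame C g p) {r : ℕ} {φ : SuperTensorField n M W r}
    {L : TangentSpace (𝓡 n) p →ₗ[ℝ] SuperTensor (TangentSpace (𝓡 n) p) W r}
    (h : HasTensorDeriv C φ p L) (hφ : IsSuperAlternating (φ p)) :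
    superExtDeriv φ p = alternation L := by
  have hex : ∃ D, IsExtDerivAt φ p D := ⟨_, h.isExtDerivAt hC P hφ⟩
  unfold superExtDeriv
  rw [dif_pos hex]
  exact hex.choose_spec.unique P (h.isExtDerivAt hC P hφ)

end ExteriorDerivative

/-! ### The divergence as negative trace of the tensor derivative -/

section Divergence

open Filter Topology

section Algebra

variable {V₀ V₁ : Type*} [AddCommGroup V₀] [Module ℝ V₀] [AddCommGroup V₁] [Module ℝ V₁]

theorem IsSuperAlternating.smul {r : ℕ} {T : SuperTensor V₀ V₁ r} (hT : IsSuperAlternating T)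
    (c : ℝ) : IsSuperAlternating (c • T) := by
  intro v ε hv i j hij
  rw [smul_apply, smul_apply, hT v ε hv i j hij, smul_eq_mul, smul_eq_mul]
  ring

theorem isSuperAlternating_zero {r : ℕ} : IsSuperAlternating (0 : SuperTensor V₀ V₁ r) := by
  intro v ε hv i j hij
  simp

theorem IsSuperAlternating.sum {r : ℕ} {ι : Type*} (s : Finset ι) {T : ι → SuperTensor V₀ V₁ r}
    (hT : ∀ a ∈ s, IsSuperAlternating (T a)) : IsSuperAlternating (∑ a ∈ s, T a) := by
  intro v ε hv i j hij
  rw [sum_apply, sum_apply, Finset.mul_sum]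
  exact Finset.sum_congr rfl fun a ha => hT a ha v ε hv i j hij

theorem IsSuperAlternating.neg {r : ℕ} {T : SuperTensor V₀ V₁ r} (hT : IsSuperAlternating T) :
    IsSuperAlternating (-T) := by
  intro v ε hv i j hij
  rw [neg_apply, neg_apply, hT v ε hv i j hij, mul_neg]

/-- More even arguments than the even dimension. -/
theorem IsSuperAlternating.eq_zero_of_finrank_lt [FiniteDimensional ℝ V₀] {r k l : ℕ}
    {T : SuperTensor V₀ V₁ r} (hT : IsSuperAlternating T) (hr : r = k + l)
    (hk : Module.finrank ℝ V₀ < k) {v : Fin r → V₀ × V₁}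
    (hv : ∀ x : Fin r, HasParity (if (x : ℕ) < k then 0 else 1) (v x)) : T v = 0 := by
  subst hr
  have hy : ∀ i, HasParity 1 (v (Fin.natAdd k i)) := fun i => by
    simpa using hv (Fin.natAdd k i)
  have h := AlternatingMap.map_linearDependent (evenSlots T hT _ hy)
    (fun i => (v (Fin.castAdd l i)).1) (fun hli => by
      have := hli.fintype_card_le_finrank
      simp at this
      omega)
  rw [← h]
  change T v = T (Fin.append (fun i => ((v (Fin.castAdd l i)).1, (0 : V₁))) _)
  congr 1
  funext i
  refine Fin.addCases (fun i => ?_) (fun i => ?_) i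
  · have := hv (Fin.castAdd l i)
    simp only [Fin.val_castAdd, Fin.is_lt, if_true] at this
    rw [Fin.append_left]
    exact Prod.ext rfl (hasParity_zero_iff.1 this)
  · simp

theorem removeNth_comp_swap {α : Type*} {r : ℕ} {i j a : Fin (r + 2)} (hi : i ≠ a) (hj : j ≠ a)
    (hij : (i : ℕ) + 1 = j) (v : Fin (r + 2) → α) :
    ∃ i' j' : Fin (r + 1), a.succAbove i' = i ∧ a.succAbove j' = j ∧ (i' : ℕ) + 1 = j' ∧
      a.removeNth (v ∘ Equiv.swap i j) = a.removeNth v ∘ Equiv.swap i' j' := by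
  obtain ⟨i', rfl⟩ := Fin.exists_succAbove_eq hi
  obtain ⟨j', rfl⟩ := Fin.exists_succAbove_eq hj
  refine ⟨i', j', rfl, rfl, ?_, ?_⟩
  · simp only [Fin.succAbove, Fin.lt_def] at hij
    split_ifs at hij <;> simp at * <;> omega
  · funext x
    simp only [Fin.removeNth, Function.comp_apply]
    rw [Fin.succAbove_right_injective.swap_apply]

/-- The alternation of super alternating tensors is super alternating. -/
theorem isSuperAlternating_alternation {r : ℕ} {L : V₀ →ₗ[ℝ] SuperTensor V₀ V₁ r}
    (hL : ∀ v, IsSuperAlternating (L v)) : IsSuperAlternating (alternation L) := by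
  intro v ε hv i j hij
  rcases r with _ | r
  · omega
  obtain ⟨i, rfl⟩ : ∃ i' : Fin (r + 1), i = i'.castSucc :=
    ⟨i.castPred (by rintro rfl; simp at hij; omega), by simp⟩
  obtain rfl : j = i.succ := by ext; simp [← hij]
  rw [alternation_apply, alternation_apply,
    ← Finset.add_sum_erase _ _ (Finset.mem_univ i.castSucc),
    ← Finset.add_sum_erase _ _ (Finset.mem_erase.2 ⟨(Fin.castSucc_lt_succ (i := i)).ne', Finset.mem_univ i.succ⟩),
    ← Finset.add_sum_erase _ _ (Finset.mem_univ i.castSucc),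
    ← Finset.add_sum_erase _ _ (Finset.mem_erase.2 ⟨(Fin.castSucc_lt_succ (i := i)).ne', Finset.mem_univ i.succ⟩),
    mul_add, mul_add, ← add_assoc, ← add_assoc]
  -- The summands for the two exchanged places are interchanged with opposite signs, and both vanish
  -- if the two arguments are odd. In every other summand the exchange takes place inside `L`.
  congr 1
  · have h1 := removeNth_swap i v
    have h2 := removeNth_swap i (v ∘ Equiv.swap i.castSucc i.succ)
    rw [Function.comp_assoc, ← Equiv.coe_trans, Equiv.swap_swap] at h2
    rw [h1, ← h2, Function.comp_apply, Function.comp_apply, Equiv.swap_apply_left,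
      Equiv.swap_apply_right, Fin.val_castSucc, Fin.val_succ]
    change _ = -(-1) ^ ((ε i.castSucc : ℕ) * (ε i.succ : ℕ)) * ((-1) ^ (i : ℕ) * _) +
      -(-1) ^ ((ε i.castSucc : ℕ) * (ε i.succ : ℕ)) *
        ((-1) ^ ((i : ℕ) + 1) * L (v i.castSucc).1 (i.castSucc.removeNth v))
    have h3 : ∀ a, ε a = 1 → (v a).1 = 0 := fun a ha => by
      simpa [ha, hasParity_one_iff] using hv a
    rcases parity_cases (ε i.castSucc) with h0 | h0
    · rw [h0, Fin.val_zero, zero_mul]; ring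
    rcases parity_cases (ε i.succ) with h0' | h0'
    · rw [h0', Fin.val_zero, mul_zero]; ring
    · rw [h3 _ h0, h3 _ h0', map_zero]
      simp
  · rw [Finset.mul_sum]
    refine Finset.sum_congr rfl fun a ha => ?_
    simp only [Finset.mem_erase] at ha
    obtain ⟨i', j', hi', hj', hij', h⟩ := removeNth_comp_swap (a := a) (Ne.symm ha.2.1)
      (Ne.symm ha.1) hij v
    rw [h, Function.comp_apply, Equiv.swap_apply_of_ne_of_ne ha.2.1 ha.1,
      hL _ (a.removeNth v) (a.removeNth ε) (fun x => hv _) i' j' hij']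
    simp only [Fin.removeNth, hi', hj']
    ring

end Algebra

variable {n : ℕ} {M : Type*} [TopologicalSpace M] [ChartedSpace (EuclideanSpace ℝ (Fin n)) M]
  [IsManifold (𝓡 n) ∞ M] {W : Type*} [NormedAddCommGroup W] [NormedSpace ℝ W]
  {C : SuperConnection n M W} {g : SuperMetric n M W} {p : M}

theorem isSuperAlternating_hodgeField (o : ManifoldOrientation n M) {r r' : ℕ} (k l j : ℕ)
    (hr : r = k + l) (hr' : r' = j + l) (hn : n = k + j) {η : SuperTensorField n M W r}
    (hη : IsSuperAlternating (η p)) :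
    IsSuperAlternating (hodgeField g o k l j hr hr' hn η p) :=
  isSuperAlternating_hodge (g.even_symm p) (g.even_nondegenerate p) _ _ _ _ _ _ _ hη

variable [FiniteDimensional ℝ W] {r : ℕ} {η : SuperTensorField n M W (r + 1)}
  {L : TangentSpace (𝓡 n) p →ₗ[ℝ] SuperTensor (TangentSpace (𝓡 n) p) W (r + 1)}

theorem HasTensorDeriv.superExtDeriv_hodgeField (hC : C.IsLeviCivita g) (P : ParallelFrame C g p)
    (o : ManifoldOrientation n M) (h : HasTensorDeriv C η p L) (hη : IsSuperAlternating (η p))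
    (k l j : ℕ) (hr : r + 1 = k + l) (hn : n = k + j) :
    superExtDeriv (SuperGeometry.hodgeField g o k l j hr rfl hn η) p = alternation
      (hodgeLinear (g.even_symm p) (g.even_nondegenerate p) (o.at_ p) k l j hr rfl hn ∘ₗ L) :=
  (h.hodgeField hC.2 P o k l j hr rfl hn).superExtDeriv_eq hC.1 P
    (isSuperAlternating_hodgeField o k l j hr rfl hn hη)

theorem HasTensorDeriv.isSuperAlternating_pairDivergence (hC : C.IsLeviCivita g)
    (P : ParallelFrame C g p) (o : ManifoldOrientation n M) (h : HasTensorDeriv C η p L)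
    (hη : ∀ q, IsSuperAlternating (η q)) (k l : ℕ) (hr : r + 1 = k + l) :
    IsSuperAlternating (pairDivergence g o k l hr η p) := by
  unfold pairDivergence
  split_ifs with hk
  · refine IsSuperAlternating.smul (isSuperAlternating_hodgeField o _ _ _ _ _ _ ?_) _
    rw [h.superExtDeriv_hodgeField hC P o (hη p)]
    exact isSuperAlternating_alternation fun v =>
      isSuperAlternating_hodge (g.even_symm p) (g.even_nondegenerate p) (o.at_ p) k l (n - k) hr rfl
        (by omega) (h.isSuperAlternating P hη v)
  · exact isSuperAlternating_zero

/-- The value of the divergence on a sorted tuple. -/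
theorem HasTensorDeriv.pairDivergence_apply (hC : C.IsLeviCivita g)
    (P : ParallelFrame C g p) (o : ManifoldOrientation n M) (h : HasTensorDeriv C η p L)
    (hη : ∀ q, IsSuperAlternating (η q)) {e : Module.Basis (Fin n) ℝ (TangentSpace (𝓡 n) p)}
    {e' : Fin n → TangentSpace (𝓡 n) p} (he : IsReciprocal (g.even p) e e') (k l : ℕ)
    (hr : r + 1 = (k + 1) + l) {w : Fin r → SuperTangent n M W p}
    (hw : ∀ x : Fin r, HasParity (if (x : ℕ) < k then 0 else 1) (w x)) :
    pairDivergence g o (k + 1) l hr η p w = - ∑ c, L (e c) (Fin.cons (e' c, 0) w) := by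
  by_cases hk : k + 1 ≤ n
  · unfold pairDivergence
    rw [dif_pos ⟨by omega, hk⟩, smul_apply]
    have key := hodge_exterior_hodge (g.even_symm p) (g.even_nondegenerate p) he (o.at_ p)
      (r := r) (k := k) (l := l) (j := n - (k + 1)) hr (by omega) (by omega) (by omega) (by omega) L
      (h.isSuperAlternating P hη) (alternation
      (hodgeLinear (g.even_symm p) (g.even_nondegenerate p) (o.at_ p) (k + 1) l (n - (k + 1)) hr rfl
        (by omega) ∘ₗ L)) (fun v => alternation_apply _ v) hw
    have hext := h.superExtDeriv_hodgeField hC P o (hη p) (k + 1) l (n - (k + 1)) hr (by omega)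
    unfold SuperGeometry.hodgeField at hext ⊢
    rw [hext]
    refine (congrArg (fun t => _ • t) key).trans ?_
    rw [smul_eq_mul, ← mul_assoc, SuperMetric.negIndex, ← pow_add]
    -- With `n = k + 1 + j` the total exponent is `(k+1)(k+2) + 2(k+2)j + 2s + 1`, and `(k+1)(k+2)`
    -- is even.
    have hodd : Odd (n * (k + 1 + 1) + sigNeg (LinearMap.BilinMap.toQuadraticMap (g.even p)) + 1 +
        ((k + 2) * (n - (k + 1)) + sigNeg (LinearMap.BilinMap.toQuadraticMap (g.even p)))) := by
      obtain ⟨j, rfl⟩ : ∃ j, n = k + 1 + j := ⟨n - (k + 1), by omega⟩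
      rw [Nat.add_sub_cancel_left]
      obtain ⟨m, hm⟩ := Nat.even_mul_succ_self (k + 1)
      refine ⟨m + (k + 2) * j + sigNeg (LinearMap.BilinMap.toQuadraticMap (g.even p)), ?_⟩
      have : (k + 1) * (k + 1 + 1) = m + m := hm
      linear_combination this
    rw [hodd.neg_one_pow, neg_one_mul]
  -- For `k + 1 > n` the left side is zero by definition, the right side because it has more even
  -- arguments than the dimension.
  · unfold pairDivergence
    rw [dif_neg (by omega)]
    rw [Finset.sum_eq_zero fun c _ => ?_]
    · simp
    · refine (h.isSuperAlternating P hη (e c)).eq_zero_of_finrank_lt (k := k + 1) hr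
        (by rw [finrank_tangentSpace]; omega) fun x => ?_
      refine Fin.cases ?_ (fun x => ?_) x
      · simp [hasParity_zero_iff]
      · simpa using hw x

/-- The outer Hodge operator produces tensors with exactly `k - 1` even arguments. -/
theorem pairDivergence_apply_of_ne (o : ManifoldOrientation n M) (k l κ : ℕ) (hκ : κ ≤ r)
    (hr : r + 1 = k + l) (hne : k ≠ κ + 1) {w : Fin r → SuperTangent n M W p}
    (hw : ∀ x : Fin r, HasParity (if (x : ℕ) < κ then 0 else 1) (w x)) :
    pairDivergence g o k l hr η p w = 0 := by
  unfold pairDivergence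
  split_ifs with hk
  · rw [smul_apply]
    unfold hodgeField
    have := hodge_apply_sorted_of_ne (g.even_nondegenerate p) (o.at_ p) (n - k + 1) l (k - 1)
      (r := n - k + l + 1) (r' := r) (by omega) (by omega) (by omega)
      (superExtDeriv (fun p => hodge (g.even p) (g.even_nondegenerate p) (o.at_ p) k l (n - k) hr rfl
        (by omega) (η p)) p) hκ hw (by omega)
    exact (congrArg (fun t => _ • t) this).trans (smul_zero _)
  · rfl

/-- The divergence is the negative trace of the flat derivative. -/
theorem HasTensorDeriv.divergence_eq (hC : C.IsLeviCivita g)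
    (P : ParallelFrame C g p) (o : ManifoldOrientation n M) (h : HasTensorDeriv C η p L)
    (hη : ∀ q, IsSuperAlternating (η q)) {e : Module.Basis (Fin n) ℝ (TangentSpace (𝓡 n) p)}
    {e' : Fin n → TangentSpace (𝓡 n) p} (he : IsReciprocal (g.even p) e e') :
    divergence g o η p = -∑ c, (L (e c)).curryLeft (e' c, 0) := by
  have hS : IsSuperAlternating (-∑ c, (L (e c)).curryLeft (e' c, (0 : W))) :=
    (IsSuperAlternating.sum _ fun c _ => (h.isSuperAlternating P hη (e c)).curryLeft (a := 0)
      (by simp [hasParity_zero_iff])).neg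
  have hT : IsSuperAlternating (divergence g o η p) :=
    IsSuperAlternating.sum _ fun k _ => h.isSuperAlternating_pairDivergence hC P o hη _ _ _
  refine IsSuperAlternating.ext_sorted hT hS fun w ε hw hε => ?_
  obtain ⟨κ, l, hr, hκ⟩ := exists_threshold hε
  have hw' : ∀ x : Fin r, HasParity (if (x : ℕ) < κ then 0 else 1) (w x) := fun x => by
    rw [← hκ]; exact hw x
  have hr' : κ + 1 < r + 1 + 1 := by omega
  unfold divergence
  -- The divergence removes one even argument, so on `κ` even arguments only the component with `κ +
  -- 1` of them is seen.
  rw [sum_apply, Finset.sum_eq_single (⟨κ + 1, hr'⟩ : Fin (r + 1 + 1))]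
  · rw [h.pairDivergence_apply hC P o hη he κ _ _ hw']
    change _ = -(∑ c, (L (e c)).curryLeft (e' c, (0 : W))) w
    rw [sum_apply]
    rfl
  · intro k _ hk
    exact pairDivergence_apply_of_ne o _ _ κ (by omega) _
      (fun h => hk (Fin.ext h)) hw'
  · simp

end Divergence

/-! ### The cancellation between `A` and `B` -/

section OddContraction

variable {V₀ V₁ : Type*} [AddCommGroup V₀] [Module ℝ V₀] [AddCommGroup V₁] [Module ℝ V₁]

theorem IsReciprocal.sum_right_smul {ι : Type*} [DecidableEq ι] [Fintype ι]
    {B : LinearMap.BilinForm ℝ V₀} {e : Module.Basis ι ℝ V₀} {e' : ι → V₀}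
    (h : IsReciprocal B e e') (x : V₀) : ∑ i, B (e' i) x • e i = x := by
  conv_rhs => rw [← e.sum_repr x]
  refine Finset.sum_congr rfl fun i _ => ?_
  congr 1
  conv_lhs => rw [← e.sum_repr x]
  simp [-Module.Basis.sum_repr, h.inner]

/-- The bilinear map given by the first argument and the one numbered `i + 1`. -/
def twoSlots {r : ℕ} (T : SuperTensor V₀ V₁ (r + 1)) (i : Fin r) (w : Fin r → V₀ × V₁) :
    V₀ × V₁ →ₗ[ℝ] V₀ × V₁ →ₗ[ℝ] ℝ :=
  LinearMap.mk₂ ℝ (fun x y => T (Fin.cons x (Function.update w i y)))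
    (fun x x' _ => T.cons_add _ x x') (fun c x _ => T.cons_smul _ c x)
    (fun x y y' => (T.curryLeft x).map_update_add w i y y')
    (fun c x y => (T.curryLeft x).map_update_smul w i c y)

theorem twoSlots_apply {r : ℕ} (T : SuperTensor V₀ V₁ (r + 1)) (i : Fin r) (w : Fin r → V₀ × V₁)
    (x y : V₀ × V₁) : twoSlots T i w x y = T (Fin.cons x (Function.update w i y)) := rfl

theorem IsSuperAlternating.twoSlots_eq {r : ℕ} {T : SuperTensor V₀ V₁ (r + 2)}
    (hT : IsSuperAlternating T) {w : Fin (r + 1) → V₀ × V₁} {ε : Fin (r + 1) → Fin 2}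
    (hw : ∀ a, HasParity (ε a) (w a)) (i : Fin (r + 1)) {x y : V₀ × V₁} {a b : Fin 2}
    (hx : HasParity a x) (hy : HasParity b y) :
    twoSlots T i w x y = (-1) ^ ((i : ℕ) + (b : ℕ) * ∑ c ∈ Finset.Iio i, (ε c : ℕ)) *
      T (Fin.cons x (Fin.cons y (i.removeNth w))) := by
  have h := (hT.curryLeft hx).apply_eq_cons i (Function.update w i y) (Function.update ε i b)
    (fun c => by
      by_cases hc : c = i
      · subst hc; simpa using hy
      · simpa [hc] using hw c)
  rw [twoSlots_apply]
  refine h.trans ?_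
  simp only [Function.update_self, Fin.removeNth_update, MultilinearMap.curryLeft_apply]
  congr 4
  exact Finset.sum_congr rfl fun c hc => by
    rw [Function.update_of_ne (Finset.mem_Iio.1 hc).ne]

/-- Exchanging the two slots. -/
theorem IsSuperAlternating.twoSlots_swap {r : ℕ} {T : SuperTensor V₀ V₁ (r + 1)}
    (hT : IsSuperAlternating T) {w : Fin r → V₀ × V₁} {ε : Fin r → Fin 2}
    (hw : ∀ a, HasParity (ε a) (w a)) (i : Fin r) {x y : V₀ × V₁} {a b : Fin 2}
    (hx : HasParity a x) (hy : HasParity b y) :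
    twoSlots T i w x y = -(-1) ^ ((a : ℕ) * (b : ℕ) +
      ((a : ℕ) + (b : ℕ)) * ∑ c ∈ Finset.Iio i, (ε c : ℕ)) * twoSlots T i w y x := by
  rcases r with _ | r
  · exact i.elim0
  rw [hT.twoSlots_eq hw i hx hy, hT.twoSlots_eq hw i hy hx,
    hT.swap_front hx hy (v := i.removeNth w) (ε := i.removeNth ε) (fun c => hw _)]
  have h1 : ∀ m : ℕ, ((-1 : ℝ) ^ m) * (-1) ^ m = 1 := fun m => by rw [← mul_pow]; simp
  have h2 := h1 ((a : ℕ) * ∑ c ∈ Finset.Iio i, (ε c : ℕ))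
  simp only [pow_add, add_mul]
  linear_combination (-(-1 : ℝ) ^ (i : ℕ) * (-1) ^ ((b : ℕ) * ∑ c ∈ Finset.Iio i, (ε c : ℕ)) *
    (-1) ^ ((a : ℕ) * (b : ℕ)) * T (Fin.cons y (Fin.cons x (i.removeNth w)))) * -h2

/-- The contraction identity behind the odd part of the divergence formula. -/
theorem IsSuperAlternating.sum_odd_contraction {r m n : ℕ} {T : SuperTensor V₀ V₁ (r + 1)}
    (hT : IsSuperAlternating T) {w : Fin r → V₀ × V₁} {ε : Fin r → Fin 2}
    (hw : ∀ a, HasParity (ε a) (w a)) (i : Fin r) {g : LinearMap.BilinForm ℝ V₀}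
    {σ : LinearMap.BilinForm ℝ V₁} (hσ : σ.IsAlt) {e e' : Fin n → V₀} {α α' : Fin m → V₁}
    (he : ∀ x, ∑ c, g x (e c) • e' c = x) (hα : ∀ x, ∑ j, σ (α' j) x • α j = x)
    {A : V₀ →ₗ[ℝ] V₁ →ₗ[ℝ] V₁} {B : V₁ →ₗ[ℝ] V₁ →ₗ[ℝ] V₀}
    (hAB : ∀ u y x, g (B u y) x = σ y (A x u)) (hA : ∀ x u y, σ y (A x u) = σ (A x y) u) :
    ∑ j, (-1) ^ (∑ c ∈ Finset.Iio i, (ε c : ℕ)) *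
      twoSlots T i w (0, α j) (B (α' j) (w i).2, A (w i).1 (α' j)) =
    ∑ c, twoSlots T i w (e' c, 0) (0, A (e c) (w i).2) := by
  have hodd : ∀ x : V₁, HasParity 1 ((0, x) : V₀ × V₁) := fun x => by simp [hasParity_one_iff]
  have heven : ∀ x : V₀, HasParity 0 ((x, 0) : V₀ × V₁) := fun x => by simp [hasParity_zero_iff]
  rcases parity_cases (ε i) with h0 | h0
  -- Even slot: `T` is symmetric in the two odd vectors while `σ(α'_k, A α'_j)` is antisymmetric in
  -- `j, k`, so the left side is its own negative. The right side is zero since `w i` has no odd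
  -- part.
  · have hwi : (w i).2 = 0 := by simpa [h0, hasParity_zero_iff] using hw i
    have hF : ∀ x y : V₁, twoSlots T i w (0, x) (0, y) = twoSlots T i w (0, y) (0, x) :=
      fun x y => by
        rw [hT.twoSlots_swap hw i (hodd x) (hodd y)]
        simp only [Fin.val_one, pow_add, mul_one, pow_one]
        rw [show (1 + 1) * ∑ c ∈ Finset.Iio i, (ε c : ℕ) = 2 * ∑ c ∈ Finset.Iio i, (ε c : ℕ) by rfl,
          pow_mul]
        simp
    simp only [hwi, map_zero]
    have h1 : ∀ j, twoSlots T i w (0, α j) (0, A (w i).1 (α' j)) =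
        ∑ k, σ (α' k) (A (w i).1 (α' j)) * twoSlots T i w (0, α j) (0, α k) := fun j => by
      conv_lhs => rw [← hα (A (w i).1 (α' j))]
      rw [show ((0, ∑ k, σ (α' k) (A (w i).1 (α' j)) • α k) : V₀ × V₁) =
        ∑ k, σ (α' k) (A (w i).1 (α' j)) • (0, α k) by
          refine Prod.ext ?_ ?_ <;> simp [Prod.fst_sum, Prod.snd_sum], map_sum]
      exact Finset.sum_congr rfl fun k _ => by rw [map_smul, smul_eq_mul]
    have h2 : ∑ j, twoSlots T i w (0, α j) (0, A (w i).1 (α' j)) =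
        -∑ j, twoSlots T i w (0, α j) (0, A (w i).1 (α' j)) := by
      rw [Finset.sum_congr rfl fun j _ => h1 j]
      conv_lhs => rw [Finset.sum_comm]
      rw [← Finset.sum_neg_distrib]
      refine Finset.sum_congr rfl fun k _ => ?_
      rw [← Finset.sum_neg_distrib]
      refine Finset.sum_congr rfl fun j _ => ?_
      rw [hF, hA, ← hσ.neg_eq]
      ring
    have h3 : ∑ j, twoSlots T i w (0, α j) (0, A (w i).1 (α' j)) = 0 := by linarith
    rw [← Finset.mul_sum, h3, mul_zero]
    simp [show ((0, 0) : V₀ × V₁) = 0 from rfl]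
  -- Odd slot: `B(α'_j, w_i)` is expanded in `e'`, its coefficients are rewritten by the relations
  -- between `A` and `B` as `-σ(α'_j, A_{e_c} w_i)`, and the sum over `j` reassembles `A_{e_c} w_i`.
  -- Exchanging the slots absorbs the Koszul sign.
  · have hwi : (w i).1 = 0 := by simpa [h0, hasParity_one_iff] using hw i
    simp only [hwi, map_zero, LinearMap.zero_apply]
    have h1 : ∀ j, (-1) ^ (∑ c ∈ Finset.Iio i, (ε c : ℕ)) *
        twoSlots T i w (0, α j) (B (α' j) (w i).2, 0) =
        -∑ c, σ (w i).2 (A (e c) (α' j)) * twoSlots T i w (e' c, 0) (0, α j) := fun j => by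
      rw [hT.twoSlots_swap hw i (hodd _) (heven _)]
      simp only [Fin.val_one, Fin.val_zero, mul_zero, zero_add, add_zero, one_mul]
      have h1 : ((-1 : ℝ) ^ (∑ c ∈ Finset.Iio i, (ε c : ℕ))) *
        (-1) ^ (∑ c ∈ Finset.Iio i, (ε c : ℕ)) = 1 := by rw [← mul_pow]; simp
      rw [neg_mul, mul_neg, ← mul_assoc, h1, one_mul]
      congr 1
      conv_lhs => rw [← he (B (α' j) (w i).2)]
      rw [show ((∑ c, g (B (α' j) (w i).2) (e c) • e' c, 0) : V₀ × V₁) =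
        ∑ c, g (B (α' j) (w i).2) (e c) • (e' c, 0) by
          refine Prod.ext ?_ ?_ <;> simp [Prod.fst_sum, Prod.snd_sum], map_sum, LinearMap.sum_apply]
      refine Finset.sum_congr rfl fun c _ => ?_
      rw [map_smul, LinearMap.smul_apply, smul_eq_mul, hAB]
    rw [Finset.sum_congr rfl fun j _ => h1 j, Finset.sum_neg_distrib, Finset.sum_comm,
      ← Finset.sum_neg_distrib]
    refine Finset.sum_congr rfl fun c _ => ?_
    conv_rhs => rw [← hα (A (e c) (w i).2)]
    rw [show ((0, ∑ j, σ (α' j) (A (e c) (w i).2) • α j) : V₀ × V₁) =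
      ∑ j, σ (α' j) (A (e c) (w i).2) • (0, α j) by
        refine Prod.ext ?_ ?_ <;> simp [Prod.fst_sum, Prod.snd_sum], map_sum,
      ← Finset.sum_neg_distrib]
    refine Finset.sum_congr rfl fun j _ => ?_
    rw [map_smul, smul_eq_mul, hA, ← hσ.neg_eq]
    ring

end OddContraction

/-! ### Derivations acting on one slot, with Koszul signs -/

section SlotAction

variable {V₀ V₁ : Type*} [AddCommGroup V₀] [Module ℝ V₀] [AddCommGroup V₁] [Module ℝ V₁] {r : ℕ}

variable (V₀ V₁) in
/-- The parity automorphism, the identity on even and minus the identity on odd vectors. -/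
def parityAut : V₀ × V₁ →ₗ[ℝ] V₀ × V₁ := LinearMap.prodMap LinearMap.id (-LinearMap.id)

theorem parityAut_of_hasParity {a : Fin 2} {x : V₀ × V₁} (h : HasParity a x) :
    parityAut V₀ V₁ x = (-1 : ℝ) ^ (a : ℕ) • x := by
  rcases parity_cases a with rfl | rfl
  · rw [hasParity_zero_iff] at h
    exact Prod.ext (by simp [parityAut]) (by simp [parityAut, h])
  · rw [hasParity_one_iff] at h
    exact Prod.ext (by simp [parityAut, h]) (by simp [parityAut])

/-- Apply an endomorphism to the argument numbered `i`, and `S` to the arguments before it. -/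
def slotAction (T : SuperTensor V₀ V₁ r) (i : Fin r) (S : V₀ × V₁ →ₗ[ℝ] V₀ × V₁) :
    (V₀ × V₁ →ₗ[ℝ] V₀ × V₁) →ₗ[ℝ] SuperTensor V₀ V₁ r where
  toFun K := T.compLinearMap
    (Function.update (fun b => if b < i then S else LinearMap.id) i K)
  map_add' K K' := by
    ext w
    have h : ∀ K : V₀ × V₁ →ₗ[ℝ] V₀ × V₁, (fun b => Function.update
        (fun b => if b < i then S else LinearMap.id) i K b (w b)) =
        Function.update (fun b => (if b < i then S else LinearMap.id) (w b)) i (K (w i)) :=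
      fun K => by
        funext b
        by_cases hb : b = i
        · subst hb; simp
        · simp [hb]
    simp only [MultilinearMap.compLinearMap_apply, h, add_apply, MultilinearMap.map_update_add,
      LinearMap.add_apply]
  map_smul' c K := by
    ext w
    have h : ∀ K : V₀ × V₁ →ₗ[ℝ] V₀ × V₁, (fun b => Function.update
        (fun b => if b < i then S else LinearMap.id) i K b (w b)) =
        Function.update (fun b => (if b < i then S else LinearMap.id) (w b)) i (K (w i)) :=
      fun K => by
        funext b
        by_cases hb : b = i
        · subst hb; simp
        · simp [hb]
    simp only [MultilinearMap.compLinearMap_apply, h, smul_apply, MultilinearMap.map_update_smul,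
      LinearMap.smul_apply, RingHom.id_apply]

theorem slotAction_apply (T : SuperTensor V₀ V₁ r) (i : Fin r) (S K : V₀ × V₁ →ₗ[ℝ] V₀ × V₁)
    (w : Fin r → V₀ × V₁) : slotAction T i S K w =
      T (Function.update (fun b => (if b < i then S else LinearMap.id) (w b)) i (K (w i))) := by
  change T _ = T _
  congr 1
  funext b
  by_cases hb : b = i
  · subst hb; simp
  · simp [hb]

theorem slotAction_id (T : SuperTensor V₀ V₁ r) (i : Fin r) (K : V₀ × V₁ →ₗ[ℝ] V₀ × V₁)
    (w : Fin r → V₀ × V₁) :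
    slotAction T i LinearMap.id K w = T (Function.update w i (K (w i))) := by
  simp [slotAction_apply]

/-- A Koszul sign is defined only on homogeneous arguments. Acting by the parity automorphism on the
earlier slots produces the same sign by a map that is linear in all arguments. -/
theorem slotAction_parityAut (T : SuperTensor V₀ V₁ r) (i : Fin r) (K : V₀ × V₁ →ₗ[ℝ] V₀ × V₁)
    {w : Fin r → V₀ × V₁} {ε : Fin r → Fin 2} (hw : ∀ a, HasParity (ε a) (w a)) :
    slotAction T i (parityAut V₀ V₁) K w =
      (-1) ^ (∑ b ∈ Finset.Iio i, (ε b : ℕ)) * T (Function.update w i (K (w i))) := by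
  have h := T.map_piecewise_smul (fun b => (-1 : ℝ) ^ (ε b : ℕ)) (Function.update w i (K (w i)))
    (Finset.Iio i)
  rw [Finset.prod_pow_eq_pow_sum, smul_eq_mul] at h
  rw [slotAction_apply, ← h]
  congr 1
  funext b
  rcases eq_or_ne b i with rfl | hb
  · simp
  · by_cases hbi : b < i
    · simp [hb, hbi, parityAut_of_hasParity (hw b)]
    · simp [hb, hbi]

end SlotAction

/-! ### The covariant derivative of a tensor field -/

section CovariantDerivative

variable {n : ℕ} {M : Type*} [TopologicalSpace M] [ChartedSpace (EuclideanSpace ℝ (Fin n)) M]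
  [IsManifold (𝓡 n) ∞ M] {W : Type*} [NormedAddCommGroup W] [NormedSpace ℝ W]
  {C : SuperConnection n M W} {g : SuperMetric n M W} {p : M} {r : ℕ}
  {T : SuperTensorField n M W r}
  {L : TangentSpace (𝓡 n) p →ₗ[ℝ] SuperTensor (TangentSpace (𝓡 n) p) W r}
  {D D' : SuperTangent n M W p →ₗ[ℝ] SuperTensor (TangentSpace (𝓡 n) p) W r}

theorem IsCovDerivAt.unique (P : ParallelFrame C g p) (h : IsCovDerivAt C T p D)
    (h' : IsCovDerivAt C T p D') : D = D' := by
  have key : ∀ (v : SuperTangent n M W p) (a : Fin 2), HasParity a v → D v = D' v := by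
    intro v a hv
    refine superTensor_ext_homogeneous fun w ε hw => ?_
    have h1 := h P.U P.isOpen P.mem v a hv ε (fun i => P.extend (w i))
      (fun i => P.smoothFieldOn_extend _) fun i q _ => P.hasParity_extend (hw i) q
    rw [h' P.U P.isOpen P.mem v a hv ε (fun i => P.extend (w i))
      (fun i => P.smoothFieldOn_extend _) fun i q _ => P.hasParity_extend (hw i) q] at h1
    simp only [P.extend_apply_self] at h1
    exact (add_right_cancel h1).symm
  refine LinearMap.ext fun v => ?_
  rw [← evenPart_add_oddPart v, map_add, map_add, key _ 0 (hasParity_evenPart v),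
    key _ 1 (hasParity_oddPart v)]

variable (C) in
/-- The endomorphism `(w₀, w₁) ↦ ∇_v w₁`, for an even `v`. -/
def SuperConnection.evenEnd (p : M) :
    TangentSpace (𝓡 n) p →ₗ[ℝ] SuperTangent n M W p →ₗ[ℝ] SuperTangent n M W p :=
  LinearMap.mk₂ ℝ (fun v x => (0, C.mixed p v x.2)) (fun v v' x => by simp) (fun c v x => by simp)
    (fun v x x' => by simp) (fun c v x => by simp)

variable (C) in
/-- The endomorphism `∇_u`, for an odd `u`, as a linear function of `u`. -/
def SuperConnection.oddEndLinear (p : M) :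
    W →ₗ[ℝ] SuperTangent n M W p →ₗ[ℝ] SuperTangent n M W p :=
  LinearMap.mk₂ ℝ (fun u x => C.oddEnd p u x)
    (fun v v' x => by simp [SuperConnection.oddEnd_apply])
    (fun c v x => by simp [SuperConnection.oddEnd_apply])
    (fun v x x' => by simp) (fun c v x => by simp)

variable (C) in
/-- The covariant derivative of a tensor field with value `T` and derivative `L` at `p`. -/
def SuperConnection.covValue (T : SuperTensor (TangentSpace (𝓡 n) p) W r)
    (L : TangentSpace (𝓡 n) p →ₗ[ℝ] SuperTensor (TangentSpace (𝓡 n) p) W r) :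
    SuperTangent n M W p →ₗ[ℝ] SuperTensor (TangentSpace (𝓡 n) p) W r :=
  (L - ∑ i, slotAction T i LinearMap.id ∘ₗ C.evenEnd p) ∘ₗ LinearMap.fst ℝ _ _ -
    (∑ i, slotAction (firstParitySign 1 T) i (parityAut _ _) ∘ₗ C.oddEndLinear p) ∘ₗ
      LinearMap.snd ℝ _ _

theorem SuperConnection.covValue_even (T : SuperTensor (TangentSpace (𝓡 n) p) W r)
    (L : TangentSpace (𝓡 n) p →ₗ[ℝ] SuperTensor (TangentSpace (𝓡 n) p) W r)
    (v : TangentSpace (𝓡 n) p) (w : Fin r → SuperTangent n M W p) :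
    C.covValue T L (v, 0) w =
      L v w - ∑ i, T (Function.update w i (0, C.mixed p v (w i).2)) := by
  simp only [SuperConnection.covValue, LinearMap.sub_apply, LinearMap.comp_apply,
    LinearMap.fst_apply, LinearMap.snd_apply, LinearMap.sum_apply, map_zero,
    sub_zero, sub_apply, sum_apply, slotAction_id]
  rfl

theorem SuperConnection.covValue_odd (T : SuperTensor (TangentSpace (𝓡 n) p) W r)
    (L : TangentSpace (𝓡 n) p →ₗ[ℝ] SuperTensor (TangentSpace (𝓡 n) p) W r)
    (u : W) {w : Fin r → SuperTangent n M W p} {ε : Fin r → Fin 2}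
    (hw : ∀ a, HasParity (ε a) (w a)) :
    C.covValue T L (0, u) w = -∑ i, (-1) ^ (∑ b ∈ Finset.Iio i, (ε b : ℕ)) *
      firstParitySign 1 T (Function.update w i (C.oddEnd p u (w i))) := by
  simp only [SuperConnection.covValue, LinearMap.sub_apply, LinearMap.comp_apply,
    LinearMap.fst_apply, LinearMap.snd_apply, LinearMap.sum_apply, map_zero,
    zero_sub, neg_apply, sum_apply, slotAction_parityAut _ _ _ hw]
  rfl

/-- In even directions `∇` differs from the flat derivative by `A` in each slot. In odd directions
the left side is zero and every `∇_u X_i` depends only on the value of `X_i` at `p`. -/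
theorem HasTensorDeriv.isCovDerivAt [FiniteDimensional ℝ W] (h : HasTensorDeriv C T p L)
    (hC : C.IsTorsionFree) (P : ParallelFrame C g p) : IsCovDerivAt C T p (C.covValue (T p) L) := by
  intro U hU hp v a hv ε X hX hXε
  have hX' : ∀ i, SmoothFieldNear (X i) p := fun i => (hX i).smoothFieldNear hU hp
  rcases parity_cases a with rfl | rfl
  · obtain ⟨v, u⟩ := v
    obtain rfl : u = 0 := by simpa [hasParity_zero_iff] using hv
    have h1 : act (fun q => T q fun i => X i q) p (v, (0 : W)) = _ := (h.hasDerivAlong P hX' v).2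
    rw [h1, SuperConnection.covValue_even, sub_add, sub_eq_add_neg, add_right_inj, neg_sub,
      ← Finset.sum_sub_distrib]
    refine Finset.sum_congr rfl fun i _ => ?_
    rw [SuperConnection.cov_even (hX' i), MultilinearMap.map_update_add]
    simp [firstParitySign]
  · obtain ⟨v, u⟩ := v
    obtain rfl : v = 0 := by simpa [hasParity_one_iff] using hv
    have h0 : act (fun q => T q fun i => X i q) p ((0, u) : SuperTangent n M W p) = 0 :=
      map_zero (mfderiv (𝓡 n) 𝓘(ℝ, ℝ) (fun q => T q fun i => X i q) p)
    rw [h0, SuperConnection.covValue_odd _ _ _ fun i => hXε i p hp]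
    simp only [hC.cov_odd (hX' _), Fin.val_one, one_mul]
    exact (neg_add_cancel _).symm

theorem HasTensorDeriv.covTensor_eq [FiniteDimensional ℝ W] (h : HasTensorDeriv C T p L)
    (hC : C.IsTorsionFree) (P : ParallelFrame C g p) (v : SuperTangent n M W p) :
    C.covTensor T p v = C.covValue (T p) L v := by
  have hex : ∃ D, IsCovDerivAt C T p D := ⟨_, h.isCovDerivAt hC P⟩
  rw [SuperConnection.covTensor, dif_pos hex]
  exact LinearMap.congr_fun (hex.choose_spec.unique P (h.isCovDerivAt hC P)) v

end CovariantDerivative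

/-! ### Insertion of homogeneous vectors -/

section Insertion

variable {V₀ V₁ : Type*} [AddCommGroup V₀] [Module ℝ V₀] [AddCommGroup V₁] [Module ℝ V₁] {r : ℕ}

theorem insertion_of_even {x : V₀ × V₁} (hx : HasParity 0 x) (T : SuperTensor V₀ V₁ (r + 1)) :
    insertion x T = T.curryLeft x := by
  change T.curryLeft (evenPart x) + (firstParitySign 1 T).curryLeft (oddPart x) = _
  rw [evenPart_of_even hx, oddPart_of_even hx, map_zero, add_zero]

/-- Inserting an odd vector leaves the number of even arguments unchanged. The sign in the insertion
is therefore the sign applied afterwards, and the two cancel. -/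
theorem firstParitySign_one_insertion {x : V₀ × V₁} (hx : HasParity 1 x)
    (T : SuperTensor V₀ V₁ (r + 1)) : firstParitySign 1 (insertion x T) = T.curryLeft x := by
  have h : insertion x T = (firstParitySign 1 T).curryLeft x := by
    change T.curryLeft (evenPart x) + (firstParitySign 1 T).curryLeft (oddPart x) = _
    rw [evenPart_of_odd hx, oddPart_of_odd hx, map_zero, zero_add]
  ext w
  rw [h]
  change T _ = T _
  congr 1
  funext i
  refine Fin.cases ?_ (fun i => ?_) i
  · rw [hasParity_one_iff] at hx
    exact Prod.ext (by simp [hx]) (by simp)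
  · exact Prod.ext (by simp) (by simp)

end Insertion

/-! ### Comparison with the Levi-Civita super connection -/

section DivergenceFormula

open Filter Topology

variable {n : ℕ} {M : Type*} [TopologicalSpace M] [ChartedSpace (EuclideanSpace ℝ (Fin n)) M]
  [IsManifold (𝓡 n) ∞ M] {W : Type*} [NormedAddCommGroup W] [NormedSpace ℝ W]
  {C : SuperConnection n M W} {g : SuperMetric n M W} {p : M} {r : ℕ}

/-- The parity sign can be absorbed by reversing the even parts of the arguments, so the insertion
is a sum of two values of `η` on smooth fields. -/
theorem IsDifferentiableAt.insertion {η : SuperTensorField n M W (r + 1)}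
    (h : IsDifferentiableAt η p) {X : SuperField n M W} (hX : SmoothFieldNear X p) :
    IsDifferentiableAt (r := r) (fun q => SuperGeometry.insertion (X q) (η q)) p := by
  intro Y hY
  have h1 := h (Fin.cons (fun q => evenPart (X q)) Y) fun i => by
    refine Fin.cases ?_ (fun i => ?_) i
    · exact hX.evenPart
    · exact hY i
  have h2 := h (Fin.cons (fun q => oddPart (X q))
      (fun i q => oddPart (Y i q) + (-1 : ℝ) • evenPart (Y i q))) fun i => by
    refine Fin.cases ?_ (fun i => ?_) i
    · exact hX.oddPart
    · exact (hY i).oddPart.add ((hY i).evenPart.const_smul _)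
  convert! h1.add h2 using 1
  funext q
  change η q _ + η q _ = η q _ + η q _
  congr 2
  · funext i
    refine Fin.cases ?_ (fun i => ?_) i <;> rfl
  · funext i
    refine Fin.cases ?_ (fun i => ?_) i
    · refine Prod.ext ?_ ?_ <;> simp [oddPart_apply]
    · refine Prod.ext ?_ ?_ <;> simp [oddPart_apply, evenPart_apply]

theorem SuperConnection.covTensor_zero [FiniteDimensional ℝ W] (hC : C.IsTorsionFree)
    (P : ParallelFrame C g p) (v : SuperTangent n M W p) :
    C.covTensor (fun _ => 0 : SuperTensorField n M W r) p v = 0 := by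
  have h : HasTensorDeriv C (fun _ => 0 : SuperTensorField n M W r) p 0 := fun v X _ =>
    hasDerivAlong_const 0
  rw [h.covTensor_eq hC P]
  ext w
  simp [SuperConnection.covValue, slotAction_apply, firstParitySign]

variable {η : SuperTensorField n M W (r + 1)}
  {L : TangentSpace (𝓡 n) p →ₗ[ℝ] SuperTensor (TangentSpace (𝓡 n) p) W (r + 1)}

theorem HasTensorDeriv.covTensor_cons_even [FiniteDimensional ℝ W] (h : HasTensorDeriv C η p L)
    (hC : C.IsTorsionFree) (P : ParallelFrame C g p) (v x : TangentSpace (𝓡 n) p)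
    (w : Fin r → SuperTangent n M W p) :
    C.covTensor η p (v, 0) (Fin.cons (x, 0) w) = L v (Fin.cons (x, 0) w) -
      ∑ i, twoSlots (η p) i w (x, 0) (0, C.mixed p v (w i).2) := by
  rw [h.covTensor_eq hC P, SuperConnection.covValue_even, Fin.sum_univ_succ]
  -- The inserted vector is even and `A` acts on odd components only, so the first slot needs no
  -- correction.
  have h0 : η p (Function.update (Fin.cons (x, 0) w) 0
      (0, C.mixed p v ((Fin.cons (x, 0) w : Fin (r + 1) → SuperTangent n M W p) 0).2)) = 0 :=
    (η p).map_coord_zero 0 (by simp)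
  rw [h0, zero_add]
  simp only [Fin.cons_succ, Fin.cons_update, twoSlots_apply]

/-- In an odd direction neither `η` nor the inserted field is differentiated: only their values at
`p` enter, and the sign of the insertion cancels against that of the covariant derivative. -/
theorem HasTensorDeriv.covTensor_insertion_odd [FiniteDimensional ℝ W]
    (h : IsDifferentiableAt η p) (hC : C.IsTorsionFree) (P : ParallelFrame C g p)
    {X : SuperField n M W} (hX : SmoothFieldNear X p) (hXp : HasParity 1 (X p)) (u : W)
    {w : Fin r → SuperTangent n M W p} {ε : Fin r → Fin 2} (hw : ∀ a, HasParity (ε a) (w a)) :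
    C.covTensor (r := r) (fun q => insertion (X q) (η q)) p (0, u) w =
      -∑ i, (-1) ^ (∑ b ∈ Finset.Iio i, (ε b : ℕ)) *
        twoSlots (η p) i w (X p) (C.oddOdd p u (w i).2, C.mixed p (w i).1 u) := by
  obtain ⟨K, hK⟩ := (h.insertion hX).exists_hasTensorDeriv P
  rw [hK.covTensor_eq hC P, SuperConnection.covValue_odd _ _ _ hw,
    firstParitySign_one_insertion hXp]
  rfl

theorem SuperConnection.IsLeviCivita.sum_odd_contraction [FiniteDimensional ℝ W]
    (hC : C.IsLeviCivita g) (P : ParallelFrame C g p) {m : ℕ}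
    {e : Module.Basis (Fin n) ℝ (TangentSpace (𝓡 n) p)} {e' : Fin n → TangentSpace (𝓡 n) p}
    (he : IsReciprocal (g.even p) e e') {α : Module.Basis (Fin m) ℝ W} {α' : Fin m → W}
    (hα : IsReciprocal (g.odd p) α α') {T : SuperTensor (TangentSpace (𝓡 n) p) W (r + 1)}
    (hT : IsSuperAlternating T) {w : Fin r → SuperTangent n M W p} {ε : Fin r → Fin 2}
    (hw : ∀ a, HasParity (ε a) (w a)) (i : Fin r) :
    ∑ j, (-1) ^ (∑ b ∈ Finset.Iio i, (ε b : ℕ)) *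
      twoSlots T i w (0, α j) (C.oddOdd p (α' j) (w i).2, C.mixed p (w i).1 (α' j)) =
    ∑ c, twoSlots T i w (e' c, 0) (0, C.mixed p (e c) (w i).2) := by
  -- The relations between `A` and `B` come from smooth fields; the parallel extension realizes
  -- every tangent vector as the value of one.
  have hx : ∀ x : TangentSpace (𝓡 n) p, ∃ X : SuperField n M W, SmoothFieldNear X p ∧
      (X p).1 = x := fun x =>
    ⟨P.extend (x, 0), (P.isParallel_extend (x, 0) 0).smooth, by rw [P.extend_apply_self]⟩
  refine hT.sum_odd_contraction hw i (g := g.even p) (g.odd_alt p)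
    (he.sum_right (g.even_nondegenerate p)) hα.sum_right_smul (fun u y x => ?_) (fun x u y => ?_)
  · obtain ⟨X, hX, rfl⟩ := hx x
    exact hC.even_oddOdd hX u y
  · obtain ⟨X, hX, rfl⟩ := hx x
    exact hC.odd_mixed hX u y

theorem divergence_of_order_zero (g : SuperMetric n M W) (o : ManifoldOrientation n M)
    (η : SuperTensorField n M W 0) : divergence g o η p = 0 := by
  refine Finset.sum_eq_zero fun k _ => ?_
  rw [pairDivergence, dif_neg]
  omega

/-- The divergence as the contraction of the covariant derivative, at a point. -/
theorem SuperConnection.IsLeviCivita.divergence_eq [FiniteDimensional ℝ W]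
    (hC : C.IsLeviCivita g) (P : ParallelFrame C g p) (o : ManifoldOrientation n M)
    (hη : IsSuperForm η) {m : ℕ}
    {e : Module.Basis (Fin n) ℝ (TangentSpace (𝓡 n) p)} {e' : Fin n → TangentSpace (𝓡 n) p}
    (he : IsReciprocal (g.even p) e e') {β : Module.Basis (Fin m) ℝ W} {β' : Fin m → W}
    (hβ : IsReciprocal (g.odd p) β β') {α : Fin m → SuperField n M W}
    (hα : ∀ j, SmoothFieldNear (α j) p) (hαβ : ∀ j, α j p = (0, β j)) :
    divergence g o η p = -(∑ c, insertion (e' c, 0) (C.covTensor η p (e c, 0))) +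
      ∑ j, C.covTensor (fun q => insertion (α j q) (η q)) p (0, β' j) := by
  obtain ⟨L, hL⟩ := (hη.isDifferentiableAt p).exists_hasTensorDeriv P
  rw [hL.divergence_eq hC P o hη.alternating he]
  refine superTensor_ext_homogeneous (r := r) fun w ε hw => ?_
  have h1 : ∀ c, insertion (e' c, (0 : W)) (C.covTensor η p (e c, 0)) w =
      L (e c) (Fin.cons (e' c, 0) w) -
        ∑ i, twoSlots (η p) i w (e' c, 0) (0, C.mixed p (e c) (w i).2) := fun c => by
    rw [insertion_of_even (by simp [hasParity_zero_iff])]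
    exact hL.covTensor_cons_even hC.1 P _ _ w
  have h2 : ∀ j, C.covTensor (r := r) (fun q => insertion (α j q) (η q)) p (0, β' j) w =
      -∑ i, (-1) ^ (∑ b ∈ Finset.Iio i, (ε b : ℕ)) *
        twoSlots (η p) i w (0, β j) (C.oddOdd p (β' j) (w i).2, C.mixed p (w i).1 (β' j)) :=
    fun j => by
      rw [HasTensorDeriv.covTensor_insertion_odd (hη.isDifferentiableAt p) hC.1 P (hα j)
        (by simp [hasParity_one_iff, hαβ]) _ hw, hαβ]
  have h3 : ∑ j, ∑ i, (-1) ^ (∑ b ∈ Finset.Iio i, (ε b : ℕ)) *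
        twoSlots (η p) i w (0, β j) (C.oddOdd p (β' j) (w i).2, C.mixed p (w i).1 (β' j)) =
      ∑ c, ∑ i, twoSlots (η p) i w (e' c, 0) (0, C.mixed p (e c) (w i).2) := by
    rw [Finset.sum_comm, Finset.sum_congr rfl fun i _ =>
      hC.sum_odd_contraction P he hβ (hη.alternating p) hw i, Finset.sum_comm]
  have h4 : (-(∑ c, insertion (e' c, (0 : W)) (C.covTensor η p (e c, 0))) +
      ∑ j, C.covTensor (fun q => insertion (α j q) (η q)) p (0, β' j)) w =
      -(∑ c, insertion (e' c, (0 : W)) (C.covTensor η p (e c, 0)) w) +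
      ∑ j, C.covTensor (r := r) (fun q => insertion (α j q) (η q)) p (0, β' j) w := by
    change -((∑ c, insertion (e' c, (0 : W)) (C.covTensor η p (e c, 0)) :
        SuperTensor (TangentSpace (𝓡 n) p) W r) w) +
      (∑ j, C.covTensor (r := r) (fun q => insertion (α j q) (η q)) p (0, β' j)) w = _
    rw [sum_apply, sum_apply]
  have h5 : (-∑ c, (L (e c)).curryLeft (e' c, (0 : W))) w =
      -∑ c, L (e c) (Fin.cons (e' c, 0) w) := by
    rw [neg_apply, sum_apply]
    rfl
  rw [h4, h5, Finset.sum_congr rfl fun c _ => h1 c, Finset.sum_congr rfl fun j _ => h2 j,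
    Finset.sum_sub_distrib, Finset.sum_neg_distrib, h3]
  ring

end DivergenceFormula

end SuperGeometry

end

/-! ### The divergence formula -/

open SuperGeometry in
theorem mainTheorem6 {n : ℕ} {M : Type*} [TopologicalSpace M] [T2Space M]
    [ChartedSpace (EuclideanSpace ℝ (Fin n)) M] [IsManifold (𝓡 n) ∞ M]
    {W : Type*} [NormedAddCommGroup W] [NormedSpace ℝ W] [FiniteDimensional ℝ W]
    (g : SuperMetric n M W) (o : ManifoldOrientation n M)
    (C : SuperConnection n M W) (hC : C.IsLeviCivita g)
    {U : Set M} (hU : IsOpen U) {m : ℕ}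
    (E E' : Fin n → SuperField n M W) (α α' : Fin m → SuperField n M W)
    (hbase : IsHomogeneousBaseOn E α U) (hrec : IsReciprocalBaseOn g E E' α α' U)
    {r : ℕ} (η : SuperTensorField n M W r) (hη : IsSuperForm η) :
    ∀ p ∈ U,
      divergence g o η p =
        -(∑ i, insertion (E' i p) (C.covTensor η p (E i p))) +
          ∑ j, C.covTensor (fun q => insertion (α j q) (η q)) p (α' j p) := by
  intro p hp
  have hE0 : ∀ i, E i p = ((E i p).1, 0) := fun i =>
    Prod.ext rfl (hasParity_zero_iff.1 (hbase.even i p hp))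
  have hE0' : ∀ i, E' i p = ((E' i p).1, 0) := fun i =>
    Prod.ext rfl (hasParity_zero_iff.1 (hrec.even i p hp))
  have hα0 : ∀ j, α j p = (0, (α j p).2) := fun j =>
    Prod.ext (hasParity_one_iff.1 (hbase.odd j p hp)) rfl
  have hα0' : ∀ j, α' j p = (0, (α' j p).2) := fun j =>
    Prod.ext (hasParity_one_iff.1 (hrec.odd j p hp)) rfl
  have hEs : ∀ i, SmoothFieldNear (E i) p := fun i =>
    (hbase.smooth_even i).smoothFieldNear hU hp
  have hgE : ∀ i j, g.even p (E' j p).1 (E i p).1 = if i = j then 1 else 0 := fun i j => by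
    rw [← hrec.inner_even i j p hp, SuperMetric.inner, hE0 i]
    simp
  have hgα : ∀ i j, g.odd p (α' j p).2 (α i p).2 = if i = j then 1 else 0 := fun i j => by
    rw [← hrec.inner_odd i j p hp, SuperMetric.inner, hα0 i]
    simp
  obtain ⟨P⟩ := hC.2.nonempty_parallelFrame hEs hgE
  rcases r with _ | r
  -- On forms of order zero insertions vanish by convention, and so does the divergence; both sides
  -- are zero.
  · rw [divergence_of_order_zero]
    have h1 : ∀ j, C.covTensor (fun q => insertion (α j q) (η q)) p (α' j p) = 0 := fun j =>
      SuperConnection.covTensor_zero hC.1 P _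
    have h2 : ∀ i, insertion (E' i p) (C.covTensor η p (E i p)) = 0 := fun i => rfl
    simp only [h1, h2, Finset.sum_const_zero, neg_zero, add_zero]
  · obtain ⟨e, he⟩ := exists_basis_of_reciprocal (finrank_tangentSpace p) hgE
    let β : Module.Basis (Fin m) ℝ W :=
      Module.Basis.mk (hbase.odd_independent p hp) (hbase.odd_span p hp).ge
    have hβ : ∀ j, β j = (α j p).2 := fun j => Module.Basis.mk_apply _ _ j
    have key := hC.divergence_eq P o hη (e := e) (e' := fun i => (E' i p).1)
      ⟨fun i j => by rw [he, hgE]⟩ (β := β) (β' := fun j => (α' j p).2)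
      ⟨fun i j => by rw [hβ, hgα]⟩ (α := α)
      (fun j => (hbase.smooth_odd j).smoothFieldNear hU hp) (fun j => by rw [hβ, ← hα0])
    simp only [he, ← hE0, ← hE0', ← hα0'] at key
    exact key
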